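/- For a string $S$ over the non-negative integers whose last letter occurs only once in $S$, the suffix tree $\mathsf{STree}(S)$ is the edge-labelled rooted tree such that (1) every internal node other than the root has at least two children, (2) the labels of the edges leaving a node begin with mutually distinct letters, (3) every edge label is a non-empty substring of $S$, and (4) the leaves correspond one-to-one to the non-empty suffixes of $S$, the path from the root to a leaf spelling out the corresponding suffix. It is stored as a table with one record of six words per node: pointers to the parent, to the first child and to the next sibling (children in any order), a pair $(i,j)$ of positions representing the label $S[i..j]$ of the incoming edge, and, at a leaf, the starting position of its suffix. Algorithms are programs of a unit-cost random access machine with constants, addition, truncated subtraction, indirect memory access, and (conditional) jumps. The input array is read-only, the working memory is initially zero, and all words in registers and working memory must stay polynomially bounded in $n$, i.e. consist of $O(\log n)$ bits. Let $c$ be a fixed natural number. There are a preprocessing program, an insertion program, and constants $C$ and $d$, depending only on $c$, such that the following holds for every $n \ge 0$ and every string $T$ of length $n$ over the integer alphabet $\{1,\dots,(n+2)^c\}$. Let $T^R$ be the reversal of $T$ and let $\# = 0$. Let the input consist of $n$, the string $T^R\#$ and a table storing the full suffix tree $\mathsf{STree}(T^R\#)$, with nodes $1,\dots,N$ in an arbitrary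 numbering. Run the preprocessing program once, and then run the insertion program $n$ times, for $k = n, n-1, \dots, 1$. Then: * after the preprocessing, the working memory holds $\mathsf{STree}(\#)$, and after the run of the insertion program for $k$ (which inserts the leaf for the suffix $T^R[k..n]\#$) it holds $\mathsf{STree}(T^R[k..n]\#)$, in the format above, where the position pairs representing the edge labels are positions in $T^R\#$ that are at least $k$; * each of the $n$ runs of the insertion program takes at most $C$ steps, i.e. $O(1)$ time per leaf insertion in the worst case; * the total number of steps, including the preprocessing, is at most $C(n+1)$, i.e. $O(n)$; * all words in registers and working memory are at most $(n+2)^d$ throughout. -/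

import Mathlib

namespace GrowingSuffixTree

/-! ### Suffix trees -/

/-- A finite rooted tree whose nodes are natural numbers and whose edges carry strings.
`label v` is the label of the edge from `parent v` to `v`; the values of `parent` and `label`
at the root and outside `nodes` are irrelevant. -/
structure EdgeTree where
  nodes : Finset ℕ
  root : ℕ
  parent : ℕ → ℕ
  label : ℕ → List ℕ
  root_mem : root ∈ nodes
  parent_mem : ∀ v ∈ nodes, v ≠ root → parent v ∈ nodes
  reaches_root : ∀ v ∈ nodes, ∃ m : ℕ, parent^[m] v = root

namespace EdgeTree

/-- `v` is a child of `u`. -/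
def IsChild (t : EdgeTree) (u v : ℕ) : Prop :=
  v ∈ t.nodes ∧ v ≠ t.root ∧ t.parent v = u

/-- `v` is a leaf, i.e. a node without children. -/
def IsLeaf (t : EdgeTree) (v : ℕ) : Prop :=
  v ∈ t.nodes ∧ ∀ w, ¬ t.IsChild v w

/-- `t.Spells v s`: the path from the root to the node `v` spells out the string `s`. -/
inductive Spells (t : EdgeTree) : ℕ → List ℕ → Prop
  | root : Spells t t.root []
  | edge (v : ℕ) (s : List ℕ) (hv : v ∈ t.nodes) (hr : v ≠ t.root)
      (hs : Spells t (t.parent v) s) : Spells t v (s ++ t.label v)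

/-- `t` is the suffix tree of the nonempty string `S` (whose last character is unique in `S`).
The root is exempt from the branching condition, so that a one-letter string has
a suffix tree; for longer strings with a unique last letter the root branches automatically. -/
structure IsSuffixTree (t : EdgeTree) (S : List ℕ) : Prop where
  branching : ∀ u ∈ t.nodes, u ≠ t.root → ¬ t.IsLeaf u →
    ∃ v w, v ≠ w ∧ t.IsChild u v ∧ t.IsChild u w
  distinct : ∀ u v w, t.IsChild u v → t.IsChild u w →
    (t.label v).head? = (t.label w).head? → v = w
  label_ne_nil : ∀ v ∈ t.nodes, v ≠ t.root → t.label v ≠ []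
  label_infix : ∀ v ∈ t.nodes, v ≠ t.root → t.label v <:+: S
  suffix_leaf : ∀ s, s ≠ [] → s <:+ S → ∃! v, t.IsLeaf v ∧ t.Spells v s
  leaf_suffix : ∀ v, t.IsLeaf v → ∃ s, s ≠ [] ∧ s <:+ S ∧ t.Spells v s

end EdgeTree

/-! ### Storing a suffix tree in memory -/

/-- `S[i..j]`, with positions counted from 1. -/
def substr (S : List ℕ) (i j : ℕ) : List ℕ := (S.drop (i - 1)).take (j + 1 - i)

/-- `S[k..|S|]`, with positions counted from 1. -/
def suffixFrom (S : List ℕ) (k : ℕ) : List ℕ := S.drop (k - 1)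

/-- Following the pointers `next` from `p` until the null pointer `0` visits exactly the
entries of the list, in this order. -/
def PointerChain (next : ℕ → ℕ) : ℕ → List ℕ → Prop
  | p, [] => p = 0
  | p, v :: l => p = v ∧ v ≠ 0 ∧ PointerChain next (next v) l

/-- The record of node `v` in a table starting at address `base` consists of six words:
field `0`: parent, field `1`: first child, field `2`: next sibling (`0` is the null pointer),
fields `3` and `4`: the pair `(i, j)` representing the label of the incoming edge,
field `5`: the start position of the suffix represented by a leaf (`0` at internal nodes). -/
def field (m : ℕ → ℕ) (base v f : ℕ) : ℕ := m (base + 6 * v + f)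

/-- The table at address `base` of the memory `m` stores the tree `t`.
All positions are positions in `S`, and all of them lie in `S[k..|S|]`. -/
structure StoresTree (m : ℕ → ℕ) (base : ℕ) (t : EdgeTree) (S : List ℕ) (k : ℕ) : Prop where
  null_not_mem : 0 ∉ t.nodes
  root_fields : field m base t.root 0 = 0 ∧ field m base t.root 2 = 0 ∧
    field m base t.root 3 = 0 ∧ field m base t.root 4 = 0
  parent_eq : ∀ v ∈ t.nodes, v ≠ t.root → field m base v 0 = t.parent v
  children : ∀ u ∈ t.nodes, ∃ l : List ℕ, l.Nodup ∧ (∀ v, v ∈ l ↔ t.IsChild u v) ∧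
    PointerChain (fun v => field m base v 2) (field m base u 1) l
  label_eq : ∀ v ∈ t.nodes, v ≠ t.root →
    k ≤ field m base v 3 ∧ field m base v 3 ≤ field m base v 4 ∧
    field m base v 4 ≤ S.length ∧
    t.label v = substr S (field m base v 3) (field m base v 4)
  leaf_eq : ∀ v, t.IsLeaf v →
    k ≤ field m base v 5 ∧ field m base v 5 ≤ S.length ∧
    t.Spells v (suffixFrom S (field m base v 5))
  internal_eq : ∀ v ∈ t.nodes, ¬ t.IsLeaf v → field m base v 5 = 0

/-- The input array: the number `n`, the number of nodes, the root, then `S` (of length `n + 1`)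
in the cells `3, …, n + 3`, then the node table at base address `n + 4`, storing the suffix tree
of `S` with nodes `1, …, N` in any numbering, with any order of children and any choice of the
pairs representing the labels. Nothing is assumed about the other cells. -/
def IsInput (inp : ℕ → ℕ) (S : List ℕ) (n : ℕ) : Prop :=
  ∃ t : EdgeTree, ∃ N : ℕ,
    t.IsSuffixTree S ∧ t.nodes = Finset.Icc 1 N ∧
    inp 0 = n ∧ inp 1 = N ∧ inp 2 = t.root ∧
    (∀ (i : ℕ) (hi : i < S.length), inp (3 + i) = S[i]) ∧
    StoresTree inp (n + 4) t S 1

/-- The working memory holds the suffix tree of `S[k..|S|]`: cell `0` contains the base address of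
the node table and cell `1` the root. -/
def HoldsSuffixTree (mem : ℕ → ℕ) (S : List ℕ) (k : ℕ) : Prop :=
  ∃ t : EdgeTree, t.IsSuffixTree (suffixFrom S k) ∧ mem 1 = t.root ∧
    StoresTree mem (mem 0) t S k

/-! ### Random access machines -/

/-- Instructions of a random access machine with registers, a working memory and a read-only
input array. -/
inductive Instr where
  /-- `reg d := c` -/
  | const (d c : ℕ)
  /-- `reg d := reg a + reg b` -/
  | add (d a b : ℕ)
  /-- `reg d := max (reg a - reg b) 0` -/
  | sub (d a b : ℕ)
  /-- `reg d := inp[reg a]` -/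
  | read (d a : ℕ)
  /-- `reg d := mem[reg a]` -/
  | load (d a : ℕ)
  /-- `mem[reg a] := reg b` -/
  | store (a b : ℕ)
  /-- continue at instruction `l` -/
  | jump (l : ℕ)
  /-- continue at instruction `l` if `reg a < reg b` -/
  | jumpLt (a b l : ℕ)
  /-- continue at instruction `l` if `reg a = reg b` -/
  | jumpEq (a b l : ℕ)

/-- A program; it halts when the program counter leaves the list. -/
abbrev Program := List Instr

/-- Registers and working memory. -/
structure Store where
  reg : ℕ → ℕ
  mem : ℕ → ℕ

/-- All registers and memory cells are zero. -/
def Store.empty : Store := ⟨fun _ => 0, fun _ => 0⟩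

/-- All words in the store are at most `W`. -/
def Store.FitsIn (s : Store) (W : ℕ) : Prop := (∀ i, s.reg i ≤ W) ∧ ∀ i, s.mem i ≤ W

/-- Program counter and store. -/
structure Config where
  pc : ℕ
  st : Store

/-- Write the value `x` to register `d` and go to the next instruction. -/
def Config.setReg (c : Config) (d x : ℕ) : Config :=
  ⟨c.pc + 1, ⟨Function.update c.st.reg d x, c.st.mem⟩⟩

/-- The effect of one instruction. -/
def Instr.exec (inp : ℕ → ℕ) (c : Config) : Instr → Config
  | .const d x => c.setReg d x
  | .add d a b => c.setReg d (c.st.reg a + c.st.reg b)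
  | .sub d a b => c.setReg d (c.st.reg a - c.st.reg b)
  | .read d a => c.setReg d (inp (c.st.reg a))
  | .load d a => c.setReg d (c.st.mem (c.st.reg a))
  | .store a b => ⟨c.pc + 1, ⟨c.st.reg, Function.update c.st.mem (c.st.reg a) (c.st.reg b)⟩⟩
  | .jump l => ⟨l, c.st⟩
  | .jumpLt a b l => ⟨if c.st.reg a < c.st.reg b then l else c.pc + 1, c.st⟩
  | .jumpEq a b l => ⟨if c.st.reg a = c.st.reg b then l else c.pc + 1, c.st⟩

/-- One step of a program; a halted configuration stays as it is. -/
def Program.step (P : Program) (inp : ℕ → ℕ) (c : Config) : Config :=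
  match P[c.pc]? with
  | some i => i.exec inp c
  | none => c

/-- Started at its first instruction in the store `s`, the program `P` halts after at most `τ`
steps, it ends in the store `s'`, and all words stay bounded by `W`. -/
def Program.Runs (P : Program) (inp : ℕ → ℕ) (W τ : ℕ) (s s' : Store) : Prop :=
  P.length ≤ ((P.step inp)^[τ] ⟨0, s⟩).pc ∧ ((P.step inp)^[τ] ⟨0, s⟩).st = s' ∧
    ∀ i ≤ τ, ((P.step inp)^[i] ⟨0, s⟩).st.FitsIn W

end GrowingSuffixTree

namespace GrowingSuffixTree

/-! ### A structured language compiled to the random access machine -/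

/-! The final tree is part of the input, so the insertions can be obtained by running deletions
backwards. Let `S` be the reversed text followed by `0`. Deleting from the suffix tree of `S` the
leaves of `S[1..]`, `S[2..]`, … in this order produces the trees of `S[2..]`, `S[3..]`, …. The
preprocessing performs all `n` deletions and logs each overwritten table cell with its old value; an
insertion merely writes one log record back, which takes constant time in the worst case.

Deletion. The leaf `x` of the longest suffix has a sibling (`IsSuffixTreeAt.exists_sibling`), so its
parent `u` does not become a leaf, and `u` is the only node that can stop branching
(`IsSuffixTreeAt.eraseLeaf`). If `u` is not the root and keeps just one child `w`, then `w` takes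
its place (`IsSuffixTreeAt.splice`). No search is needed: a table gives the leaf of every start
position, and every node other than the root knows the address of the cell that points to it. The
records of removed nodes are left intact, so at most five table cells need to be logged: the
pointers to `x` and to `u`, and the next sibling, the parent and the label start of `w`.

Labels. The position pairs must lie in `S[k..]` when the tree of `S[k..]` is stored. Therefore each
label is taken from the last occurrence in `S` of the string of its lower node. A node of the tree
of `S[k..]` has an occurrence that starts at or after `k`, so its last one does too (`Rep.holds`).
The last occurrences are found by climbing from the leaves in decreasing order of start positions
and stopping at nodes visited before: the first visit to a node comes from its last occurrence, and
every edge is climbed once (`Source.climb`, `Source.climbLoop`).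

Memory. The tree table occupies the cells below `A = 6 * N + 6`. From `A` on there are blocks of 16
cells: block `i` has at offset 0 the leaf with start `i`, at offset 1 the back pointer of node `i`,
at offset 2 the mark of node `i`, and at offsets 4 to 13 the log of the `i`th deletion. Insertions
restore only cells below `A`, since back pointers and marks serve the preprocessing alone.

The programs are written in a small structured language with a cost semantics, and `Cmd.Exec.runs`
transfers executions to the machine. The time and space are linear because `N ≤ 2 * (n + 1)`
(`card_nodes`). -/

/-- Expressions over variables, working memory and input. -/
inductive Expr where
  | lit (x : ℕ)
  | var (i : ℕ)
  | add (a b : Expr)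
  | sub (a b : Expr)
  | six (a : Expr)
  | sixteen (a : Expr)
  | mem (a : Expr)
  | inp (a : Expr)

namespace Expr

/-- The value of an expression. -/
def val (inp v m : ℕ → ℕ) : Expr → ℕ
  | lit x => x
  | var i => v i
  | add a b => a.val inp v m + b.val inp v m
  | sub a b => a.val inp v m - b.val inp v m
  | six a => 6 * a.val inp v m
  | sixteen a => 16 * a.val inp v m
  | mem a => m (a.val inp v m)
  | .inp a => inp (a.val inp v m)

/-- All values occurring in the evaluation are at most `W`, provided that variables and
working memory are. -/
def Fits (inp : ℕ → ℕ) (W : ℕ) (v m : ℕ → ℕ) : Expr → Prop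
  | lit x => x ≤ W
  | var _ => True
  | add a b => a.Fits inp W v m ∧ b.Fits inp W v m ∧ a.val inp v m + b.val inp v m ≤ W
  | sub a b => a.Fits inp W v m ∧ b.Fits inp W v m
  | six a => a.Fits inp W v m ∧ 6 * a.val inp v m ≤ W
  | sixteen a => a.Fits inp W v m ∧ 16 * a.val inp v m ≤ W
  | mem a => a.Fits inp W v m
  | .inp a => a.Fits inp W v m ∧ inp (a.val inp v m) ≤ W

/-- Code that evaluates an expression into register `2 * t + 1`, using only odd registers from
there on as scratch space; variable `i` lives in register `2 * i`. -/
def compile : Expr → ℕ → List Instr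
  | lit x, t => [.const (2 * t + 1) x]
  | var i, t => [.const (2 * t + 1) 0, .add (2 * t + 1) (2 * i) (2 * t + 1)]
  | add a b, t =>
    a.compile t ++ (b.compile (t + 1) ++ [.add (2 * t + 1) (2 * t + 1) (2 * (t + 1) + 1)])
  | sub a b, t =>
    a.compile t ++ (b.compile (t + 1) ++ [.sub (2 * t + 1) (2 * t + 1) (2 * (t + 1) + 1)])
  -- The next scratch register receives `2a`; then `a + 2a` is formed and doubled.
  | six a, t => a.compile t ++ [.add (2 * (t + 1) + 1) (2 * t + 1) (2 * t + 1),
      .add (2 * t + 1) (2 * t + 1) (2 * (t + 1) + 1), .add (2 * t + 1) (2 * t + 1) (2 * t + 1)]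
  | sixteen a, t => a.compile t ++ List.replicate 4 (.add (2 * t + 1) (2 * t + 1) (2 * t + 1))
  | mem a, t => a.compile t ++ [.load (2 * t + 1) (2 * t + 1)]
  | .inp a, t => a.compile t ++ [.read (2 * t + 1) (2 * t + 1)]

end Expr

/-- The code `l` occurs in the program `P` at position `off`. -/
def HasCode (P : Program) (off : ℕ) (l : List Instr) : Prop :=
  ∀ i x, l[i]? = some x → P[off + i]? = some x

theorem HasCode.left {P : Program} {off : ℕ} {a b : List Instr} (h : HasCode P off (a ++ b)) :
    HasCode P off a := fun i x hx => h i x (by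
  have := (List.getElem?_eq_some_iff.1 hx).1
  rw [List.getElem?_append_left this, hx])

theorem HasCode.right {P : Program} {off : ℕ} {a b : List Instr} (h : HasCode P off (a ++ b)) :
    HasCode P (off + a.length) b := fun i x hx => by
  have := h (a.length + i) x (by rw [List.getElem?_append_right (by omega)]; simpa using hx)
  rwa [← add_assoc] at this

theorem HasCode.head {P : Program} {off : ℕ} {x : Instr} {b : List Instr}
    (h : HasCode P off (x :: b)) : P[off]? = some x := h 0 x rfl

theorem HasCode.tail {P : Program} {off : ℕ} {x : Instr} {b : List Instr}
    (h : HasCode P off (x :: b)) : HasCode P (off + 1) b := HasCode.right (a := [x]) h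

/-- `t` steps lead from `c` to `c'`, with all words bounded by `W`. -/
def Steps (P : Program) (inp : ℕ → ℕ) (W t : ℕ) (c c' : Config) : Prop :=
  (P.step inp)^[t] c = c' ∧ ∀ i ≤ t, ((P.step inp)^[i] c).st.FitsIn W

theorem Steps.refl {P : Program} {inp : ℕ → ℕ} {W : ℕ} {c : Config} (h : c.st.FitsIn W) :
    Steps P inp W 0 c c := ⟨rfl, fun i hi => by rwa [Nat.le_zero.1 hi]⟩

theorem Steps.trans {P : Program} {inp : ℕ → ℕ} {W t u : ℕ} {c c' c'' : Config}
    (h : Steps P inp W t c c') (h' : Steps P inp W u c' c'') : Steps P inp W (t + u) c c'' := by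
  refine ⟨by rw [add_comm, Function.iterate_add_apply, h.1, h'.1], fun i hi => ?_⟩
  by_cases hit : i ≤ t
  · exact h.2 i hit
  · obtain ⟨j, rfl⟩ : ∃ j, i = j + t := ⟨i - t, by omega⟩
    rw [Function.iterate_add_apply, h.1]
    exact h'.2 j (by omega)

theorem Steps.fits {P : Program} {inp : ℕ → ℕ} {W t : ℕ} {c c' : Config}
    (h : Steps P inp W t c c') : c'.st.FitsIn W := h.1 ▸ h.2 t le_rfl

theorem Steps.one {P : Program} {inp : ℕ → ℕ} {W : ℕ} {c : Config} {x : Instr}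
    (hx : P[c.pc]? = some x) (h : c.st.FitsIn W) (h' : (x.exec inp c).st.FitsIn W) :
    Steps P inp W 1 c (x.exec inp c) := by
  have hs : P.step inp c = x.exec inp c := by simp [Program.step, hx]
  refine ⟨hs, fun i hi => ?_⟩
  rcases (by omega : i = 0 ∨ i = 1) with rfl | rfl
  · exact h
  · simpa [hs] using h'

theorem Store.FitsIn.setReg {c : Config} {W d x : ℕ} (h : c.st.FitsIn W) (hx : x ≤ W) :
    (c.setReg d x).st.FitsIn W := by
  refine ⟨fun i => ?_, h.2⟩
  simp only [Config.setReg, Function.update_apply]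
  split_ifs
  · exact hx
  · exact h.1 i

theorem Steps.setReg {P : Program} {inp : ℕ → ℕ} {W t : ℕ} {c c' : Config} {x : Instr} {d y : ℕ}
    (h : Steps P inp W t c c') (hx : P[c'.pc]? = some x)
    (he : x.exec inp c' = c'.setReg d y) (hy : y ≤ W) :
    Steps P inp W (t + 1) c (c'.setReg d y) :=
  h.trans (he ▸ Steps.one hx h.fits (he ▸ h.fits.setReg hy))

/-- The registers `r'` arise from `r` by evaluating an expression with value `x` to scratch
register `t`. -/
def Scratch (r r' : ℕ → ℕ) (t x : ℕ) : Prop :=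
  r' (2 * t + 1) = x ∧ (∀ i, r' (2 * i) = r (2 * i)) ∧ ∀ i < t, r' (2 * i + 1) = r (2 * i + 1)

/-- Evaluation at level `t` leaves the scratch registers below `t` alone, so the first operand of a
binary operation survives the evaluation of the second one at level `t + 1`. -/
theorem Expr.compile_steps {P : Program} {inp : ℕ → ℕ} {W : ℕ} (e : Expr) :
    ∀ (t off : ℕ) (r v m : ℕ → ℕ), (∀ i, r (2 * i) = v i) → Store.FitsIn ⟨r, m⟩ W →
      e.Fits inp W v m → HasCode P off (e.compile t) →
      ∃ r', Steps P inp W (e.compile t).length ⟨off, r, m⟩ ⟨off + (e.compile t).length, r', m⟩ ∧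
        Scratch r r' t (e.val inp v m) := by
  induction e with
  | lit x =>
    intro t off r v m hr hf he hc
    exact ⟨_, (Steps.refl hf).setReg hc.head rfl he, by simp [Expr.val],
      fun i => Function.update_of_ne (by omega) _ _,
      fun i hi => Function.update_of_ne (by omega) _ _⟩
  | var i =>
    intro t off r v m hr hf he hc
    refine ⟨_, ((Steps.refl hf).setReg hc.head rfl (Nat.zero_le _)).setReg hc.tail.head rfl ?_,
      ?_, fun j => ?_, fun j hj => ?_⟩
    · have := hf.1 (2 * i)
      have h2 : 2 * i ≠ 2 * t + 1 := by omega
      simpa [Config.setReg, Function.update_apply, h2] using this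
    · have h2 : 2 * i ≠ 2 * t + 1 := by omega
      simp [Config.setReg, h2, hr, Expr.val]
    · have h2 : 2 * j ≠ 2 * t + 1 := by omega
      simp [Config.setReg, Function.update_apply, h2]
    · have h4 : j ≠ t := by omega
      simp [Config.setReg, h4]
  | add a b iha ihb =>
    intro t off r v m hr hf he hc
    obtain ⟨r1, hs1, h1, h1', h1''⟩ := iha t off r v m hr hf he.1 hc.left
    obtain ⟨r2, hs2, h2, h2', h2''⟩ := ihb (t + 1) _ r1 v m (fun i => by rw [h1', hr]) hs1.fits
      he.2.1 hc.right.left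
    have hv : r2 (2 * t + 1) + r2 (2 * (t + 1) + 1) = (Expr.add a b).val inp v m := by
      rw [h2'' t (by omega), h1, h2]; rfl
    have := (hs1.trans hs2).setReg (x := .add (2 * t + 1) (2 * t + 1) (2 * (t + 1) + 1))
      hc.right.right.head rfl (by rw [hv]; exact he.2.2)
    refine ⟨_, by simpa [Expr.compile, Config.setReg, add_assoc] using this,
      by simpa [Function.update_apply] using hv, fun j => ?_, fun j hj => ?_⟩
    · have h2 : 2 * j ≠ 2 * t + 1 := by omega
      simp [h2, h2', h1']
    · have h2 : 2 * j + 1 ≠ 2 * t + 1 := by omega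
      rw [Function.update_apply, if_neg h2, h2'' j (by omega), h1'' j hj]
  | sub a b iha ihb =>
    intro t off r v m hr hf he hc
    obtain ⟨r1, hs1, h1, h1', h1''⟩ := iha t off r v m hr hf he.1 hc.left
    obtain ⟨r2, hs2, h2, h2', h2''⟩ := ihb (t + 1) _ r1 v m (fun i => by rw [h1', hr]) hs1.fits
      he.2 hc.right.left
    have hv : r2 (2 * t + 1) - r2 (2 * (t + 1) + 1) = (Expr.sub a b).val inp v m := by
      rw [h2'' t (by omega), h1, h2]; rfl
    have := (hs1.trans hs2).setReg (x := .sub (2 * t + 1) (2 * t + 1) (2 * (t + 1) + 1))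
      hc.right.right.head rfl ((Nat.sub_le _ _).trans (hs2.fits.1 _))
    refine ⟨_, by simpa [Expr.compile, Config.setReg, add_assoc] using this,
      by simpa [Function.update_apply] using hv, fun j => ?_, fun j hj => ?_⟩
    · have h2 : 2 * j ≠ 2 * t + 1 := by omega
      simp [h2, h2', h1']
    · have h2 : 2 * j + 1 ≠ 2 * t + 1 := by omega
      rw [Function.update_apply, if_neg h2, h2'' j (by omega), h1'' j hj]
  | six a iha =>
    intro t off r v m hr hf he hc
    obtain ⟨r1, hs1, h1, h1', h1''⟩ := iha t off r v m hr hf he.1 hc.left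
    have hW := he.2
    rw [← h1] at hW
    have e1 : 2 * t + 1 ≠ 2 * (t + 1) + 1 := by omega
    have s1 := hs1.setReg (x := .add (2 * (t + 1) + 1) (2 * t + 1) (2 * t + 1))
      hc.right.head rfl (by dsimp only; omega)
    have s2 := s1.setReg (x := .add (2 * t + 1) (2 * t + 1) (2 * (t + 1) + 1))
      hc.right.tail.head rfl (by simp [Config.setReg]; omega)
    have s3 := s2.setReg (x := .add (2 * t + 1) (2 * t + 1) (2 * t + 1))
      hc.right.tail.tail.head rfl (by simp [Config.setReg]; omega)
    refine ⟨_, by simpa [Expr.compile, Config.setReg, add_assoc] using s3,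
      by simp [Expr.val, h1]; omega, fun j => ?_, fun j hj => ?_⟩
    · have h2 : 2 * j ≠ 2 * t + 1 := by omega
      have h3 : 2 * j ≠ 2 * (t + 1) + 1 := by omega
      simp [h2, h3, h1']
    · have h2 : 2 * j + 1 ≠ 2 * t + 1 := by omega
      have h3 : 2 * j + 1 ≠ 2 * (t + 1) + 1 := by omega
      have h4 : j ≠ t := by omega
      have h5 : j ≠ t + 1 := by omega
      simp [h4, h5, h1'' j hj]
  | sixteen a iha =>
    intro t off r v m hr hf he hc
    obtain ⟨r1, hs1, h1, h1', h1''⟩ := iha t off r v m hr hf he.1 hc.left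
    have hW := he.2
    rw [← h1] at hW
    have s1 := hs1.setReg (x := .add (2 * t + 1) (2 * t + 1) (2 * t + 1))
      hc.right.head rfl (by dsimp only; omega)
    have s2 := s1.setReg (x := .add (2 * t + 1) (2 * t + 1) (2 * t + 1))
      hc.right.tail.head rfl (by simp [Config.setReg]; omega)
    have s3 := s2.setReg (x := .add (2 * t + 1) (2 * t + 1) (2 * t + 1))
      hc.right.tail.tail.head rfl (by simp [Config.setReg]; omega)
    have s4 := s3.setReg (x := .add (2 * t + 1) (2 * t + 1) (2 * t + 1))
      hc.right.tail.tail.tail.head rfl (by simp [Config.setReg]; omega)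
    refine ⟨_, by simpa [Expr.compile, Config.setReg, add_assoc] using s4,
      by simp [Expr.val, h1]; omega, fun j => ?_, fun j hj => ?_⟩
    · have h2 : 2 * j ≠ 2 * t + 1 := by omega
      simp [h2, h1']
    · have h4 : j ≠ t := by omega
      simp [h4, h1'' j hj]
  | mem a iha =>
    intro t off r v m hr hf he hc
    obtain ⟨r1, hs1, h1, h1', h1''⟩ := iha t off r v m hr hf he hc.left
    have s1 := hs1.setReg (x := .load (2 * t + 1) (2 * t + 1)) hc.right.head rfl (hf.2 _)
    refine ⟨_, by simpa [Expr.compile, Config.setReg, add_assoc] using s1,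
      by simp [Expr.val, h1], fun j => ?_, fun j hj => ?_⟩
    · have h2 : 2 * j ≠ 2 * t + 1 := by omega
      simp [h2, h1']
    · have h4 : j ≠ t := by omega
      simp [h4, h1'' j hj]
  | inp a iha =>
    intro t off r v m hr hf he hc
    obtain ⟨r1, hs1, h1, h1', h1''⟩ := iha t off r v m hr hf he.1 hc.left
    have s1 := hs1.setReg (x := .read (2 * t + 1) (2 * t + 1)) hc.right.head rfl
      (by dsimp only; rw [h1]; exact he.2)
    refine ⟨_, by simpa [Expr.compile, Config.setReg, add_assoc] using s1,
      by simp [Expr.val, h1], fun j => ?_, fun j hj => ?_⟩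
    · have h2 : 2 * j ≠ 2 * t + 1 := by omega
      simp [h2, h1']
    · have h4 : j ≠ t := by omega
      simp [h4, h1'' j hj]

/-! ### Commands, their cost semantics and their compilation -/

/-- Structured commands. -/
inductive Cmd where
  | set (i : ℕ) (e : Expr)
  | store (a e : Expr)
  | seq (c d : Cmd)
  | ifEq (a b : Expr) (c d : Cmd)
  | whileNe (a b : Expr) (c : Cmd)

infixr:60 " ;; " => Cmd.seq

namespace Cmd

/-- The length of the compiled code. -/
def size : Cmd → ℕ
  | set _ e => (e.compile 0).length + 2
  | store a e => (a.compile 0).length + (e.compile 1).length + 1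
  | seq c d => c.size + d.size
  | ifEq a b c d => (a.compile 0).length + (b.compile 1).length + 2 + c.size + d.size
  | whileNe a b c => (a.compile 0).length + (b.compile 1).length + 2 + c.size

/-- Compilation of a command to code placed at position `off`. -/
def compile : Cmd → ℕ → List Instr
  -- The machine has no move instruction, so the value is copied by adding `0`.
  | set i e, _ => e.compile 0 ++ [.const 3 0, .add (2 * i) 1 3]
  | store a e, _ => a.compile 0 ++ (e.compile 1 ++ [.store 1 3])
  | seq c d, off => c.compile off ++ d.compile (off + c.size)
  | ifEq a b c d, off =>
    let k := off + (a.compile 0).length + (b.compile 1).length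
    a.compile 0 ++ (b.compile 1 ++ (Instr.jumpEq 1 3 (k + 1 + d.size + 1) ::
      (d.compile (k + 1) ++ (Instr.jump (k + 1 + d.size + 1 + c.size) ::
        c.compile (k + 1 + d.size + 1)))))
  | whileNe a b c, off =>
    let k := off + (a.compile 0).length + (b.compile 1).length
    a.compile 0 ++ (b.compile 1 ++ (Instr.jumpEq 1 3 (k + 1 + c.size + 1) ::
      (c.compile (k + 1) ++ [Instr.jump off])))

theorem length_compile (c : Cmd) : ∀ off, (c.compile off).length = c.size := by
  induction c with
  | set i e => intro off; simp [compile, size]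
  | store a e => intro off; simp [compile, size]; omega
  | seq c d hc hd => intro off; simp [compile, size, hc, hd]
  | ifEq a b c d hc hd => intro off; simp [compile, size, hc, hd]; omega
  | whileNe a b c hc => intro off; simp [compile, size, hc]; omega

/-- Big-step semantics; the last argument is the number of machine steps. -/
inductive Exec (inp : ℕ → ℕ) (W : ℕ) :
    Cmd → (ℕ → ℕ) → (ℕ → ℕ) → (ℕ → ℕ) → (ℕ → ℕ) → ℕ → Prop
  | set {i e v m} (he : e.Fits inp W v m) :
      Exec inp W (set i e) v m (Function.update v i (e.val inp v m)) m (set i e).size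
  | store {a e v m} (ha : a.Fits inp W v m) (he : e.Fits inp W v m) :
      Exec inp W (store a e) v m v (Function.update m (a.val inp v m) (e.val inp v m))
        (store a e).size
  | seq {c d v m v' m' v'' m'' t t'} (hc : Exec inp W c v m v' m' t)
      (hd : Exec inp W d v' m' v'' m'' t') : Exec inp W (c ;; d) v m v'' m'' (t + t')
  | ifTrue {a b c d v m v' m' t} (ha : a.Fits inp W v m) (hb : b.Fits inp W v m)
      (h : a.val inp v m = b.val inp v m) (hc : Exec inp W c v m v' m' t) :
      Exec inp W (ifEq a b c d) v m v' m' ((a.compile 0).length + (b.compile 1).length + 1 + t)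
  | ifFalse {a b c d v m v' m' t} (ha : a.Fits inp W v m) (hb : b.Fits inp W v m)
      (h : a.val inp v m ≠ b.val inp v m) (hd : Exec inp W d v m v' m' t) :
      Exec inp W (ifEq a b c d) v m v' m' ((a.compile 0).length + (b.compile 1).length + 2 + t)
  | whileDone {a b c v m} (ha : a.Fits inp W v m) (hb : b.Fits inp W v m)
      (h : a.val inp v m = b.val inp v m) :
      Exec inp W (whileNe a b c) v m v m ((a.compile 0).length + (b.compile 1).length + 1)
  | whileStep {a b c v m v' m' v'' m'' t t'} (ha : a.Fits inp W v m) (hb : b.Fits inp W v m)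
      (h : a.val inp v m ≠ b.val inp v m) (hc : Exec inp W c v m v' m' t)
      (hw : Exec inp W (whileNe a b c) v' m' v'' m'' t') :
      Exec inp W (whileNe a b c) v m v'' m''
        ((a.compile 0).length + (b.compile 1).length + 2 + t + t')

end Cmd

theorem compile_pair_steps {P : Program} {inp : ℕ → ℕ} {W : ℕ} {a b : Expr} {off : ℕ}
    {r v m : ℕ → ℕ} {l : List Instr} (hr : ∀ i, r (2 * i) = v i) (hf : Store.FitsIn ⟨r, m⟩ W)
    (ha : a.Fits inp W v m) (hb : b.Fits inp W v m)
    (hc : HasCode P off (a.compile 0 ++ (b.compile 1 ++ l))) :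
    ∃ r', Steps P inp W ((a.compile 0).length + (b.compile 1).length) ⟨off, r, m⟩
        ⟨off + (a.compile 0).length + (b.compile 1).length, r', m⟩ ∧
      r' 1 = a.val inp v m ∧ r' 3 = b.val inp v m ∧ ∀ i, r' (2 * i) = v i := by
  obtain ⟨r1, hs1, h1, h1', h1''⟩ := a.compile_steps 0 off r v m hr hf ha hc.left
  obtain ⟨r2, hs2, h2, h2', h2''⟩ := b.compile_steps 1 _ r1 v m (fun i => by rw [h1', hr]) hs1.fits
    hb hc.right.left
  exact ⟨r2, hs1.trans hs2, by rw [← h1]; exact h2'' 0 (by omega), h2, fun i => by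
    rw [h2', h1', hr]⟩

theorem Steps.jump {P : Program} {inp : ℕ → ℕ} {W t : ℕ} {c c' : Config} {x : Instr} {l : ℕ}
    (h : Steps P inp W t c c') (hx : P[c'.pc]? = some x)
    (he : x.exec inp c' = ⟨l, c'.st⟩) :
    Steps P inp W (t + 1) c ⟨l, c'.st⟩ :=
  h.trans (he ▸ Steps.one hx h.fits (he ▸ h.fits))

theorem Steps.cast {P : Program} {inp : ℕ → ℕ} {W t t' o o' : ℕ} {c : Config} {s : Store}
    (h : Steps P inp W t c ⟨o, s⟩) (ht : t = t') (ho : o = o') : Steps P inp W t' c ⟨o', s⟩ :=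
  ht ▸ ho ▸ h

/-- Induction on the execution. Only the even registers are tracked; the odd ones are scratch, which
is why the final register file is existentially quantified. -/
theorem Cmd.Exec.steps {P : Program} {inp : ℕ → ℕ} {W t : ℕ} {c : Cmd} {v m v' m' : ℕ → ℕ}
    (h : Cmd.Exec inp W c v m v' m' t) :
    ∀ (off : ℕ) (r : ℕ → ℕ), (∀ i, r (2 * i) = v i) → Store.FitsIn ⟨r, m⟩ W →
      HasCode P off (c.compile off) →
      ∃ r', Steps P inp W t ⟨off, r, m⟩ ⟨off + c.size, r', m'⟩ ∧ ∀ i, r' (2 * i) = v' i := by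
  induction h with
  | @set i e v m he =>
    intro off r hr hf hc
    obtain ⟨r1, hs1, h1, h1', h1''⟩ := e.compile_steps 0 off r v m hr hf he hc.left
    have h1 : r1 1 = e.val inp v m := h1
    have s1 := hs1.setReg (x := .const 3 0) hc.right.head rfl (Nat.zero_le _)
    have s2 := s1.setReg (x := .add (2 * i) 1 3) hc.right.tail.head rfl
      (by simpa [Config.setReg] using hs1.fits.1 _)
    refine ⟨_, s2.cast (by simp [size]) (by simp [size, Config.setReg]; omega), fun j => ?_⟩
    have h3 : ∀ j, 2 * j ≠ 3 := by omega
    by_cases hj : j = i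
    · subst hj; simp [Config.setReg, h1]
    · simp [Config.setReg, hj, h3, h1', hr]
  | @store a e v m ha he =>
    intro off r hr hf hc
    obtain ⟨r1, hs, h1, h2, h3⟩ := compile_pair_steps hr hf ha he hc
    have s1 : Steps P inp W 1 ⟨off + (a.compile 0).length + (e.compile 1).length, r1, m⟩ _ :=
      Steps.one (x := .store 1 3) hc.right.right.head hs.fits ⟨hs.fits.1, fun i => by
        simp only [Instr.exec, Function.update_apply]
        split_ifs
        · exact hs.fits.1 _
        · exact hf.2 i⟩
    have := hs.trans s1
    simp only [Instr.exec, h1, h2] at this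
    exact ⟨r1, this.cast (by simp [size]) (by simp [size]; omega), h3⟩
  | seq _ _ ih1 ih2 =>
    intro off r hr hf hc
    obtain ⟨r1, hs1, h1⟩ := ih1 off r hr hf hc.left
    have hc2 := hc.right
    rw [length_compile] at hc2
    obtain ⟨r2, hs2, h2⟩ := ih2 _ r1 h1 hs1.fits hc2
    exact ⟨r2, (hs1.trans hs2).cast rfl (by simp [size]; omega), h2⟩
  | @ifTrue a b c d v m v' m' t ha hb h _ ih =>
    intro off r hr hf hc
    obtain ⟨r1, hs, h1, h2, h3⟩ := compile_pair_steps hr hf ha hb hc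
    have s1 := hs.jump hc.right.right.head (by simp [Instr.exec, h1, h2, h]; rfl)
    have hc2 := hc.right.right.tail.right.tail
    rw [length_compile] at hc2
    obtain ⟨r2, hs2, h4⟩ := ih _ r1 h3 s1.fits hc2
    exact ⟨r2, (s1.trans hs2).cast (by omega) (by simp [size]; omega), h4⟩
  | @ifFalse a b c d v m v' m' t ha hb h _ ih =>
    intro off r hr hf hc
    obtain ⟨r1, hs, h1, h2, h3⟩ := compile_pair_steps hr hf ha hb hc
    have s1 := hs.jump hc.right.right.head (by simp [Instr.exec, h1, h2, h]; rfl)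
    obtain ⟨r2, hs2, h4⟩ := ih _ r1 h3 s1.fits hc.right.right.tail.left
    have hc2 := hc.right.right.tail.right
    rw [length_compile] at hc2
    have s3 := (s1.trans hs2).jump hc2.head rfl
    exact ⟨r2, s3.cast (by omega) (by simp [size]; omega), h4⟩
  | @whileDone a b c v m ha hb h =>
    intro off r hr hf hc
    obtain ⟨r1, hs, h1, h2, h3⟩ := compile_pair_steps hr hf ha hb hc
    have s1 := hs.jump hc.right.right.head (by simp [Instr.exec, h1, h2, h]; rfl)
    exact ⟨r1, s1.cast (by omega) (by simp [size]; omega), h3⟩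
  | @whileStep a b c v m v' m' v'' m'' t t' ha hb h _ _ ih1 ih2 =>
    intro off r hr hf hc
    obtain ⟨r1, hs, h1, h2, h3⟩ := compile_pair_steps hr hf ha hb hc
    have s1 := hs.jump hc.right.right.head (by simp [Instr.exec, h1, h2, h]; rfl)
    obtain ⟨r2, hs2, h4⟩ := ih1 _ r1 h3 s1.fits hc.right.right.tail.left
    have hc2 := hc.right.right.tail.right
    rw [length_compile] at hc2
    have s3 := (s1.trans hs2).jump hc2.head rfl
    obtain ⟨r3, hs4, h5⟩ := ih2 off r2 h4 s3.fits hc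
    exact ⟨r3, (s3.trans hs4).cast (by omega) rfl, h5⟩

/-- A halting execution of a command is a run of the compiled program. -/
theorem Cmd.Exec.runs {inp : ℕ → ℕ} {W t T : ℕ} {c : Cmd} {v m v' m' : ℕ → ℕ}
    (h : Cmd.Exec inp W c v m v' m' t) (hT : t ≤ T) {r : ℕ → ℕ} (hr : ∀ i, r (2 * i) = v i)
    (hf : Store.FitsIn ⟨r, m⟩ W) :
    ∃ r', Program.Runs (c.compile 0) inp W T ⟨r, m⟩ ⟨r', m'⟩ ∧ ∀ i, r' (2 * i) = v' i := by
  obtain ⟨r', hs, hr'⟩ := h.steps (P := c.compile 0) 0 r hr hf (fun i x hx => by simpa using hx)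
  -- A halted configuration is a fixed point, so any time bound `T ≥ t` will do.
  have hl : ∀ j, (Program.step (c.compile 0) inp)^[j] ⟨0 + c.size, r', m'⟩ =
      ⟨0 + c.size, r', m'⟩ := fun j => by
    refine Function.iterate_fixed ?_ j
    have : (c.compile 0)[0 + c.size]? = none := by simp [length_compile]
    simp only [Program.step, this]
  have hl' : ∀ j, (Program.step (c.compile 0) inp)^[j + t] ⟨0, r, m⟩ =
      ⟨0 + c.size, r', m'⟩ := fun j => by
    rw [Function.iterate_add_apply, hs.1, hl]
  have hTt := hl' (T - t)
  rw [Nat.sub_add_cancel hT] at hTt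
  refine ⟨r', ⟨by rw [hTt, length_compile]; simp, by rw [hTt], fun i _ => ?_⟩, hr'⟩
  by_cases hit : i ≤ t
  · exact hs.2 i hit
  · have := hl' (i - t)
    rw [Nat.sub_add_cancel (by omega)] at this
    rw [this]; exact hs.fits

/-! ### Program logic: total correctness with time bounds -/

/-- `Q` holds after executing `c` for at most `T` steps. -/
def Cmd.Ends (inp : ℕ → ℕ) (W : ℕ) (c : Cmd) (v m : ℕ → ℕ) (T : ℕ)
    (Q : (ℕ → ℕ) → (ℕ → ℕ) → Prop) : Prop :=
  ∃ v' m' t, Cmd.Exec inp W c v m v' m' t ∧ t ≤ T ∧ Q v' m'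

theorem Cmd.Ends.seq {inp : ℕ → ℕ} {W : ℕ} {c d : Cmd} {v m : ℕ → ℕ} {T T' : ℕ}
    {R Q : (ℕ → ℕ) → (ℕ → ℕ) → Prop} (hc : Cmd.Ends inp W c v m T R)
    (hd : ∀ v m, R v m → Cmd.Ends inp W d v m T' Q) : Cmd.Ends inp W (c ;; d) v m (T + T') Q := by
  obtain ⟨v', m', t, h, ht, hR⟩ := hc
  obtain ⟨v'', m'', t', h', ht', hQ⟩ := hd _ _ hR
  exact ⟨v'', m'', _, h.seq h', by omega, hQ⟩

theorem Cmd.Ends.mono {inp : ℕ → ℕ} {W : ℕ} {c : Cmd} {v m : ℕ → ℕ} {T T' : ℕ}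
    {R Q : (ℕ → ℕ) → (ℕ → ℕ) → Prop} (hc : Cmd.Ends inp W c v m T R) (hT : T ≤ T')
    (hd : ∀ v m, R v m → Q v m) : Cmd.Ends inp W c v m T' Q := by
  obtain ⟨v', m', t, h, ht, hR⟩ := hc
  exact ⟨v', m', t, h, by omega, hd _ _ hR⟩

/-- Weakest preconditions of loop-free commands. -/
def Cmd.wp (inp : ℕ → ℕ) (W : ℕ) :
    Cmd → ((ℕ → ℕ) → (ℕ → ℕ) → Prop) → (ℕ → ℕ) → (ℕ → ℕ) → Prop
  | set i e, Q, v, m => e.Fits inp W v m ∧ Q (Function.update v i (e.val inp v m)) m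
  | store a e, Q, v, m => a.Fits inp W v m ∧ e.Fits inp W v m ∧
      Q v (Function.update m (a.val inp v m) (e.val inp v m))
  | seq c d, Q, v, m => c.wp inp W (d.wp inp W Q) v m
  | ifEq a b c d, Q, v, m => a.Fits inp W v m ∧ b.Fits inp W v m ∧
      (a.val inp v m = b.val inp v m → c.wp inp W Q v m) ∧
      (a.val inp v m ≠ b.val inp v m → d.wp inp W Q v m)
  | whileNe _ _ _, _, _, _ => False

/-- Reduces a loop-free block to one symbolic evaluation, its running time being at most the code
size. Loops have the precondition `False` and are treated by `exec_whileNe`. -/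
theorem Cmd.ends_of_wp {inp : ℕ → ℕ} {W : ℕ} {c : Cmd} :
    ∀ {v m : ℕ → ℕ} {Q : (ℕ → ℕ) → (ℕ → ℕ) → Prop}, c.wp inp W Q v m →
      Cmd.Ends inp W c v m c.size Q := by
  induction c with
  | set i e => intro v m Q h; exact ⟨_, _, _, .set h.1, le_rfl, h.2⟩
  | store a e => intro v m Q h; exact ⟨_, _, _, .store h.1 h.2.1, le_rfl, h.2.2⟩
  | seq c d hc hd => intro v m Q h; exact (hc h).seq fun v m h' => hd h'
  | ifEq a b c d hc hd =>
    intro v m Q h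
    by_cases hab : a.val inp v m = b.val inp v m
    · obtain ⟨v', m', t, h', ht, hQ⟩ := hc (h.2.2.1 hab)
      exact ⟨v', m', _, .ifTrue h.1 h.2.1 hab h', by simp [size]; omega, hQ⟩
    · obtain ⟨v', m', t, h', ht, hQ⟩ := hd (h.2.2.2 hab)
      exact ⟨v', m', _, .ifFalse h.1 h.2.1 hab h', by simp [size]; omega, hQ⟩
  | whileNe a b c hc => intro v m Q h; exact h.elim

/-- The rule for loops: `φ` bounds the time that remains. -/
theorem Cmd.exec_whileNe {inp : ℕ → ℕ} {W : ℕ} {a b : Expr} {c : Cmd}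
    {I : (ℕ → ℕ) → (ℕ → ℕ) → Prop} (φ : (ℕ → ℕ) → (ℕ → ℕ) → ℕ) (g : ℕ)
    (hg : (a.compile 0).length + (b.compile 1).length + 2 = g)
    (hI : ∀ v m, I v m → a.Fits inp W v m ∧ b.Fits inp W v m ∧
      (a.val inp v m ≠ b.val inp v m → ∃ v' m' t, Cmd.Exec inp W c v m v' m' t ∧
        t + g + φ v' m' ≤ φ v m ∧ I v' m')) :
    ∀ {v m : ℕ → ℕ}, I v m → ∃ v' m' t, Cmd.Exec inp W (.whileNe a b c) v m v' m' t ∧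
      t + φ v' m' ≤ φ v m + g ∧ I v' m' ∧ a.val inp v' m' = b.val inp v' m' := by
  suffices H : ∀ (k : ℕ) (v m : ℕ → ℕ), φ v m ≤ k → I v m →
      ∃ v' m' t, Cmd.Exec inp W (.whileNe a b c) v m v' m' t ∧
        t + φ v' m' ≤ φ v m + g ∧ I v' m' ∧ a.val inp v' m' = b.val inp v' m' from
    fun {v m} h => H _ v m le_rfl h
  intro k
  induction k with
  | zero =>
    intro v m hk hv
    obtain ⟨ha, hb, h⟩ := hI v m hv
    by_cases hab : a.val inp v m = b.val inp v m
    · exact ⟨v, m, _, .whileDone ha hb hab, by omega, hv, hab⟩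
    -- An iteration lowers `φ` by at least `g ≥ 2`, so none is possible when `φ` is zero.
    · obtain ⟨v', m', t, _, hφ, _⟩ := h hab
      omega
  | succ k ih =>
    intro v m hk hv
    obtain ⟨ha, hb, h⟩ := hI v m hv
    by_cases hab : a.val inp v m = b.val inp v m
    · exact ⟨v, m, _, .whileDone ha hb hab, by omega, hv, hab⟩
    · obtain ⟨v', m', t, hc, hφ, hv'⟩ := h hab
      obtain ⟨v'', m'', t', hw, ht', hQ⟩ := ih v' m' (by omega) hv'
      exact ⟨v'', m'', _, .whileStep ha hb hab hc hw, by omega, hQ⟩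

namespace EdgeTree

/-! ### Suffix trees -/

variable {t : EdgeTree}

/-- Induction from the root downwards, along the number of parent steps to the root. -/
theorem rec_on_nodes (t : EdgeTree) {P : ℕ → Prop} (h0 : P t.root)
    (h1 : ∀ v ∈ t.nodes, v ≠ t.root → P (t.parent v) → P v) : ∀ v ∈ t.nodes, P v := by
  intro v hv
  obtain ⟨m, hm⟩ := t.reaches_root v hv
  induction m generalizing v with
  | zero => exact (show v = t.root from hm) ▸ h0
  | succ m ih =>
    by_cases hr : v = t.root
    · exact hr ▸ h0
    · exact h1 v hv hr (ih _ (t.parent_mem v hv hr) (by simpa using hm))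

theorem Spells.mem {v : ℕ} {s : List ℕ} (h : t.Spells v s) : v ∈ t.nodes := by
  cases h with
  | root => exact t.root_mem
  | edge _ _ hv => exact hv

theorem exists_spells (t : EdgeTree) : ∀ v ∈ t.nodes, ∃ s, t.Spells v s :=
  t.rec_on_nodes ⟨[], .root⟩ fun v hv hr ⟨s, hs⟩ => ⟨_, .edge v s hv hr hs⟩

theorem Spells.unique {v : ℕ} {s s' : List ℕ} (h : t.Spells v s) (h' : t.Spells v s') :
    s = s' := by
  induction h generalizing s' with
  | root =>
    cases h' with
    | root => rfl
    | edge _ _ _ hr => exact absurd rfl hr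
  | edge v s hv hr _ ih =>
    cases h' with
    | root => exact absurd rfl hr
    | edge _ _ _ _ hs' => rw [ih hs']

open Classical in
/-- The string spelled out by the path from the root to a node. -/
noncomputable def str (t : EdgeTree) (v : ℕ) : List ℕ :=
  if h : ∃ s, t.Spells v s then h.choose else []

theorem spells_str {v : ℕ} (hv : v ∈ t.nodes) : t.Spells v (t.str v) := by
  have h := t.exists_spells v hv
  rw [str, dif_pos h]; exact h.choose_spec

theorem Spells.str_eq {v : ℕ} {s : List ℕ} (h : t.Spells v s) : t.str v = s :=
  (spells_str h.mem).unique h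

theorem str_root (t : EdgeTree) : t.str t.root = [] := Spells.root.str_eq

theorem str_eq {v : ℕ} (hv : v ∈ t.nodes) (hr : v ≠ t.root) :
    t.str v = t.str (t.parent v) ++ t.label v :=
  (Spells.edge v _ hv hr (spells_str (t.parent_mem v hv hr))).str_eq

/-- `t.Anc v w`: the node `v` lies on the path from the root to `w`. -/
inductive Anc (t : EdgeTree) (v : ℕ) : ℕ → Prop
  | refl : Anc t v v
  | step (w : ℕ) (hw : w ∈ t.nodes) (hr : w ≠ t.root) (h : Anc t v (t.parent w)) : Anc t v w

theorem root_anc (t : EdgeTree) : ∀ v ∈ t.nodes, t.Anc t.root v :=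
  t.rec_on_nodes .refl fun v hv hr h => .step v hv hr h

theorem Anc.prefix {v w : ℕ} (h : t.Anc v w) : t.str v <+: t.str w := by
  induction h with
  | refl => exact List.prefix_rfl
  | step w hw hr _ ih =>
    rw [str_eq hw hr]
    exact ih.trans (List.prefix_append _ _)

theorem Anc.exists_child {v w : ℕ} (h : t.Anc v w) (hne : v ≠ w) :
    ∃ c, t.IsChild v c ∧ t.Anc c w := by
  induction h with
  | refl => exact absurd rfl hne
  | step w hw hr _ ih =>
    by_cases hp : v = t.parent w
    · exact ⟨w, ⟨hw, hr, hp.symm⟩, .refl⟩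
    · obtain ⟨c, hc, hcw⟩ := ih hp
      exact ⟨c, hc, .step w hw hr hcw⟩

/-- A set of nodes that is closed under taking parents is closed under taking ancestors. -/
theorem Anc.closed {v w : ℕ} (h : t.Anc v w) {X : ℕ → Prop} (hX : X w)
    (hc : ∀ y ∈ t.nodes, y ≠ t.root → X y → X (t.parent y)) : X v := by
  induction h with
  | refl => exact hX
  | step w hw hr _ ih => exact ih (hc w hw hr hX)

theorem IsLeaf.eq_of_anc {v w : ℕ} (hv : t.IsLeaf v) (h : t.Anc v w) : v = w := by
  by_contra hne
  obtain ⟨c, hc, _⟩ := h.exists_child hne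
  exact hv.2 c hc

/-- `t` is the suffix tree of `S`, except that the node `z` need not branch. -/
structure IsSuffixTreeAt (t : EdgeTree) (S : List ℕ) (z : ℕ) : Prop where
  branching : ∀ u ∈ t.nodes, u ≠ t.root → u ≠ z → ¬ t.IsLeaf u →
    ∃ v w, v ≠ w ∧ t.IsChild u v ∧ t.IsChild u w
  distinct : ∀ u v w, t.IsChild u v → t.IsChild u w →
    (t.label v).head? = (t.label w).head? → v = w
  label_ne_nil : ∀ v ∈ t.nodes, v ≠ t.root → t.label v ≠ []
  suffix_leaf : ∀ s, s ≠ [] → s <:+ S → ∃! v, t.IsLeaf v ∧ t.Spells v s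
  leaf_suffix : ∀ v, t.IsLeaf v → ∃ s, s ≠ [] ∧ s <:+ S ∧ t.Spells v s

theorem IsSuffixTree.at_root {S : List ℕ} (h : t.IsSuffixTree S) : t.IsSuffixTreeAt S t.root :=
  ⟨fun u hu hr _ => h.branching u hu hr, h.distinct, h.label_ne_nil, h.suffix_leaf, h.leaf_suffix⟩

namespace IsSuffixTreeAt

variable {S : List ℕ} {z : ℕ}

theorem leaf_ne_root (h : t.IsSuffixTreeAt S z) {v : ℕ} (hv : t.IsLeaf v) : v ≠ t.root := by
  rintro rfl
  obtain ⟨s, hs, _, hsp⟩ := h.leaf_suffix _ hv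
  exact hs (hsp.unique .root)

/-- Below every node there is a leaf. -/
theorem exists_leaf (h : t.IsSuffixTreeAt S z) {v : ℕ} (hv : v ∈ t.nodes) :
    ∃ l, t.IsLeaf l ∧ t.Anc v l := by
  classical
  -- A descendant with the longest string has no child, because labels are nonempty.
  obtain ⟨l, hl, hmax⟩ := Finset.exists_max_image (t.nodes.filter (t.Anc v))
    (fun l => (t.str l).length) ⟨v, by simp [hv, Anc.refl]⟩
  rw [Finset.mem_filter] at hl
  refine ⟨l, ⟨hl.1, fun c hc => ?_⟩, hl.2⟩
  have hlc : t.Anc v c := .step c hc.1 hc.2.1 (hc.2.2 ▸ hl.2)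
  have := hmax c (by simp [hc.1, hlc])
  have hne := h.label_ne_nil c hc.1 hc.2.1
  rw [str_eq hc.1 hc.2.1, hc.2.2] at this
  simp at this
  exact hne this

/-- In a trie, prefixes belong to ancestors. -/
theorem anc_of_prefix (h : t.IsSuffixTreeAt S z) {l : ℕ} : ∀ v ∈ t.nodes, l ∈ t.nodes →
    t.str v <+: t.str l → t.Anc v l := by
  refine t.rec_on_nodes (fun hl _ => t.root_anc l hl) fun v hv hr ih hl hp => ?_
  have hv' := str_eq hv hr
  have hne := h.label_ne_nil v hv hr
  have hpl := ih hl ((hv' ▸ List.prefix_append _ _).trans hp)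
  have hpl' : t.parent v ≠ l := by
    intro he
    have := hp.length_le
    rw [hv', he] at this
    simp at this
    exact hne this
  -- The child `c` of `parent v` on the way to `l` and `v` itself both continue the string of
  -- `parent v` along that of `l`; their labels begin with the same letter, hence `c = v`.
  obtain ⟨c, hc, hcl⟩ := hpl.exists_child hpl'
  obtain ⟨x, hx⟩ := hp
  obtain ⟨y, hy⟩ := hcl.prefix
  rw [← hx, str_eq hc.1 hc.2.1, hc.2.2, hv', List.append_assoc, List.append_assoc,
    List.append_cancel_left_eq] at hy
  have hcn := h.label_ne_nil c hc.1 hc.2.1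
  have := h.distinct _ c v hc ⟨hv, hr, rfl⟩ (by
    cases hlc : t.label c with
    | nil => exact absurd hlc hcn
    | cons a _ =>
      cases hlv : t.label v with
      | nil => exact absurd hlv hne
      | cons b _ =>
        rw [hlc, hlv] at hy
        simp at hy
        simp [hy.1])
  exact this ▸ hcl

/-- The infix condition on labels need not be maintained: every node lies above a leaf, so its label
is an infix of some suffix. -/
theorem isSuffixTree (h : t.IsSuffixTreeAt S t.root) : t.IsSuffixTree S where
  branching u hu hr := h.branching u hu hr hr
  distinct := h.distinct
  label_ne_nil := h.label_ne_nil
  label_infix v hv hr := by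
    obtain ⟨l, hl, hvl⟩ := h.exists_leaf hv
    obtain ⟨s, _, hs, hsp⟩ := h.leaf_suffix l hl
    have hp := hvl.prefix
    rw [str_eq hv hr, hsp.str_eq] at hp
    exact ((List.suffix_append _ _).isInfix.trans hp.isInfix).trans hs.isInfix
  suffix_leaf := h.suffix_leaf
  leaf_suffix := h.leaf_suffix

theorem eq_of_str_eq (h : t.IsSuffixTreeAt S z) {v w : ℕ} (hv : t.IsLeaf v) (hw : t.IsLeaf w)
    (he : t.str v = t.str w) : v = w :=
  hv.eq_of_anc (h.anc_of_prefix v hv.1 hw.1 (he ▸ List.prefix_rfl))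

open Classical in
/-- A suffix tree has at most as many leaves as its string has letters. -/
theorem card_leaves (h : t.IsSuffixTreeAt S z) : (t.nodes.filter t.IsLeaf).card ≤ S.length := by
  have hs : ∀ v, t.IsLeaf v → t.str v ≠ [] ∧ t.str v <:+ S := fun v hv => by
    obtain ⟨s, h1, h2, h3⟩ := h.leaf_suffix v hv
    rw [h3.str_eq]; exact ⟨h1, h2⟩
  rw [← Finset.card_range S.length]
  -- A leaf is sent to the start position (from 0) of its suffix.
  refine Finset.card_le_card_of_injOn (fun v => S.length - (t.str v).length) (fun v hv => ?_)
    fun v hv w hw he => ?_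
  · have h1 := (hs v (by simpa using (Finset.mem_filter.1 hv).2)).1
    have h2 := (hs v (by simpa using (Finset.mem_filter.1 hv).2)).2.length_le
    have := List.length_pos_iff.2 h1
    simp; omega
  · have hv' := (Finset.mem_filter.1 hv).2
    have hw' := (Finset.mem_filter.1 hw).2
    have h1 := (hs v hv').2
    have h2 := (hs w hw').2
    have h3 := h1.length_le
    have h4 := h2.length_le
    refine h.eq_of_str_eq hv' hw' ((List.suffix_of_suffix_length_le h1 h2 ?_).eq_of_length ?_) <;>
    · simp only at he; omega

open Classical in
/-- A suffix tree has at most twice as many nodes as its string has letters. -/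
theorem card_nodes (h : t.IsSuffixTreeAt S t.root) : t.nodes.card ≤ 2 * S.length := by
  have hL := h.card_leaves
  set L := t.nodes.filter t.IsLeaf with hLdef
  set I := (t.nodes.filter fun v => ¬ t.IsLeaf v) with hIdef
  have h1 : t.nodes.card = L.card + I.card := by
    rw [hLdef, hIdef, Finset.card_filter_add_card_filter_not]
  have hroot : t.root ∈ I := Finset.mem_filter.2 ⟨t.root_mem, fun hl => h.leaf_ne_root hl rfl⟩
  -- Each node other than the root is counted once, as a child of an internal node.
  have h2 : (t.nodes.erase t.root).card =
      ∑ u ∈ I, ((t.nodes.erase t.root).filter fun v => t.parent v = u).card := by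
    refine Finset.card_eq_sum_card_fiberwise fun v hv => ?_
    obtain ⟨hr, hv⟩ := Finset.mem_erase.1 hv
    exact Finset.mem_filter.2 ⟨t.parent_mem v hv hr, fun hl => hl.2 v ⟨hv, hr, rfl⟩⟩
  have h3 : ∀ u ∈ I.erase t.root,
      2 ≤ ((t.nodes.erase t.root).filter fun v => t.parent v = u).card := by
    intro u hu
    obtain ⟨hr, hu⟩ := Finset.mem_erase.1 hu
    obtain ⟨hu, hl⟩ := Finset.mem_filter.1 hu
    obtain ⟨v, w, hne, hv, hw⟩ := h.branching u hu hr hr hl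
    refine Finset.one_lt_card.2 ⟨v, ?_, w, ?_, hne⟩ <;>
      simp only [Finset.mem_filter, Finset.mem_erase]
    exacts [⟨⟨hv.2.1, hv.1⟩, hv.2.2⟩, ⟨⟨hw.2.1, hw.1⟩, hw.2.2⟩]
  have h4 : 1 ≤ ((t.nodes.erase t.root).filter fun v => t.parent v = t.root).card := by
    obtain ⟨_, hl⟩ := Finset.mem_filter.1 hroot
    have : ∃ w, t.IsChild t.root w := by
      by_contra! hc
      exact hl ⟨t.root_mem, hc⟩
    obtain ⟨w, hw⟩ := this
    refine Finset.card_pos.2 ⟨w, ?_⟩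
    simp only [Finset.mem_filter, Finset.mem_erase]
    exact ⟨⟨hw.2.1, hw.1⟩, hw.2.2⟩
  -- The root has at least one child and the other internal nodes at least two, so `|nodes| - 1 ≥ 2
  -- * (|I| - 1) + 1`. Together with `|nodes| = |L| + |I|` this gives `|I| ≤ |L|`.
  rw [← Finset.add_sum_erase _ _ hroot] at h2
  have h5 := Finset.card_nsmul_le_sum _ _ _ h3
  rw [Finset.card_erase_of_mem t.root_mem] at h2
  rw [Finset.card_erase_of_mem hroot, smul_eq_mul] at h5
  have := Finset.card_pos.2 ⟨_, hroot⟩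
  omega

end IsSuffixTreeAt

/-! ### Removing a leaf -/

/-- Remove the leaf `v`. -/
def eraseLeaf (t : EdgeTree) (v : ℕ) (hv : t.IsLeaf v) (hr : v ≠ t.root) : EdgeTree where
  nodes := t.nodes.erase v
  root := t.root
  parent := t.parent
  label := t.label
  root_mem := Finset.mem_erase.2 ⟨hr.symm, t.root_mem⟩
  parent_mem x hx hxr := by
    have hx := Finset.mem_of_mem_erase hx
    exact Finset.mem_erase.2 ⟨fun he => hv.2 x ⟨hx, hxr, he⟩, t.parent_mem x hx hxr⟩
  reaches_root x hx := t.reaches_root x (Finset.mem_of_mem_erase hx)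

section eraseLeaf

variable {v : ℕ} {hv : t.IsLeaf v} {hr : v ≠ t.root}

theorem isChild_eraseLeaf {x y : ℕ} :
    (t.eraseLeaf v hv hr).IsChild x y ↔ t.IsChild x y ∧ y ≠ v := by
  simp only [IsChild, eraseLeaf, Finset.mem_erase]
  tauto

theorem str_eraseLeaf : ∀ x ∈ (t.eraseLeaf v hv hr).nodes,
    (t.eraseLeaf v hv hr).str x = t.str x := by
  refine (t.eraseLeaf v hv hr).rec_on_nodes ?_ fun x hx hxr ih => ?_
  · rw [str_root]; exact (str_root t).symm
  · rw [str_eq hx hxr, ih, str_eq (Finset.mem_of_mem_erase hx) hxr]; rfl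

theorem isLeaf_eraseLeaf (hu : ∃ c, c ≠ v ∧ t.IsChild (t.parent v) c) {x : ℕ} :
    (t.eraseLeaf v hv hr).IsLeaf x ↔ t.IsLeaf x ∧ x ≠ v := by
  simp only [IsLeaf, isChild_eraseLeaf]
  constructor
  · rintro ⟨h1, h2⟩
    obtain ⟨hne, h1⟩ := Finset.mem_erase.1 h1
    refine ⟨⟨h1, fun w hw => ?_⟩, hne⟩
    by_cases hwv : w = v
    · subst hwv
      obtain ⟨c, hc, hc'⟩ := hu
      exact h2 c ⟨hw.2.2 ▸ hc', hc⟩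
    · exact h2 w ⟨hw, hwv⟩
  · rintro ⟨⟨h1, h2⟩, hne⟩
    exact ⟨Finset.mem_erase.2 ⟨hne, h1⟩, fun w hw => h2 w hw.1⟩

end eraseLeaf

/-- If the parent is the root, then the leaf of `R` lies below another child of the root, as nothing
else lies below the leaf `v`. Otherwise the parent branches. The hypothesis `R ≠ []` is needed
because the tree of a single letter is a root with one leaf. -/
theorem IsSuffixTreeAt.exists_sibling {a : ℕ} {R : List ℕ}
    (h : t.IsSuffixTreeAt (a :: R) t.root) (hR : R ≠ []) {v : ℕ} (hv : t.IsLeaf v)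
    (hs : t.str v = a :: R) : ∃ c, c ≠ v ∧ t.IsChild (t.parent v) c := by
  have hr := h.leaf_ne_root hv
  by_cases hu : t.parent v = t.root
  · obtain ⟨l, ⟨hl, hls⟩, _⟩ := h.suffix_leaf R hR (List.suffix_cons _ _)
    obtain ⟨c, hc, hcl⟩ := (t.root_anc l hl.1).exists_child (h.leaf_ne_root hl).symm
    refine ⟨c, ?_, hu ▸ hc⟩
    rintro rfl
    have := hv.eq_of_anc hcl
    rw [← this] at hls
    rw [hls.str_eq] at hs
    simpa using congrArg List.length hs
  · obtain ⟨c, d, hne, hc, hd⟩ := h.branching _ (t.parent_mem v hv.1 hr) hu hu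
      fun hl => hl.2 v ⟨hv.1, hr, rfl⟩
    by_cases hcv : c = v
    · exact ⟨d, by rw [← hcv]; exact hne.symm, hd⟩
    · exact ⟨c, hcv, hc⟩

theorem spells_iff {v : ℕ} {s : List ℕ} : t.Spells v s ↔ v ∈ t.nodes ∧ t.str v = s :=
  ⟨fun h => ⟨h.mem, h.str_eq⟩, fun h => h.2 ▸ spells_str h.1⟩

/-- The parent is the only node that loses a child, so it becomes the exempt node. The suffixes of
`a :: R` other than the full string are those of `R`, and their leaves remain because of the
sibling. -/
theorem IsSuffixTreeAt.eraseLeaf {a : ℕ} {R : List ℕ}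
    (h : t.IsSuffixTreeAt (a :: R) t.root) (hR : R ≠ []) {v : ℕ} (hv : t.IsLeaf v)
    (hr : v ≠ t.root) (hs : t.str v = a :: R) :
    (t.eraseLeaf v hv hr).IsSuffixTreeAt R (t.parent v) := by
  have hsib := h.exists_sibling hR hv hs
  constructor
  · intro u hu hur huv hul
    rw [isLeaf_eraseLeaf hsib] at hul
    obtain ⟨hne, hu⟩ := Finset.mem_erase.1 hu
    obtain ⟨c, d, hcd, hc, hd⟩ := h.branching u hu hur hur fun hl => hul ⟨hl, hne⟩
    exact ⟨c, d, hcd, isChild_eraseLeaf.2 ⟨hc, by rintro rfl; exact huv hc.2.2.symm⟩,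
      isChild_eraseLeaf.2 ⟨hd, by rintro rfl; exact huv hd.2.2.symm⟩⟩
  · intro u c d hc hd
    exact h.distinct u c d (isChild_eraseLeaf.1 hc).1 (isChild_eraseLeaf.1 hd).1
  · intro x hx hxr
    exact h.label_ne_nil x (Finset.mem_of_mem_erase hx) hxr
  · intro s hs0 hsR
    obtain ⟨l, ⟨hl, hls⟩, huniq⟩ := h.suffix_leaf s hs0 (hsR.trans (List.suffix_cons _ _))
    have hlv : l ≠ v := by
      rintro rfl
      rw [hls.str_eq] at hs
      have := hsR.length_le
      rw [hs] at this
      simp at this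
    have hl' := (isLeaf_eraseLeaf (hv := hv) (hr := hr) hsib).2 ⟨hl, hlv⟩
    refine ⟨l, ⟨hl', spells_iff.2 ⟨hl'.1, by rw [str_eraseLeaf _ hl'.1, hls.str_eq]⟩⟩,
      fun y hy => huniq y ?_⟩
    have hy1 := (isLeaf_eraseLeaf hsib).1 hy.1
    exact ⟨hy1.1, spells_iff.2 ⟨hy1.1.1, by rw [← str_eraseLeaf _ hy.1.1, hy.2.str_eq]⟩⟩
  · intro l hl
    have hl1 := (isLeaf_eraseLeaf hsib).1 hl
    obtain ⟨s, hs0, hsR, hls⟩ := h.leaf_suffix l hl1.1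
    refine ⟨s, hs0, ?_, spells_iff.2 ⟨hl.1, by rw [str_eraseLeaf _ hl.1, hls.str_eq]⟩⟩
    rcases List.suffix_cons_iff.1 hsR with he | hsR
    · exact absurd (h.eq_of_str_eq hl1.1 hv (by rw [hls.str_eq, hs, he])) hl1.2
    · exact hsR

/-- A suffix tree with an exempt node that branches or is the root. -/
theorem IsSuffixTreeAt.of_branching {S : List ℕ} {u : ℕ} (h : t.IsSuffixTreeAt S u)
    (hu : u ≠ t.root → ∃ v w, v ≠ w ∧ t.IsChild u v ∧ t.IsChild u w) :
    t.IsSuffixTreeAt S t.root where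
  branching x hx hxr _ hl := by
    by_cases hxu : x = u
    · subst hxu; exact hu hxr
    · exact h.branching x hx hxr hxu hl
  distinct := h.distinct
  label_ne_nil := h.label_ne_nil
  suffix_leaf := h.suffix_leaf
  leaf_suffix := h.leaf_suffix

/-! ### Splicing out a unary node -/

/-- Remove the node `u`, whose only child is `w`. -/
def splice (t : EdgeTree) (u w : ℕ) (hu : u ∈ t.nodes) (hr : u ≠ t.root)
    (hw : ∀ x, t.IsChild u x ↔ x = w) : EdgeTree where
  nodes := t.nodes.erase u
  root := t.root
  parent := Function.update t.parent w (t.parent u)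
  label := Function.update t.label w (t.label u ++ t.label w)
  root_mem := Finset.mem_erase.2 ⟨hr.symm, t.root_mem⟩
  parent_mem x hx hxr := by
    have hx := (Finset.mem_erase.1 hx)
    have hwc := (hw w).2 rfl
    simp only [Function.update_apply, Finset.mem_erase]
    split_ifs with hxw
    · refine ⟨fun he => ?_, t.parent_mem u hu hr⟩
      have hwu : u = w := (hw u).1 ⟨hu, hr, he⟩
      obtain ⟨m, hm⟩ := t.reaches_root u hu
      rw [Function.iterate_fixed he] at hm
      exact hr hm
    · exact ⟨fun he => hxw ((hw x).1 ⟨hx.2, hxr, he⟩), t.parent_mem x hx.2 hxr⟩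
  reaches_root x hx := by
    have hwc := (hw w).2 rfl
    refine t.rec_on_nodes (P := fun x =>
      ∃ m, (Function.update t.parent w (t.parent u))^[m] x = t.root) ⟨0, rfl⟩ ?_ x
      (Finset.mem_of_mem_erase hx)
    rintro x hx hxr ⟨m, hm⟩
    by_cases hxw : x = w
    · subst hxw
      rw [hwc.2.2] at hm
      cases m with
      | zero => exact absurd hm hr
      | succ m =>
        -- The new parent function sends `x` and `u` to the same node, so the path of `u` also
        -- serves `x`.
        refine ⟨m + 1, ?_⟩
        by_cases hux : u = x
        · rw [← hux] at hm ⊢; exact hm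
        · simpa [Function.update_of_ne hux] using hm
    · exact ⟨m + 1, by simpa [Function.update_of_ne hxw] using hm⟩

section splice

variable {u w : ℕ} {hu : u ∈ t.nodes} {hr : u ≠ t.root} {hw : ∀ x, t.IsChild u x ↔ x = w}

theorem parent_ne_self (t : EdgeTree) {u : ℕ} (hu : u ∈ t.nodes) (hr : u ≠ t.root) :
    t.parent u ≠ u := by
  intro he
  obtain ⟨m, hm⟩ := t.reaches_root u hu
  rw [Function.iterate_fixed he] at hm
  exact hr hm

theorem splice_child_ne (hu : u ∈ t.nodes) (hr : u ≠ t.root)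
    (hw : ∀ x, t.IsChild u x ↔ x = w) : w ≠ u := by
  rintro rfl
  exact t.parent_ne_self hu hr ((hw w).2 rfl).2.2

theorem isChild_splice {x y : ℕ} : (t.splice u w hu hr hw).IsChild x y ↔
    (y = w ∧ x = t.parent u) ∨ (y ≠ w ∧ y ≠ u ∧ t.IsChild x y) := by
  have hwc := (hw w).2 rfl
  have hwu := splice_child_ne hu hr hw
  by_cases hyw : y = w
  · subst hyw
    simp [IsChild, splice, hwc.1, hwc.2.1, hwu, eq_comm]
  · simp only [IsChild, splice, Finset.mem_erase, Function.update_of_ne hyw]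
    tauto

theorem str_splice : ∀ x ∈ (t.splice u w hu hr hw).nodes,
    (t.splice u w hu hr hw).str x = t.str x := by
  have hwc := (hw w).2 rfl
  refine (t.splice u w hu hr hw).rec_on_nodes ?_ fun x hx hxr ih => ?_
  · rw [str_root]; exact (str_root t).symm
  · rw [str_eq hx hxr, ih, str_eq (Finset.mem_of_mem_erase hx) hxr]
    by_cases hxw : x = w
    · subst hxw
      simp only [splice, Function.update_self]
      rw [hwc.2.2, str_eq hu hr, List.append_assoc]
    · simp only [splice, Function.update_of_ne hxw]

theorem isLeaf_splice {x : ℕ} : (t.splice u w hu hr hw).IsLeaf x ↔ t.IsLeaf x := by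
  have hwc := (hw w).2 rfl
  have hwu := splice_child_ne hu hr hw
  simp only [IsLeaf, isChild_splice]
  constructor
  · rintro ⟨h1, h2⟩
    obtain ⟨hne, h1⟩ := Finset.mem_erase.1 h1
    refine ⟨h1, fun y hy => ?_⟩
    by_cases hyu : y = u
    · subst hyu
      exact h2 w (.inl ⟨rfl, hy.2.2.symm⟩)
    · refine h2 y (.inr ⟨?_, hyu, hy⟩)
      rintro rfl
      exact hne (hy.2.2.symm.trans hwc.2.2)
  · rintro ⟨h1, h2⟩
    refine ⟨Finset.mem_erase.2 ⟨by rintro rfl; exact h2 w hwc, h1⟩, ?_⟩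
    rintro y (⟨_, hx⟩ | ⟨_, _, hy⟩)
    · exact h2 u ⟨hu, hr, hx.symm⟩
    · exact h2 y hy

end splice

/-- The merged label begins with that of `u`, so `w` takes over the role of `u` among the children
of `parent u`: their number and their first letters do not change. Leaves and their strings stay the
same. -/
theorem IsSuffixTreeAt.splice {S : List ℕ} {u w : ℕ} (h : t.IsSuffixTreeAt S u)
    (hu : u ∈ t.nodes) (hr : u ≠ t.root) (hw : ∀ x, t.IsChild u x ↔ x = w) :
    (t.splice u w hu hr hw).IsSuffixTreeAt S t.root := by
  have hwc := (hw w).2 rfl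
  have hwu := splice_child_ne hu hr hw
  have hun := h.label_ne_nil u hu hr
  have hsp : ∀ l, t.IsLeaf l → ∀ s, (t.splice u w hu hr hw).Spells l s ↔ t.Spells l s := by
    intro l hl s
    have hl' := (isLeaf_splice (hw := hw) (hu := hu) (hr := hr)).2 hl
    rw [spells_iff, spells_iff, str_splice l hl'.1]
    simp [hl.1, hl'.1]
  constructor
  · intro x hx hxr _ hl
    rw [isLeaf_splice] at hl
    obtain ⟨hxu, hx⟩ := Finset.mem_erase.1 hx
    obtain ⟨c, d, hcd, hc, hd⟩ := h.branching x hx hxr hxu hl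
    have key : ∀ y, t.IsChild x y → y ≠ w := by
      rintro y hy rfl
      exact hxu (hy.2.2.symm.trans hwc.2.2)
    have key2 : ∀ y, t.IsChild x y →
        (t.splice u w hu hr hw).IsChild x (if y = u then w else y) := by
      intro y hy
      rw [isChild_splice]
      split_ifs with hyu
      · subst hyu; exact .inl ⟨rfl, hy.2.2.symm⟩
      · exact .inr ⟨key y hy, hyu, hy⟩
    refine ⟨_, _, ?_, key2 c hc, key2 d hd⟩
    have := key c hc
    have := key d hd
    split_ifs with h1 h2 h2
    · exact fun _ => hcd (h1.trans h2.symm)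
    · exact Ne.symm ‹d ≠ w›
    · exact ‹c ≠ w›
    · exact hcd
  · intro x c d hc hd he
    have hlw : ((t.splice u w hu hr hw).label w).head? = (t.label u).head? := by
      simp only [EdgeTree.splice, Function.update_self]
      cases hl : t.label u with
      | nil => exact absurd hl hun
      | cons => simp
    have hl' : ∀ y, y ≠ w → (t.splice u w hu hr hw).label y = t.label y := fun y hy => by
      simp only [EdgeTree.splice, Function.update_of_ne hy]
    rw [isChild_splice] at hc hd
    rcases hc with ⟨rfl, hc⟩ | ⟨hcw, hcu, hc⟩ <;> rcases hd with ⟨hd, hd'⟩ | ⟨hdw, hdu, hd⟩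
    · exact hd.symm
    · rw [hlw, hl' d hdw] at he
      exact absurd (h.distinct x u d ⟨hu, hr, hc.symm⟩ hd he).symm hdu
    · rw [hd, hlw, hl' c hcw] at he
      exact absurd (h.distinct x c u hc ⟨hu, hr, hd'.symm⟩ he) hcu
    · rw [hl' c hcw, hl' d hdw] at he
      exact h.distinct x c d hc hd he
  · intro x hx hxr
    have := h.label_ne_nil x (Finset.mem_of_mem_erase hx) hxr
    by_cases hxw : x = w
    · subst hxw; simp [EdgeTree.splice, hun]
    · simpa [EdgeTree.splice, Function.update_of_ne hxw] using this
  · intro s hs0 hs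
    obtain ⟨l, ⟨hl, hls⟩, huniq⟩ := h.suffix_leaf s hs0 hs
    refine ⟨l, ⟨isLeaf_splice.2 hl, (hsp l hl s).2 hls⟩, fun y hy => huniq y ?_⟩
    have := isLeaf_splice.1 hy.1
    exact ⟨this, (hsp y this s).1 hy.2⟩
  · intro l hl
    have hl := isLeaf_splice.1 hl
    obtain ⟨s, h1, h2, h3⟩ := h.leaf_suffix l hl
    exact ⟨s, h1, h2, (hsp l hl s).2 h3⟩

end EdgeTree

/-! ### Representation in memory -/

/-- The last occurrence of `x` in `S` begins after the first `p` letters. -/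
def LastOcc (S x : List ℕ) (p : ℕ) : Prop :=
  x <+: S.drop p ∧ ∀ q, x <+: S.drop q → q ≤ p

/-- The linked list that begins in cell `a`: node `v` has its successor in cell `6 * v + 2`,
and cell `A + 16 * v + 1` contains the address of the cell that points to `v`. -/
def DChain (A : ℕ) (m : ℕ → ℕ) : ℕ → List ℕ → Prop
  | a, [] => m a = 0
  | a, v :: l => m a = v ∧ v ≠ 0 ∧ m (A + 16 * v + 1) = a ∧ DChain A m (6 * v + 2) l

/-! ### Sibling lists with back pointers -/

namespace DChain

variable {A : ℕ} {m m' : ℕ → ℕ}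

theorem congr : ∀ {l : List ℕ} {a : ℕ}, DChain A m a l → m' a = m a →
    (∀ z ∈ l, m' (6 * z + 2) = m (6 * z + 2)) →
    (∀ z ∈ l, m' (A + 16 * z + 1) = m (A + 16 * z + 1)) → DChain A m' a l
  | [], a, h, ha, _, _ => ha.trans h
  | v :: l, a, ⟨h1, h2, h3, h4⟩, ha, hn, hp =>
    ⟨ha.trans h1, h2, (hp v (by simp)).trans h3, h4.congr (hn v (by simp))
      (fun z hz => hn z (by simp [hz])) (fun z hz => hp z (by simp [hz]))⟩

theorem ne_zero : ∀ {l : List ℕ} {a : ℕ}, DChain A m a l → ∀ v ∈ l, v ≠ 0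
  | _ :: l, a, ⟨_, h2, _, h4⟩, v, hv => by
    rcases List.mem_cons.1 hv with rfl | hv
    · exact h2
    · exact h4.ne_zero v hv

theorem pointerChain : ∀ {l : List ℕ} {a : ℕ}, DChain A m a l → m' a = m a →
    (∀ z ∈ l, m' (6 * z + 2) = m (6 * z + 2)) → PointerChain (fun v => m' (6 * v + 2)) (m' a) l
  | [], _, h, ha, _ => ha.trans h
  | v :: _, _, ⟨h1, h2, _, h4⟩, ha, hn => by
    rw [ha, h1]
    exact ⟨rfl, h2, h4.pointerChain (hn v (by simp)) fun z hz => hn z (by simp [hz])⟩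

/-- The possible values of the two links of an element. They show which cells an update at `v` can
touch and that it cannot interfere with another list. -/
theorem pointer : ∀ {l : List ℕ} {a v : ℕ}, DChain A m a l → l.Nodup → v ∈ l →
    m (m (A + 16 * v + 1)) = v ∧
    (m (A + 16 * v + 1) = a ∨ ∃ z ∈ l, z ≠ v ∧ m (A + 16 * v + 1) = 6 * z + 2) ∧
    (m (6 * v + 2) = 0 ∨ (m (6 * v + 2) ∈ l ∧ m (6 * v + 2) ≠ v))
  | y :: l, a, v, ⟨h1, h2, h3, h4⟩, hnd, hv => by
    obtain ⟨hyl, hnd'⟩ := List.nodup_cons.1 hnd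
    by_cases hvy : v = y
    · subst hvy
      refine ⟨by rw [h3, h1], .inl h3, ?_⟩
      cases l with
      | nil => exact .inl h4
      | cons z l =>
        have := h4.1
        refine .inr ⟨by simp [this], ?_⟩
        rw [this]
        rintro rfl
        simp at hyl
    · have hv : v ∈ l := by simpa [hvy] using hv
      obtain ⟨g1, g2, g3⟩ := h4.pointer hnd' hv
      refine ⟨g1, .inr ?_, ?_⟩
      · rcases g2 with g2 | ⟨z, hz, hzv, g2⟩
        · exact ⟨y, by simp, fun h => hvy h.symm, g2⟩
        · exact ⟨z, by simp [hz], hzv, g2⟩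
      · exact g3.imp_right fun g => ⟨by simp [g.1], g.2⟩

/-- Unlinking an element of the list. -/
theorem erase {v p x : ℕ} (hp : m (A + 16 * v + 1) = p) (hx : m (6 * v + 2) = x)
    (h1 : m' p = x) (h2 : x ≠ 0 → m' (A + 16 * x + 1) = p) : ∀ {l : List ℕ} {a : ℕ},
    DChain A m a l → l.Nodup → v ∈ l → (∀ z ∈ l, a ≠ 6 * z + 2) → (a ≠ p → m' a = m a) →
    (∀ z ∈ l, 6 * z + 2 ≠ p → m' (6 * z + 2) = m (6 * z + 2)) →
    (∀ z ∈ l, z ≠ x → m' (A + 16 * z + 1) = m (A + 16 * z + 1)) → DChain A m' a (l.erase v)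
  | y :: l, a, ⟨g1, g2, g3, g4⟩, hnd, hv, ha, ha', hn, hpa => by
    obtain ⟨hyl, hnd'⟩ := List.nodup_cons.1 hnd
    by_cases hvy : v = y
    · subst hvy
      rw [List.erase_cons_head]
      have hpa' : p = a := by rw [← hp, g3]
      subst hpa'
      cases l with
      | nil => exact h1.trans (hx.symm.trans g4)
      | cons z l =>
        obtain ⟨k1, k2, k3, k4⟩ := g4
        have hxz : x = z := hx.symm.trans k1
        subst hxz
        obtain ⟨hxl, _⟩ := List.nodup_cons.1 hnd'
        refine ⟨h1, k2, h2 k2, k4.congr (hn x (by simp) (ha x (by simp)).symm) (fun z hz => ?_)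
          (fun z hz => ?_)⟩
        · exact hn z (by simp [hz]) (ha z (by simp [hz])).symm
        · exact hpa z (by simp [hz]) (by rintro rfl; exact hxl hz)
    · have hv : v ∈ l := by simpa [hvy] using hv
      obtain ⟨k1, k2, k3⟩ := g4.pointer hnd' hv
      rw [hp] at k2
      rw [hx] at k3
      rw [List.erase_cons_tail (by simpa using Ne.symm hvy)]
      -- Since `v` is not the head, `p` is the next-sibling cell of some element, whereas `a` is no
      -- such cell.
      have hap : a ≠ p := by
        rcases k2 with k2 | ⟨z, hz, _, k2⟩
        · rw [k2]; exact ha y (by simp)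
        · rw [k2]; exact ha z (by simp [hz])
      refine ⟨(ha' hap).trans g1, g2, (hpa y (by simp) ?_).trans g3, erase hp hx h1 h2 g4 hnd' hv ?_
        (hn y (by simp)) (fun z hz => hn z (by simp [hz])) (fun z hz => hpa z (by simp [hz]))⟩
      · rintro rfl
        rcases k3 with k3 | k3
        · exact g2 k3
        · exact hyl k3.1
      · intro z hz he
        obtain rfl : y = z := by omega
        exact hyl hz

/-- Replacing an element of the list. -/
theorem replace {u w p x : ℕ} (hp : m (A + 16 * u + 1) = p) (hx : m (6 * u + 2) = x)
    (hw : w ≠ 0) (h1 : m' p = w) (h2 : m' (A + 16 * w + 1) = p) (h3 : m' (6 * w + 2) = x)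
    (h4 : x ≠ 0 → m' (A + 16 * x + 1) = 6 * w + 2) : ∀ {l : List ℕ} {a : ℕ},
    DChain A m a l → l.Nodup → u ∈ l → (∀ z ∈ l, a ≠ 6 * z + 2) → (a ≠ p → m' a = m a) →
    (∀ z ∈ l, 6 * z + 2 ≠ p → m' (6 * z + 2) = m (6 * z + 2)) →
    (∀ z ∈ l, z ≠ x → m' (A + 16 * z + 1) = m (A + 16 * z + 1)) →
    DChain A m' a (l.map fun y => if y = u then w else y)
  | y :: l, a, ⟨g1, g2, g3, g4⟩, hnd, hv, ha, ha', hn, hpa => by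
    obtain ⟨hyl, hnd'⟩ := List.nodup_cons.1 hnd
    by_cases hvy : u = y
    · subst hvy
      have hid : (l.map fun y => if y = u then w else y) = l := by
        conv_rhs => rw [← List.map_id l]
        refine List.map_congr_left fun z hz => if_neg ?_
        rintro rfl
        exact hyl hz
      have hpa' : p = a := by rw [← hp, g3]
      subst hpa'
      rw [List.map_cons, hid, if_pos rfl]
      refine ⟨h1, hw, h2, ?_⟩
      cases l with
      | nil => exact h3.trans (hx.symm.trans g4)
      | cons z l =>
        obtain ⟨k1, k2, k3, k4⟩ := g4
        have hxz : x = z := hx.symm.trans k1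
        subst hxz
        obtain ⟨hxl, _⟩ := List.nodup_cons.1 hnd'
        refine ⟨h3, k2, h4 k2, k4.congr (hn x (by simp) (ha x (by simp)).symm) (fun z hz => ?_)
          (fun z hz => ?_)⟩
        · exact hn z (by simp [hz]) (ha z (by simp [hz])).symm
        · exact hpa z (by simp [hz]) (by rintro rfl; exact hxl hz)
    · have hv : u ∈ l := by simpa [hvy] using hv
      obtain ⟨k1, k2, k3⟩ := g4.pointer hnd' hv
      rw [hp] at k2
      rw [hx] at k3
      rw [List.map_cons, if_neg (Ne.symm hvy)]
      have hap : a ≠ p := by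
        rcases k2 with k2 | ⟨z, hz, _, k2⟩
        · rw [k2]; exact ha y (by simp)
        · rw [k2]; exact ha z (by simp [hz])
      refine ⟨(ha' hap).trans g1, g2, (hpa y (by simp) ?_).trans g3,
        replace hp hx hw h1 h2 h3 h4 g4 hnd' hv ?_
        (hn y (by simp)) (fun z hz => hn z (by simp [hz])) (fun z hz => hpa z (by simp [hz]))⟩
      · rintro rfl
        rcases k3 with k3 | k3
        · exact g2 k3
        · exact hyl k3.1
      · intro z hz he
        obtain rfl : y = z := by omega
        exact hyl hz

end DChain

/-- The memory `m` represents the tree `t`, with a node table at address `0`, and with auxiliary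
cells from address `A` on: the cell `A + 16 * p` contains the leaf with start position `p`. -/
structure Rep (S : List ℕ) (N A : ℕ) (m : ℕ → ℕ) (t : EdgeTree) : Prop where
  base_le : 6 * N + 6 ≤ A
  node_le : ∀ v ∈ t.nodes, 1 ≤ v ∧ v ≤ N
  mem_zero : m 0 = 0
  mem_one : m 1 = t.root
  root_fields : m (6 * t.root) = 0 ∧ m (6 * t.root + 2) = 0 ∧ m (6 * t.root + 3) = 0 ∧
    m (6 * t.root + 4) = 0
  parent_eq : ∀ v ∈ t.nodes, v ≠ t.root → m (6 * v) = t.parent v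
  chain : ∀ u ∈ t.nodes, ∃ l : List ℕ, l.Nodup ∧ (∀ v, v ∈ l ↔ t.IsChild u v) ∧
    DChain A m (6 * u + 1) l
  label_eq : ∀ v ∈ t.nodes, v ≠ t.root → ∃ p, LastOcc S (t.str v) p ∧
    m (6 * v + 3) = p + (t.str (t.parent v)).length + 1 ∧ m (6 * v + 4) = p + (t.str v).length
  leaf_eq : ∀ v, t.IsLeaf v → 1 ≤ m (6 * v + 5) ∧ m (6 * v + 5) ≤ S.length ∧
    t.str v = S.drop (m (6 * v + 5) - 1)
  internal_eq : ∀ v ∈ t.nodes, ¬ t.IsLeaf v → m (6 * v + 5) = 0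
  leaf_of : ∀ v, t.IsLeaf v → m (A + 16 * m (6 * v + 5)) = v

/-- Agreement on the cells that are relevant for `Rep`. -/
structure Agree (A : ℕ) (m m' : ℕ → ℕ) : Prop where
  low : ∀ a < A, m' a = m a
  leaf : ∀ z, m' (A + 16 * z) = m (A + 16 * z)
  ptr : ∀ z, m' (A + 16 * z + 1) = m (A + 16 * z + 1)

/-- Unlink the node `v` from the list that contains it. -/
def unlink (A : ℕ) (m : ℕ → ℕ) (v : ℕ) : ℕ → ℕ :=
  Function.update (Function.update m (m (A + 16 * v + 1)) (m (6 * v + 2)))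
    (A + 16 * m (6 * v + 2) + 1) (m (A + 16 * v + 1))

/-- Put `w`, the only child of `u`, in the place of `u`. -/
def bypass (A : ℕ) (m : ℕ → ℕ) (u w : ℕ) : ℕ → ℕ :=
  Function.update (Function.update (Function.update (Function.update (Function.update
    (Function.update m (m (A + 16 * u + 1)) w)
    (A + 16 * w + 1) (m (A + 16 * u + 1)))
    (6 * w + 2) (m (6 * u + 2)))
    (A + 16 * m (6 * u + 2) + 1) (6 * w + 2))
    (6 * w) (m (6 * u)))
    (6 * w + 3) (m (6 * w + 3) - (m (6 * u + 4) - m (6 * u + 3)) - 1)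

/-! ### The memory representation under deletions -/

namespace Rep

open EdgeTree

variable {S : List ℕ} {N A : ℕ} {m m' : ℕ → ℕ} {t : EdgeTree}

/-- Allows the log cells to be written, as they lie outside the cells on which `Rep` depends. -/
theorem congr (h : Rep S N A m t) (ha : Agree A m m') : Rep S N A m' t := by
  have hA := h.base_le
  have key : ∀ v ∈ t.nodes, ∀ f < 6, m' (6 * v + f) = m (6 * v + f) := fun v hv f hf =>
    ha.low _ (by have := h.node_le v hv; omega)
  have key0 : ∀ v ∈ t.nodes, m' (6 * v) = m (6 * v) := fun v hv => key v hv 0 (by omega)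
  have hr := t.root_mem
  refine ⟨hA, h.node_le, ?_, ?_, ?_, ?_, ?_, ?_, ?_, ?_, ?_⟩
  · rw [ha.low 0 (by omega), h.mem_zero]
  · rw [ha.low 1 (by omega), h.mem_one]
  · rw [key0 _ hr, key _ hr 2 (by omega), key _ hr 3 (by omega), key _ hr 4 (by omega)]
    exact h.root_fields
  · intro v hv hvr
    rw [key0 v hv, h.parent_eq v hv hvr]
  · intro u hu
    obtain ⟨l, h1, h2, h3⟩ := h.chain u hu
    exact ⟨l, h1, h2, h3.congr (key u hu 1 (by omega))
      (fun z hz => key z ((h2 z).1 hz).1 2 (by omega)) (fun z _ => ha.ptr z)⟩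
  · intro v hv hvr
    rw [key v hv 3 (by omega), key v hv 4 (by omega)]
    exact h.label_eq v hv hvr
  · intro v hv
    rw [key v hv.1 5 (by omega)]
    exact h.leaf_eq v hv
  · intro v hv hl
    rw [key v hv 5 (by omega)]
    exact h.internal_eq v hv hl
  · intro v hv
    rw [key v hv.1 5 (by omega), ha.leaf]
    exact h.leaf_of v hv

theorem pointer (h : Rep S N A m t) {v : ℕ} (hv : v ∈ t.nodes) (hr : v ≠ t.root) :
    m (m (A + 16 * v + 1)) = v ∧
    (m (A + 16 * v + 1) = 6 * t.parent v + 1 ∨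
      ∃ z, t.IsChild (t.parent v) z ∧ z ≠ v ∧ m (A + 16 * v + 1) = 6 * z + 2) ∧
    (m (6 * v + 2) = 0 ∨ (t.IsChild (t.parent v) (m (6 * v + 2)) ∧ m (6 * v + 2) ≠ v)) := by
  obtain ⟨l, h1, h2, h3⟩ := h.chain _ (t.parent_mem v hv hr)
  obtain ⟨k1, k2, k3⟩ := h3.pointer h1 ((h2 v).2 ⟨hv, hr, rfl⟩)
  refine ⟨k1, k2.imp_right ?_, k3.imp_right fun k => ⟨(h2 _).1 k.1, k.2⟩⟩
  rintro ⟨z, hz, hzv, k⟩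
  exact ⟨z, (h2 z).1 hz, hzv, k⟩

/-- The cell that points to a node. -/
theorem pointer_lt (h : Rep S N A m t) {v : ℕ} (hv : v ∈ t.nodes) (hr : v ≠ t.root) :
    7 ≤ m (A + 16 * v + 1) ∧ m (A + 16 * v + 1) < 6 * N + 6 ∧
    (m (A + 16 * v + 1) % 6 = 1 ∨ m (A + 16 * v + 1) % 6 = 2) := by
  rcases (h.pointer hv hr).2.1 with k | ⟨z, hz, _, k⟩
  · have := h.node_le _ (t.parent_mem v hv hr)
    omega
  · have := h.node_le _ hz.1
    omega

theorem next_le (h : Rep S N A m t) {v : ℕ} (hv : v ∈ t.nodes) : m (6 * v + 2) ≤ N := by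
  by_cases hr : v = t.root
  · rw [hr, h.root_fields.2.1]; omega
  · rcases (h.pointer hv hr).2.2 with k | ⟨k, _⟩
    · omega
    · exact (h.node_le _ k.1).2

theorem first_le (h : Rep S N A m t) {v : ℕ} (hv : v ∈ t.nodes) : m (6 * v + 1) ≤ N := by
  obtain ⟨l, h1, h2, h3⟩ := h.chain v hv
  cases l with
  | nil => have : m (6 * v + 1) = 0 := h3
           omega
  | cons z l =>
    rw [h3.1]
    exact (h.node_le z ((h2 z).1 (by simp)).1).2

/-- The first child of a node is its only child if it has no next sibling. -/
theorem only_child (h : Rep S N A m t) {u : ℕ} (hu : u ∈ t.nodes) (hl : ¬ t.IsLeaf u)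
    (h0 : m (6 * m (6 * u + 1) + 2) = 0) : ∀ x, t.IsChild u x ↔ x = m (6 * u + 1) := by
  obtain ⟨l, h1, h2, h3⟩ := h.chain u hu
  intro x
  rw [← h2]
  match l, h3 with
  | [], h3 => exact absurd ⟨hu, fun w hw => by simpa using (h2 w).2 hw⟩ hl
  | [z], h3 => simp [h3.1]
  | z :: y :: l, h3 =>
    rw [h3.1, h3.2.2.2.1] at h0
    exact absurd h0 h3.2.2.2.2.1

/-- A node whose first child has a next sibling branches. -/
theorem two_children (h : Rep S N A m t) {u : ℕ} (hu : u ∈ t.nodes) (hl : ¬ t.IsLeaf u)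
    (h0 : m (6 * m (6 * u + 1) + 2) ≠ 0) :
    ∃ v w, v ≠ w ∧ t.IsChild u v ∧ t.IsChild u w := by
  obtain ⟨l, h1, h2, h3⟩ := h.chain u hu
  match l, h3 with
  | [], h3 => exact absurd ⟨hu, fun w hw => by simpa using (h2 w).2 hw⟩ hl
  | [z], h3 =>
    rw [h3.1] at h0
    exact absurd h3.2.2.2 h0
  | z :: y :: l, h3 =>
    refine ⟨z, y, ?_, (h2 z).1 (by simp), (h2 y).1 (by simp)⟩
    rintro rfl
    simp at h1

/-- Only the sibling list below `parent v` changes: the links of `v` lead to the first-child cell of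
that parent or to records of its other children. If `v` has no next sibling, the back pointer is
written to the block of the null node `0`, which no node uses, so no case distinction is needed.
Strings are unchanged, hence so are their last occurrences. -/
theorem unlink (h : Rep S N A m t) {v : ℕ} (hv : t.IsLeaf v) (hr : v ≠ t.root)
    (hsib : ∃ c, c ≠ v ∧ t.IsChild (t.parent v) c) :
    Rep S N A (unlink A m v) (t.eraseLeaf v hv hr) := by
  obtain ⟨k1, k2, k3⟩ := h.pointer hv.1 hr
  obtain ⟨b1, b2, b3⟩ := h.pointer_lt hv.1 hr
  have hA := h.base_le
  set p := m (A + 16 * v + 1) with hp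
  set x := m (6 * v + 2) with hx
  set m' := GrowingSuffixTree.unlink A m v with hm'
  have e : ∀ a, a ≠ p → a ≠ A + 16 * x + 1 → m' a = m a := fun a h1 h2 => by
    rw [hm', GrowingSuffixTree.unlink, Function.update_of_ne h2, Function.update_of_ne h1]
  have e1 : m' p = x := by
    rw [hm', GrowingSuffixTree.unlink, Function.update_of_ne (by omega), Function.update_self]
  have e2 : m' (A + 16 * x + 1) = p := by
    rw [hm', GrowingSuffixTree.unlink, Function.update_self]
  have key : ∀ v ∈ t.nodes, ∀ f < 6, f ≠ 1 → f ≠ 2 → m' (6 * v + f) = m (6 * v + f) :=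
    fun v hv f hf h1 h2 => e _ (by omega) (by have := h.node_le v hv; omega)
  have key0 : ∀ v ∈ t.nodes, m' (6 * v) = m (6 * v) := fun v hv =>
    key v hv 0 (by omega) (by omega) (by omega)
  have key2 : ∀ y ∈ t.nodes, 6 * y + 2 ≠ p → m' (6 * y + 2) = m (6 * y + 2) :=
    fun y hy h2 => e _ h2 (by have := h.node_le y hy; omega)
  have hroot := t.root_mem
  have hsub : ∀ y, y ∈ (t.eraseLeaf v hv hr).nodes → y ≠ v ∧ y ∈ t.nodes := fun y hy =>
    Finset.mem_erase.1 hy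
  have hstr := str_eraseLeaf (t := t) (hv := hv) (hr := hr)
  have hleaf := fun y => isLeaf_eraseLeaf (hr := hr) (hv := hv) hsib (x := y)
  refine ⟨hA, fun y hy => h.node_le y (hsub y hy).2, ?_, ?_, ?_, ?_, ?_, ?_, ?_, ?_, ?_⟩
  · rw [e 0 (by omega) (by omega), h.mem_zero]
  · rw [e 1 (by omega) (by omega), h.mem_one]; rfl
  · change m' (6 * t.root) = 0 ∧ m' (6 * t.root + 2) = 0 ∧ m' (6 * t.root + 3) = 0 ∧
      m' (6 * t.root + 4) = 0
    rw [key0 _ hroot, key2 _ hroot, key _ hroot 3, key _ hroot 4] <;> try omega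
    · exact h.root_fields
    · rcases k2 with k2 | ⟨z, hz, _, k2⟩
      · omega
      · have := hz.2.1; omega
  · intro y hy hyr
    rw [key0 y (hsub y hy).2, h.parent_eq y (hsub y hy).2 hyr]; rfl
  · intro u hu
    obtain ⟨l, h1, h2, h3⟩ := h.chain u (hsub u hu).2
    have hul := h.node_le u (hsub u hu).2
    by_cases huv : u = t.parent v
    · subst huv
      refine ⟨l.erase v, h1.erase v, fun y => ?_, h3.erase hp.symm hx.symm e1 (fun _ => e2) h1
        ((h2 v).2 ⟨hv.1, hr, rfl⟩) (fun z _ => by omega) (fun h => e _ h (by omega))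
        (fun z hz => key2 z ((h2 z).1 hz).1) (fun z hz h => e _ (by omega) (by omega))⟩
      rw [isChild_eraseLeaf, h1.mem_erase_iff, h2, and_comm]
    · refine ⟨l, h1, fun y => ?_, h3.congr (e _ ?_ (by omega)) (fun z hz => key2 z
        ((h2 z).1 hz).1 ?_) (fun z hz => e _ (by omega) ?_)⟩
      · rw [isChild_eraseLeaf, h2]
        refine ⟨fun hy => ⟨hy, ?_⟩, fun hy => hy.1⟩
        rintro rfl
        exact huv hy.2.2.symm
      · rcases k2 with k2 | ⟨z, hz, _, k2⟩ <;> omega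
      · rcases k2 with k2 | ⟨y, hy, _, k2⟩
        · omega
        · intro he
          obtain rfl : z = y := by omega
          exact huv (((h2 z).1 hz).2.2.symm.trans hy.2.2)
      · intro he
        have hzx : z = x := by omega
        rcases k3 with k3 | k3
        · exact h3.ne_zero z hz (hzx.trans k3)
        · rw [← hzx] at k3
          exact huv (((h2 z).1 hz).2.2.symm.trans k3.1.2.2)
  · intro y hy hyr
    rw [hstr y hy, hstr _ ((t.eraseLeaf v hv hr).parent_mem y hy hyr), key y (hsub y hy).2 3,
      key y (hsub y hy).2 4] <;> try omega
    exact h.label_eq y (hsub y hy).2 hyr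
  · intro y hy
    rw [hstr y hy.1, key y (hsub y hy.1).2 5] <;> try omega
    exact h.leaf_eq y ((hleaf y).1 hy).1
  · intro y hy hl
    rw [key y (hsub y hy).2 5] <;> try omega
    exact h.internal_eq y (hsub y hy).2 fun hl' => hl ((hleaf y).2 ⟨hl', (hsub y hy).1⟩)
  · intro y hy
    rw [key y (hsub y hy.1).2 5, e _ (by omega) (by omega)] <;> try omega
    exact h.leaf_of y ((hleaf y).1 hy).1

/-- In the sibling list that contains `u`, the node `w` inherits both links of `u`. The label of `w`
is extended upwards by that of `u`, so only its start position moves; the string of `w` and its last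
occurrence are the same. -/
theorem bypass (h : Rep S N A m t) {u w : ℕ} (hu : u ∈ t.nodes) (hr : u ≠ t.root)
    (hw : ∀ x, t.IsChild u x ↔ x = w) (hlab : t.label u ≠ []) :
    Rep S N A (bypass A m u w) (t.splice u w hu hr hw) := by
  obtain ⟨k1, k2, k3⟩ := h.pointer hu hr
  obtain ⟨b1, b2, b3⟩ := h.pointer_lt hu hr
  have hA := h.base_le
  have hwc := (hw w).2 rfl
  have hwu := splice_child_ne hu hr hw
  have hwl := h.node_le w hwc.1
  have hpar := t.parent_ne_self hu hr
  set p := m (A + 16 * u + 1) with hp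
  set x := m (6 * u + 2) with hx
  have hxw : x ≠ w := by
    rintro hxw
    rcases k3 with k3 | k3
    · omega
    · rw [hxw] at k3
      exact hpar (k3.1.2.2.symm.trans hwc.2.2)
  have hpw : p ≠ 6 * w + 2 := by
    rcases k2 with k2 | ⟨z, hz, _, k2⟩
    · omega
    · intro he
      obtain rfl : w = z := by omega
      exact hpar (hz.2.2.symm.trans hwc.2.2)
  set m' := GrowingSuffixTree.bypass A m u w with hm'
  have e : ∀ a, a ≠ p → a ≠ A + 16 * w + 1 → a ≠ 6 * w + 2 → a ≠ A + 16 * x + 1 → a ≠ 6 * w →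
      a ≠ 6 * w + 3 → m' a = m a := fun a h1 h2 h3 h4 h5 h6 => by
    rw [hm', GrowingSuffixTree.bypass, Function.update_of_ne h6, Function.update_of_ne h5,
      Function.update_of_ne h4, Function.update_of_ne h3, Function.update_of_ne h2,
      Function.update_of_ne h1]
  have e1 : m' p = w := by
    rw [hm', GrowingSuffixTree.bypass]
    simp (disch := omega) only [Function.update_of_ne, ← hp, ← hx, Function.update_self]
  have e2 : m' (A + 16 * w + 1) = p := by
    rw [hm', GrowingSuffixTree.bypass]
    simp (disch := omega) only [Function.update_of_ne, ← hp, ← hx, Function.update_self]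
  have e3 : m' (6 * w + 2) = x := by
    rw [hm', GrowingSuffixTree.bypass]
    simp (disch := omega) only [Function.update_of_ne, ← hp, ← hx, Function.update_self]
  have e4 : m' (A + 16 * x + 1) = 6 * w + 2 := by
    rw [hm', GrowingSuffixTree.bypass]
    simp (disch := omega) only [Function.update_of_ne, ← hp, ← hx, Function.update_self]
  have e5 : m' (6 * w) = m (6 * u) := by
    rw [hm', GrowingSuffixTree.bypass]
    simp (disch := omega) only [Function.update_of_ne, ← hp, ← hx, Function.update_self]
  have e6 : m' (6 * w + 3) = m (6 * w + 3) - (m (6 * u + 4) - m (6 * u + 3)) - 1 := by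
    rw [hm', GrowingSuffixTree.bypass]
    simp (disch := omega) only [← hp, ← hx, Function.update_self]
  have f0 : ∀ y ∈ t.nodes, y ≠ w → m' (6 * y) = m (6 * y) := fun y hy h1 => by
    have := h.node_le y hy; apply e <;> omega
  have f2 : ∀ y ∈ t.nodes, y ≠ w → 6 * y + 2 ≠ p → m' (6 * y + 2) = m (6 * y + 2) :=
    fun y hy h1 h2 => by have := h.node_le y hy; apply e <;> omega
  have f3 : ∀ y ∈ t.nodes, y ≠ w → m' (6 * y + 3) = m (6 * y + 3) := fun y hy h1 => by
    have := h.node_le y hy; apply e <;> omega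
  have f4 : ∀ y ∈ t.nodes, m' (6 * y + 4) = m (6 * y + 4) := fun y hy => by
    have := h.node_le y hy; apply e <;> omega
  have f5 : ∀ y ∈ t.nodes, m' (6 * y + 5) = m (6 * y + 5) := fun y hy => by
    have := h.node_le y hy; apply e <;> omega
  have fp : ∀ y, y ≠ w → y ≠ x → m' (A + 16 * y + 1) = m (A + 16 * y + 1) := fun y h1 h2 => by
    apply e <;> omega
  have hroot := t.root_mem
  have hsub : ∀ y, y ∈ (t.splice u w hu hr hw).nodes → y ≠ u ∧ y ∈ t.nodes := fun y hy =>
    Finset.mem_erase.1 hy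
  have hstr := str_splice (t := t) (hu := hu) (hr := hr) (hw := hw)
  have hleaf := fun y => isLeaf_splice (hu := hu) (hr := hr) (hw := hw) (x := y)
  have hroot2 : 6 * t.root + 2 ≠ p := by
    rcases k2 with k2 | ⟨z, hz, _, k2⟩
    · omega
    · have := hz.2.1; omega
  refine ⟨hA, fun y hy => h.node_le y (hsub y hy).2, ?_, ?_, ?_, ?_, ?_, ?_, ?_, ?_, ?_⟩
  · rw [e 0, h.mem_zero] <;> omega
  · rw [e 1, h.mem_one]; rfl
    all_goals omega
  · change m' (6 * t.root) = 0 ∧ m' (6 * t.root + 2) = 0 ∧ m' (6 * t.root + 3) = 0 ∧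
      m' (6 * t.root + 4) = 0
    rw [f0 _ hroot hwc.2.1.symm, f2 _ hroot hwc.2.1.symm hroot2, f3 _ hroot hwc.2.1.symm,
      f4 _ hroot]
    exact h.root_fields
  · intro y hy hyr
    by_cases hyw : y = w
    · subst hyw
      rw [e5, h.parent_eq u hu hr]
      simp [splice]
    · rw [f0 y (hsub y hy).2 hyw, h.parent_eq y (hsub y hy).2 hyr]
      simp [splice, Function.update_of_ne hyw]
  · intro y hy
    obtain ⟨hyu, hy⟩ := hsub y hy
    obtain ⟨l, h1, h2, h3⟩ := h.chain y hy
    have hyl := h.node_le y hy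
    have hwl' : w ∉ l := fun hwl' => hyu (((h2 w).1 hwl').2.2.symm.trans hwc.2.2)
    by_cases hyv : y = t.parent u
    · subst hyv
      have hul := (h2 u).2 ⟨hu, hr, rfl⟩
      refine ⟨l.map fun y => if y = u then w else y, ?_, fun y => ?_,
        h3.replace hp.symm hx.symm (by omega) e1 e2 e3 (fun _ => e4) h1 hul
        (fun z _ => by omega) (fun h => by apply e <;> omega)
        (fun z hz => f2 z ((h2 z).1 hz).1 ?_) (fun z hz => fp z ?_)⟩
      · refine List.Nodup.map_on (fun a ha b hb hab => ?_) h1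
        split_ifs at hab with g1 g2 g2
        · exact g1.trans g2.symm
        · exact absurd (hab ▸ hb) hwl'
        · exact absurd (hab ▸ ha) hwl'
        · exact hab
      · rw [isChild_splice, List.mem_map]
        constructor
        · rintro ⟨z, hz, rfl⟩
          split_ifs with hzu
          · exact .inl ⟨rfl, rfl⟩
          · exact .inr ⟨fun he => hwl' (he ▸ hz), hzu, (h2 z).1 hz⟩
        · rintro (⟨rfl, _⟩ | ⟨g1, g2, g3⟩)
          · exact ⟨u, hul, if_pos rfl⟩
          · exact ⟨y, (h2 y).2 g3, if_neg g2⟩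
      · rintro rfl; exact hwl' hz
      · rintro rfl; exact hwl' hz
    · refine ⟨l, h1, fun z => ?_, h3.congr ?_ (fun z hz => f2 z ((h2 z).1 hz).1 ?_ ?_)
        (fun z hz => fp z ?_ ?_)⟩
      · rw [isChild_splice, h2]
        constructor
        · intro hz
          refine .inr ⟨fun he => hwl' (he ▸ (h2 z).2 hz), ?_, hz⟩
          rintro rfl
          exact hyv hz.2.2.symm
        · rintro (⟨_, g⟩ | ⟨_, _, g⟩)
          · exact absurd g hyv
          · exact g
      · have : 6 * y + 1 ≠ p := by
          rcases k2 with k2 | ⟨z, hz, _, k2⟩ <;> omega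
        apply e <;> omega
      · rintro rfl; exact hwl' hz
      · rcases k2 with k2 | ⟨y', hy', _, k2⟩
        · omega
        · intro he
          obtain rfl : z = y' := by omega
          exact hyv (((h2 z).1 hz).2.2.symm.trans hy'.2.2)
      · rintro rfl; exact hwl' hz
      · intro he
        rcases k3 with k3 | k3
        · exact h3.ne_zero z hz (he.trans k3)
        · rw [← he] at k3
          exact hyv (((h2 z).1 hz).2.2.symm.trans k3.1.2.2)
  · intro y hy hyr
    rw [hstr y hy, hstr _ ((t.splice u w hu hr hw).parent_mem y hy hyr), f4 y (hsub y hy).2]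
    obtain ⟨q, q1, q2, q3⟩ := h.label_eq y (hsub y hy).2 hyr
    refine ⟨q, q1, ?_, q3⟩
    by_cases hyw : y = w
    · subst hyw
      -- The last occurrences of the strings of `u` and `w` may be different, but only the length of
      -- the label of `u`, a difference of positions, enters.
      obtain ⟨r, r1, r2, r3⟩ := h.label_eq u hu hr
      have := congrArg List.length (str_eq hu hr)
      have := List.length_pos_iff.2 hlab
      rw [List.length_append] at *
      rw [hwc.2.2] at q2
      simp only [splice, Function.update_self]
      rw [e6, q2, r2, r3]
      omega
    · simp only [splice, Function.update_of_ne hyw]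
      rw [f3 y (hsub y hy).2 hyw, q2]
  · intro y hy
    rw [hstr y hy.1, f5 y (hsub y hy.1).2]
    exact h.leaf_eq y ((hleaf y).1 hy)
  · intro y hy hl
    rw [f5 y (hsub y hy).2]
    exact h.internal_eq y (hsub y hy).2 fun hl' => hl ((hleaf y).2 hl')
  · intro y hy
    rw [f5 y (hsub y hy.1).2, show m' (A + 16 * m (6 * y + 5)) = m (A + 16 * m (6 * y + 5)) by
      apply e <;> omega]
    exact h.leaf_of y ((hleaf y).1 hy)

/-- The represented tree is stored in the table at address `0`. -/
theorem holds (h : Rep S N A m t) {k : ℕ} (ht : t.IsSuffixTreeAt (S.drop (k - 1)) t.root)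
    (hm : ∀ a < A, m' a = m a) : HoldsSuffixTree m' S k := by
  have hA := h.base_le
  have key : ∀ v ∈ t.nodes, ∀ f < 6, m' (6 * v + f) = m (6 * v + f) := fun v hv f hf =>
    hm _ (by have := h.node_le v hv; omega)
  have h0 : m' 0 = 0 := by rw [hm 0 (by omega), h.mem_zero]
  have hfield : ∀ v ∈ t.nodes, ∀ f < 6, field m' (m' 0) v f = m (6 * v + f) := fun v hv f hf => by
    rw [field, h0, zero_add, key v hv f hf]
  have hr := t.root_mem
  refine ⟨t, ht.isSuffixTree, by rw [hm 1 (by omega), h.mem_one], ?_, ?_, ?_, ?_, ?_, ?_, ?_⟩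
  · intro h0; have := h.node_le 0 h0; omega
  · rw [hfield _ hr 0 (by omega), hfield _ hr 2 (by omega), hfield _ hr 3 (by omega),
      hfield _ hr 4 (by omega)]
    exact h.root_fields
  · intro v hv hvr
    rw [hfield v hv 0 (by omega)]; exact h.parent_eq v hv hvr
  · intro u hu
    obtain ⟨l, h1, h2, h3⟩ := h.chain u hu
    refine ⟨l, h1, h2, ?_⟩
    have h5 := h3.pointerChain (m' := m') (key u hu 1 (by omega))
      (fun z hz => key z ((h2 z).1 hz).1 2 (by omega))
    simpa [field, h0] using h5
  · intro v hv hvr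
    obtain ⟨p, ⟨p1, p2⟩, p3, p4⟩ := h.label_eq v hv hvr
    rw [hfield v hv 3 (by omega), hfield v hv 4 (by omega), p3, p4]
    obtain ⟨l, hl, hvl⟩ := ht.exists_leaf hv
    obtain ⟨s, hs0, hs, hls⟩ := ht.leaf_suffix l hl
    have hpre := hvl.prefix
    have hstr := str_eq hv hvr
    have hne := List.length_pos_iff.2 (ht.label_ne_nil v hv hvr)
    have hlen := congrArg List.length hstr
    rw [List.length_append] at hlen
    -- The node lies above a leaf, whose suffix begins at offset `k - 1` or later; the last
    -- occurrence of the node's string cannot begin earlier than this one.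
    have hkp : k - 1 ≤ p := by
      rw [hls.str_eq] at hpre
      obtain ⟨y, hy⟩ := hs
      have : s = S.drop (k - 1 + y.length) := by
        rw [← List.drop_drop, ← hy, List.drop_left]
      rw [this] at hpre
      have := p2 _ hpre
      omega
    have hplen := p1.length_le
    rw [List.length_drop] at hplen
    refine ⟨by omega, by omega, by omega, ?_⟩
    rw [substr]
    obtain ⟨y, hy⟩ := p1
    rw [show p + (t.str (t.parent v)).length + 1 - 1 = p + (t.str (t.parent v)).length by omega,
      ← List.drop_drop, ← hy, hstr, List.append_assoc, List.drop_left,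
      show p + (t.str (t.parent v) ++ t.label v).length + 1 -
        (p + (t.str (t.parent v)).length + 1) = (t.label v).length by
          rw [List.length_append]; omega, List.take_left]
  · intro v hv
    rw [hfield v hv.1 5 (by omega)]
    obtain ⟨q1, q2, q3⟩ := h.leaf_eq v hv
    refine ⟨?_, q2, ?_⟩
    · obtain ⟨s, hs0, hs, hls⟩ := ht.leaf_suffix v hv
      have := hs.length_le
      rw [← hls.str_eq, q3, List.length_drop, List.length_drop] at this
      omega
    · rw [suffixFrom, ← q3]; exact spells_str hv.1
  · intro v hv hl
    rw [hfield v hv 5 (by omega)]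
    exact h.internal_eq v hv hl

end Rep

/-! ### The programs

The variables are: `0` the length `n`, `1` the number of nodes, `2` the root, `3` the address of the
auxiliary cells, `4` the address of the input table, `5` the current start position, `6` to `9`
nodes, `10` the address of a pointer, `11` a position, `12` the address of the current log record,
`13` the address of an input record. The log record at address `l` has five pairs of an address
and an overwritten value, in the cells `l + 4, …, l + 13`. -/

open GrowingSuffixTree.Expr GrowingSuffixTree.Cmd

/-- Field `f` of the record of the node in variable `i`. -/
abbrev Expr.cell (i f : ℕ) : Expr := add (six (var i)) (lit f)

/-- Auxiliary cell `f` of the index in variable `i`. -/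
abbrev Expr.aux (i f : ℕ) : Expr := add (add (var 3) (sixteen (var i))) (lit f)

/-- Variable `i` plus a constant. -/
abbrev Expr.off (i f : ℕ) : Expr := add (var i) (lit f)

/-- Undo the changes of one log record. -/
def insertCmd : Cmd :=
  set 12 (sub (var 12) (lit 16)) ;;
  store (mem (off 12 12)) (mem (off 12 13)) ;;
  store (mem (off 12 10)) (mem (off 12 11)) ;;
  store (mem (off 12 8)) (mem (off 12 9)) ;;
  store (mem (off 12 6)) (mem (off 12 7)) ;;
  store (mem (off 12 4)) (mem (off 12 5))

/-- Unlink the leaf with start position in variable `5`. -/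
def unlinkCmd : Cmd :=
  set 6 (mem (add (var 3) (sixteen (var 5)))) ;;
  set 10 (mem (aux 6 1)) ;;
  set 9 (mem (cell 6 2)) ;;
  set 7 (mem (six (var 6))) ;;
  store (off 12 4) (var 10) ;;
  store (off 12 5) (mem (var 10)) ;;
  store (var 10) (var 9) ;;
  store (aux 9 1) (var 10) ;;
  set 8 (mem (cell 7 1))

/-- Log the changes made by `bypassCmd`. -/
def logCmd : Cmd :=
  set 10 (mem (aux 7 1)) ;;
  set 9 (mem (cell 7 2)) ;;
  store (off 12 6) (var 10) ;;
  store (off 12 7) (mem (var 10)) ;;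
  store (off 12 8) (cell 8 2) ;;
  store (off 12 9) (mem (cell 8 2)) ;;
  store (off 12 10) (six (var 8)) ;;
  store (off 12 11) (mem (six (var 8))) ;;
  store (off 12 12) (cell 8 3) ;;
  store (off 12 13) (mem (cell 8 3))

/-- Put the node in variable `8`, the only child of the node in variable `7`, in its place. -/
def bypassCmd : Cmd :=
  store (var 10) (var 8) ;;
  store (aux 8 1) (var 10) ;;
  store (cell 8 2) (var 9) ;;
  store (aux 9 1) (cell 8 2) ;;
  store (six (var 8)) (mem (six (var 7))) ;;
  store (cell 8 3) (sub (sub (mem (cell 8 3)) (sub (mem (cell 7 4)) (mem (cell 7 3)))) (lit 1))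

/-- Delete the leaf with start position in variable `5`. -/
def deleteCmd : Cmd :=
  unlinkCmd ;;
  ifEq (var 7) (var 2) (set 13 (lit 0))
    (ifEq (mem (cell 8 2)) (lit 0) (logCmd ;; bypassCmd) (set 13 (lit 0))) ;;
  set 5 (off 5 1) ;;
  set 12 (off 12 16)

/-- Write back the overwritten values in the log record of `g` at address `l`. -/
def restore (g : ℕ → ℕ) (l : ℕ) (m : ℕ → ℕ) : ℕ → ℕ :=
  Function.update (Function.update (Function.update (Function.update (Function.update m
    (g (l + 12)) (g (l + 13))) (g (l + 10)) (g (l + 11))) (g (l + 8)) (g (l + 9)))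
    (g (l + 6)) (g (l + 7))) (g (l + 4)) (g (l + 5))

/-- With the log records in `g`, the table in `m` can be turned into tables of the suffix trees
of `S[k..]`, `S[k-1..]`, …, `S[1..]`. -/
def Restorable (S : List ℕ) (A : ℕ) (g : ℕ → ℕ) : ℕ → (ℕ → ℕ) → Prop
  | 0, _ => True
  | k + 1, m => (∀ m', (∀ a < A, m' a = m a) → HoldsSuffixTree m' S (k + 1)) ∧
      (g (A + 16 * k + 4) < A ∧ g (A + 16 * k + 6) < A ∧ g (A + 16 * k + 8) < A ∧
        g (A + 16 * k + 10) < A ∧ g (A + 16 * k + 12) < A) ∧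
      Restorable S A g k (restore g (A + 16 * k) m)

theorem restore_congr {g g' m m' : ℕ → ℕ} {l A : ℕ} (hm : ∀ a < A, m' a = m a)
    (hg : ∀ f, 4 ≤ f → f < 14 → g' (l + f) = g (l + f)) :
    ∀ a < A, restore g' l m' a = restore g l m a := by
  intro a ha
  simp only [restore, Function.update_apply, hm a ha]
  rw [hg 4, hg 5, hg 6, hg 7, hg 8, hg 9, hg 10, hg 11, hg 12, hg 13] <;> omega

/-- Restoring from level `k` uses only the table and the log records with index below `k`, so the
preprocessing may go on to write later records. -/
theorem Restorable.congr {S : List ℕ} {A : ℕ} {g g' : ℕ → ℕ} : ∀ {k : ℕ} {m m' : ℕ → ℕ},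
    Restorable S A g k m → (∀ a < A, m' a = m a) →
    (∀ j < k, ∀ f, 4 ≤ f → f < 14 → g' (A + 16 * j + f) = g (A + 16 * j + f)) →
    Restorable S A g' k m'
  | 0, _, _, _, _, _ => trivial
  | k + 1, m, m', ⟨h1, h2, h3⟩, hm, hg => by
    have hk := hg k (by omega)
    refine ⟨fun m'' h => h1 m'' fun a ha => (h a ha).trans (hm a ha), ?_,
      h3.congr (restore_congr hm hk) fun j hj => hg j (by omega)⟩
    rw [hk 4, hk 6, hk 8, hk 10, hk 12] <;> first | exact h2 | omega

theorem Restorable.holds {S : List ℕ} {A k : ℕ} {g m : ℕ → ℕ} (h : Restorable S A g k m)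
    (hk : 1 ≤ k) : HoldsSuffixTree m S k := by
  obtain ⟨k, rfl⟩ : ∃ j, k = j + 1 := ⟨k - 1, by omega⟩
  exact h.1 m fun _ _ => rfl

/-- The logged addresses are below `A`, so writing the record back cannot damage the log while it is
being read. -/
theorem insertCmd_ends {inp : ℕ → ℕ} {W : ℕ} {S : List ℕ} {A k : ℕ} {v m : ℕ → ℕ}
    (hv : v 12 = A + 16 * (k + 1)) (hW : A + 16 * k + 16 ≤ W) (h : Restorable S A m (k + 1) m) :
    insertCmd.Ends inp W v m insertCmd.size fun v' m' =>
      v' 12 = A + 16 * k ∧ Restorable S A m' k m' := by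
  apply ends_of_wp
  obtain ⟨_, ⟨h4, h6, h8, h10, h12⟩, h⟩ := h
  have e : v 12 - 16 = A + 16 * k := by omega
  simp (disch := omega) only [insertCmd, wp, Fits, val, Function.update_self, e, true_and,
    Function.update_of_ne]
  refine ⟨by omega, by omega, by omega, by omega, by omega, by omega, by omega,
    by omega, by omega, by omega, by omega, ?_⟩
  refine h.congr (fun _ _ => rfl) fun j hj f h1 h2 => ?_
  simp (disch := omega) only [Function.update_of_ne]

theorem unlinkCmd_wp {inp : ℕ → ℕ} {W A N n k x p y : ℕ} {v m : ℕ → ℕ}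
    (h3 : v 3 = A) (h5 : v 5 = k) (h12 : v 12 = A + 16 * k) (hW : A + 16 * (N + n + 3) ≤ W)
    (hA : 6 * N + 6 ≤ A) (hk : k ≤ n + 1) (hx : m (A + 16 * k) = x) (hxN : x ≤ N)
    (hp : m (A + 16 * x + 1) = p)
    (hpA : p < A) (hy : m (6 * x + 2) = y) (hyN : y ≤ N) (hu : m (6 * x) ≤ N) :
    unlinkCmd.wp inp W (fun v' m' => (∀ i, i < 6 ∨ 10 < i → v' i = v i) ∧ v' 6 = x ∧
      v' 7 = m (6 * x) ∧ v' 8 = m' (6 * m (6 * x) + 1) ∧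
      m' = unlink A (Function.update (Function.update m (A + 16 * k + 4) p) (A + 16 * k + 5)
        (m p)) x) v m := by
  simp (disch := omega) only [unlinkCmd, wp, Fits, val, Function.update_self, h3, h5, h12,
    Function.update_of_ne, hx, hp, hy, true_and, and_true, unlink]
  refine ⟨by omega, by omega, by omega, by omega, by omega, by omega, by omega, by omega,
    ?_⟩
  intro i hi
  simp (disch := omega) only [Function.update_of_ne]

/-- `m` is the memory before the unlinking, `m₁` the one before the bypass, `m₂` the final one. The
first pair is restored last because its cell may be overwritten again by the bypass, for instance
when the deleted leaf followed `w` in the list; the other four values are all read from `m₁`, so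
their mutual order is irrelevant. -/
theorem restore_eq {g m m₁ m₂ : ℕ → ℕ} {l A : ℕ} (h0 : g (l + 5) = m (g (l + 4)))
    (h1 : g (l + 7) = m₁ (g (l + 6))) (h2 : g (l + 9) = m₁ (g (l + 8)))
    (h3 : g (l + 11) = m₁ (g (l + 10))) (h4 : g (l + 13) = m₁ (g (l + 12)))
    (h : ∀ a < A, a ≠ g (l + 4) → m₁ a = m a)
    (h' : ∀ a < A, a ≠ g (l + 6) → a ≠ g (l + 8) → a ≠ g (l + 10) → a ≠ g (l + 12) →
      m₂ a = m₁ a) : ∀ a < A, restore g l m₂ a = m a := by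
  intro a ha
  simp only [restore, Function.update_apply]
  split_ifs with g0 g1 g2 g3 g4
  · rw [h0, g0]
  · rw [h1, ← g1, h a ha g0]
  · rw [h2, ← g2, h a ha g0]
  · rw [h3, ← g3, h a ha g0]
  · rw [h4, ← g4, h a ha g0]
  · rw [h' a ha g1 g2 g3 g4, h a ha g0]

theorem logCmd_ends {inp : ℕ → ℕ} {W A N n k u w p : ℕ} {v m : ℕ → ℕ}
    (h3 : v 3 = A) (h7 : v 7 = u) (h8 : v 8 = w) (h12 : v 12 = A + 16 * k)
    (hW : A + 16 * (N + n + 3) ≤ W) (hA : 6 * N + 6 ≤ A) (hk : k ≤ n + 1) (hu : u ≤ N) (hw : w ≤ N)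
    (hp : m (A + 16 * u + 1) = p) (hpA : p < A) :
    logCmd.Ends inp W v m logCmd.size fun v' m' => (∀ i, i < 9 ∨ 10 < i → v' i = v i) ∧
      v' 9 = m (6 * u + 2) ∧ v' 10 = p ∧
      (∀ a, (a < A + 16 * k + 6 ∨ A + 16 * k + 13 < a) → m' a = m a) ∧
      (m' (A + 16 * k + 6) = p ∧ m' (A + 16 * k + 8) = 6 * w + 2 ∧ m' (A + 16 * k + 10) = 6 * w ∧
          m' (A + 16 * k + 12) = 6 * w + 3) ∧ m' (A + 16 * k + 7) = m p ∧
        m' (A + 16 * k + 9) = m (6 * w + 2) ∧ m' (A + 16 * k + 11) = m (6 * w) ∧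
        m' (A + 16 * k + 13) = m (6 * w + 3) := by
  apply ends_of_wp
  simp (disch := omega) only [logCmd, wp, Fits, val, Function.update_self, h3, h7, h8, h12,
    Function.update_of_ne, hp, true_and, and_true]
  refine ⟨by omega, by omega, by omega, by omega, by omega, by omega, by omega, by omega, by omega,
    by omega, by omega, by omega, by omega, by omega, by omega, by omega, fun i hi => ?_,
    fun a ha => ?_⟩ <;>
  simp (disch := omega) only [Function.update_of_ne]

theorem bypassCmd_ends {inp : ℕ → ℕ} {W A N n u w p y : ℕ} {v m : ℕ → ℕ}
    (h3 : v 3 = A) (h7 : v 7 = u) (h8 : v 8 = w) (h9 : v 9 = y) (h10 : v 10 = p)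
    (hW : A + 16 * (N + n + 3) ≤ W) (hA : 6 * N + 6 ≤ A) (hu : u ≤ N) (hw : w ≤ N)
    (hp : m (A + 16 * u + 1) = p) (hp6 : p % 6 = 1 ∨ p % 6 = 2)
    (hy : m (6 * u + 2) = y) (hyN : y ≤ N) :
    bypassCmd.Ends inp W v m bypassCmd.size fun v' m' => v' = v ∧ m' = bypass A m u w := by
  apply ends_of_wp
  simp (disch := omega) only [bypassCmd, wp, Fits, val, h3, h7, h8, h9, h10,
    Function.update_of_ne, true_and, and_true, bypass, hp, hy]
  omega

/-- Used in place of `wp` where the branches have been treated by separate lemmas. -/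
theorem Cmd.Ends.ifEq {inp : ℕ → ℕ} {W : ℕ} {a b : Expr} {c d : Cmd} {v m : ℕ → ℕ}
    {Q : (ℕ → ℕ) → (ℕ → ℕ) → Prop} (ha : a.Fits inp W v m) (hb : b.Fits inp W v m)
    (hc : a.val inp v m = b.val inp v m → c.Ends inp W v m c.size Q)
    (hd : a.val inp v m ≠ b.val inp v m → d.Ends inp W v m d.size Q) :
    (Cmd.ifEq a b c d).Ends inp W v m (Cmd.ifEq a b c d).size Q := by
  by_cases hab : a.val inp v m = b.val inp v m
  · obtain ⟨v', m', t, h', ht, hQ⟩ := hc hab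
    exact ⟨v', m', _, .ifTrue ha hb hab h', by simp [size]; omega, hQ⟩
  · obtain ⟨v', m', t, h', ht, hQ⟩ := hd hab
    exact ⟨v', m', _, .ifFalse ha hb hab h', by simp [size]; omega, hQ⟩

theorem unlink_of_ne {A v a : ℕ} {m : ℕ → ℕ} (h : a ≠ m (A + 16 * v + 1))
    (h' : a ≠ A + 16 * m (6 * v + 2) + 1) : unlink A m v a = m a := by
  rw [unlink, Function.update_of_ne h', Function.update_of_ne h]

theorem bypass_of_ne {A u w a : ℕ} {m : ℕ → ℕ} (h : a ≠ m (A + 16 * u + 1)) (h0 : a ≠ 6 * w)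
    (h2 : a ≠ 6 * w + 2) (h3 : a ≠ 6 * w + 3) (hA : ∀ z, a ≠ A + 16 * z + 1) :
    bypass A m u w a = m a := by
  rw [bypass, Function.update_of_ne h3, Function.update_of_ne h0, Function.update_of_ne (hA _),
    Function.update_of_ne h2, Function.update_of_ne (hA _), Function.update_of_ne h]

/-! ### One logged deletion -/

/-- The working memory holds the suffix tree of `S[k..]`, together with the log records of the
deletions that led to it. -/
structure DeletedTo (S : List ℕ) (n N A k : ℕ) (v m : ℕ → ℕ) : Prop where
  v0 : v 0 = n
  v3 : v 3 = A
  v5 : v 5 = k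
  v12 : v 12 = A + 16 * k
  tree : ∃ t : EdgeTree, t.root = v 2 ∧ Rep S N A m t ∧
    t.IsSuffixTreeAt (S.drop (k - 1)) t.root
  zero : ∀ j, k ≤ j → ∀ f, 4 ≤ f → f < 14 → m (A + 16 * j + f) = 0
  restorable : Restorable S A m k m

-- After the unlinking there are three cases: the parent is the root, it still branches, or it is
-- bypassed. The first two leave the last four pairs of the log record zero.
open EdgeTree in
theorem DeletedTo.delete {inp : ℕ → ℕ} {W n N A k : ℕ} {S : List ℕ} {v m : ℕ → ℕ}
    (h : DeletedTo S n N A k v m) (hS : S.length = n + 1) (hk : 1 ≤ k) (hkn : k ≤ n)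
    (hW : A + 16 * (N + n + 3) ≤ W) :
    deleteCmd.Ends inp W v m deleteCmd.size (DeletedTo S n N A (k + 1)) := by
  obtain ⟨t, hrt, hR, ht⟩ := h.tree
  have hA := hR.base_le
  have hdrop : S.drop (k - 1) = S[k - 1] :: S.drop k := by
    rw [List.drop_eq_getElem_cons (by omega), show k - 1 + 1 = k by omega]
  have hRne : S.drop k ≠ [] := by
    rw [Ne, List.drop_eq_nil_iff]; omega
  obtain ⟨x, ⟨hx, hxs⟩, -⟩ := ht.suffix_leaf _ (by rw [hdrop]; simp) List.suffix_rfl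
  have hxr := ht.leaf_ne_root hx
  have hxN := hR.node_le x hx.1
  have hx5 : m (6 * x + 5) = k := by
    obtain ⟨q1, q2, q3⟩ := hR.leaf_eq x hx
    rw [hxs.str_eq] at q3
    have := congrArg List.length q3
    simp only [List.length_drop] at this
    omega
  have hxk : m (A + 16 * k) = x := hx5 ▸ hR.leaf_of x hx
  obtain ⟨p1, p2, p3⟩ := hR.pointer_lt hx.1 hxr
  have hu := hR.parent_eq x hx.1 hxr
  have huN := hR.node_le _ (t.parent_mem x hx.1 hxr)
  have hp := hR.pointer hx.1 hxr
  set p := m (A + 16 * x + 1) with hpdef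
  set u := t.parent x with hudef
  have hyN := hR.next_le hx.1
  refine Ends.seq (ends_of_wp (unlinkCmd_wp h.v3 h.v5 h.v12 hW hA (by omega) hxk hxN.2 hpdef.symm
    (by omega) rfl hyN (by omega))) ?_
  rintro v' m' ⟨hv, v6, v7, v8, hm'⟩
  rw [hu] at v7 v8
  set m₁ := Function.update (Function.update m (A + 16 * k + 4) p) (A + 16 * k + 5) (m p) with hm₁
  have e₁ : ∀ a, a ≠ A + 16 * k + 4 → a ≠ A + 16 * k + 5 → m₁ a = m a := fun a h1 h2 => by
    rw [hm₁, Function.update_of_ne h2, Function.update_of_ne h1]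
  have hR₁ : Rep S N A m₁ t := hR.congr ⟨fun a ha => e₁ a (by omega) (by omega),
    fun z => e₁ _ (by omega) (by omega), fun z => e₁ _ (by omega) (by omega)⟩
  have hsib := (hdrop ▸ ht).exists_sibling hRne hx (hxs.str_eq.trans hdrop)
  have ht₁ := (hdrop ▸ ht).eraseLeaf hRne hx hxr (hxs.str_eq.trans hdrop)
  have hR₂ := hR₁.unlink hx hxr hsib
  rw [← hm'] at hR₂
  set t₁ := t.eraseLeaf x hx hxr with ht₁def
  have hp₁ : m₁ (A + 16 * x + 1) = p := e₁ _ (by omega) (by omega)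
  have hy₁ : m₁ (6 * x + 2) = m (6 * x + 2) := e₁ _ (by omega) (by omega)
  have e₂ : ∀ a, a ≠ A + 16 * k + 4 → a ≠ A + 16 * k + 5 → a ≠ p →
      a ≠ A + 16 * m (6 * x + 2) + 1 → m' a = m a := fun a h1 h2 h3 h4 => by
    rw [hm', unlink_of_ne (by rwa [hp₁]) (by rwa [hy₁]), e₁ a h1 h2]
  have hu₁ : u ∈ t₁.nodes := by
    refine Finset.mem_erase.2 ⟨?_, t.parent_mem x hx.1 hxr⟩
    exact t.parent_ne_self hx.1 hxr
  have hul : ¬ t₁.IsLeaf u := by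
    rw [ht₁def, isLeaf_eraseLeaf hsib]
    exact fun hl => hl.1.2 x ⟨hx.1, hxr, rfl⟩
  have hl4 : m' (A + 16 * k + 4) = p := by
    rw [hm', unlink_of_ne (by rw [hp₁]; omega) (by omega), hm₁,
      Function.update_of_ne (by omega), Function.update_self]
  have hl5 : m' (A + 16 * k + 5) = m p := by
    rw [hm', unlink_of_ne (by rw [hp₁]; omega) (by omega), hm₁, Function.update_self]
  -- The common end of the three cases: a final memory that represents the new tree and contains a
  -- record leading back through `m'` to `m` satisfies the invariant.
  have finish : ∀ v'' m'', (∀ i, i < 6 ∨ 10 < i → i ≠ 13 → v'' i = v i) →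
      (∃ t : EdgeTree, t.root = v 2 ∧ Rep S N A m'' t ∧ t.IsSuffixTreeAt (S.drop k) t.root) →
      (∀ j, j ≠ k → ∀ f, 4 ≤ f → f < 14 → m'' (A + 16 * j + f) = m' (A + 16 * j + f)) →
      m'' (A + 16 * k + 4) = p → m'' (A + 16 * k + 5) = m p →
      (m'' (A + 16 * k + 6) < A ∧ m'' (A + 16 * k + 8) < A ∧ m'' (A + 16 * k + 10) < A ∧
        m'' (A + 16 * k + 12) < A) →
      m'' (A + 16 * k + 7) = m' (m'' (A + 16 * k + 6)) →
      m'' (A + 16 * k + 9) = m' (m'' (A + 16 * k + 8)) →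
      m'' (A + 16 * k + 11) = m' (m'' (A + 16 * k + 10)) →
      m'' (A + 16 * k + 13) = m' (m'' (A + 16 * k + 12)) →
      (∀ a < A, a ≠ m'' (A + 16 * k + 6) → a ≠ m'' (A + 16 * k + 8) →
        a ≠ m'' (A + 16 * k + 10) → a ≠ m'' (A + 16 * k + 12) → m'' a = m' a) →
      (set 5 (off 5 1) ;; set 12 (off 12 16)).Ends inp W v'' m''
        (set 5 (off 5 1) ;; set 12 (off 12 16)).size (DeletedTo S n N A (k + 1)) := by
    intro v'' m'' hv'' htree hlog h4 h5 haddr h7 h9 h11 h13 hrest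
    apply ends_of_wp
    have g5 := hv'' 5 (by omega) (by omega)
    have g12 := hv'' 12 (by omega) (by omega)
    rw [h.v5] at g5
    rw [h.v12] at g12
    simp (disch := omega) only [wp, Fits, val, Function.update_of_ne, g5, g12, true_and]
    refine ⟨by omega, by omega, ?_, ?_, ?_, ?_, ?_, ?_, ?_⟩
    · simp (disch := omega) only [Function.update_of_ne, hv'', h.v0]
    · simp (disch := omega) only [Function.update_of_ne, hv'', h.v3]
    · simp (disch := omega) only [Function.update_of_ne, Function.update_self]
    · rw [Function.update_self]; ring
    · simp (disch := omega) only [Function.update_of_ne, hv'']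
      exact htree
    · intro j hj f hf hf'
      rw [hlog j (by omega) f hf hf', e₂ _ (by omega) (by omega) (by omega) (by omega)]
      exact h.zero j (by omega) f hf hf'
    · obtain ⟨t₂, _, hR₂, ht₂⟩ := htree
      refine ⟨fun m₃ hm₃ => hR₂.holds (by simpa using ht₂) hm₃, ⟨by omega, haddr⟩,
        h.restorable.congr ?_ fun j hj f hf hf' => ?_⟩
      · refine restore_eq (m₁ := m') (by rw [h4, h5]) h7 h9 h11 h13 (fun a ha hne => ?_) hrest
        rw [h4] at hne
        exact e₂ a (by omega) (by omega) hne (by omega)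
      · rw [hlog j (by omega) f hf hf', e₂ _ (by omega) (by omega) (by omega) (by omega)]
  have hskip : t₁.IsSuffixTreeAt (S.drop k) t₁.root →
      (set 13 (lit 0)).Ends inp W v' m' (set 13 (lit 0)).size fun v'' m'' =>
        (set 5 (off 5 1) ;; set 12 (off 12 16)).Ends inp W v'' m''
          (set 5 (off 5 1) ;; set 12 (off 12 16)).size (DeletedTo S n N A (k + 1)) := by
    intro ht'
    apply ends_of_wp
    simp only [wp, Fits, val, zero_le, true_and]
    have hz : ∀ f, 6 ≤ f → f < 14 → m' (A + 16 * k + f) = 0 := fun f h1 h2 => by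
      rw [e₂ _ (by omega) (by omega) (by omega) (by omega)]
      exact h.zero k le_rfl f (by omega) h2
    -- An unused pair of the record asks for `0` to be written to cell `0`, which contains `0`
    -- anyway.
    have hm0 := hR₂.mem_zero
    refine finish _ _ (fun i hi hi' => ?_) ⟨t₁, hrt, hR₂, ht'⟩ (fun _ _ _ _ _ => rfl) hl4 hl5
      ?_ ?_ ?_ ?_ ?_ fun _ _ _ _ _ _ => rfl
    · rw [Function.update_of_ne hi', hv i hi]
    all_goals
      simp (disch := omega) only [hz, hm0]
    omega
  refine Ends.seq (R := fun v'' m'' =>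
        (set 5 (off 5 1) ;; set 12 (off 12 16)).Ends inp W v'' m''
          (set 5 (off 5 1) ;; set 12 (off 12 16)).size (DeletedTo S n N A (k + 1)))
    (Ends.ifEq (by simp [Fits]) (by simp [Fits]) (fun hc => ?_) (fun hc => ?_)) fun _ _ h => h
  · simp only [val, v7, hv 2 (by omega)] at hc
    exact hskip (ht₁.of_branching fun hne => absurd (hc.trans hrt.symm) hne)
  simp only [val, v7, hv 2 (by omega)] at hc
  have hur : u ≠ t₁.root := fun he => hc (he.trans hrt)
  have hwN := hR₂.first_le hu₁
  refine Ends.ifEq (by simp only [Fits, val, v8, true_and]; omega) (by simp [Fits]) (fun hd => ?_)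
    (fun hd => ?_)
  · simp only [val, v8] at hd
    have hw := hR₂.only_child hu₁ hul hd
    have hwc := (hw _).2 rfl
    have hwu := splice_child_ne hu₁ hur hw
    set w := m' (6 * u + 1) with hwdef
    obtain ⟨b1, b2, b3⟩ := hR₂.pointer_lt hu₁ hur
    have hpu := hR₂.pointer hu₁ hur
    have hy'N := hR₂.next_le hu₁
    have hpw : m' (A + 16 * u + 1) ≠ 6 * w + 2 := by
      intro he
      rcases hpu.2.1 with k2 | ⟨z, hz, hzu, k2⟩
      · omega
      · obtain rfl : w = z := by omega
        exact t₁.parent_ne_self hu₁ hur (hz.2.2.symm.trans hwc.2.2)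
    refine Ends.seq (logCmd_ends (N := N) (n := n) (k := k) ((hv 3 (by omega)).trans h.v3) v7 v8
      ((hv 12 (by omega)).trans h.v12) hW hA (by omega) huN.2 hwN rfl (by omega)) ?_
    rintro v₂ m₂ ⟨hv₂, v9, v10, hm₂, ⟨a6, a8, a10, a12⟩, a7, a9, a11, a13⟩
    have hR₃ : Rep S N A m₂ t₁ := hR₂.congr ⟨fun a ha => hm₂ a (by omega),
      fun z => hm₂ _ (by omega), fun z => hm₂ _ (by omega)⟩
    have hpm₂ : m₂ (A + 16 * u + 1) = m' (A + 16 * u + 1) := hm₂ _ (by omega)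
    refine (bypassCmd_ends (N := N) (n := n) (((hv₂ 3 (by omega)).trans (hv 3 (by omega))).trans
      h.v3) ((hv₂ 7 (by omega)).trans v7) ((hv₂ 8 (by omega)).trans v8) v9 v10 hW hA huN.2 hwN
      hpm₂ b3 (hm₂ _ (by omega)) hy'N).mono le_rfl ?_
    rintro v₃ m₃ ⟨rfl, rfl⟩
    have e₃ : ∀ a, a ≠ m' (A + 16 * u + 1) → a ≠ 6 * w → a ≠ 6 * w + 2 → a ≠ 6 * w + 3 →
        (∀ z, a ≠ A + 16 * z + 1) → bypass A m₂ u w a = m₂ a := fun a h1 =>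
      bypass_of_ne (by rwa [hpm₂])
    have e₄ : ∀ j f, 4 ≤ f → f < 14 → bypass A m₂ u w (A + 16 * j + f) = m₂ (A + 16 * j + f) :=
      fun j f h1 h2 => e₃ _ (by omega) (by omega) (by omega) (by omega) fun z => by omega
    refine finish _ _ (fun i hi hi' => ?_) ⟨t₁.splice u w hu₁ hur hw, hrt, hR₃.bypass hu₁ hur hw
      (ht₁.label_ne_nil u hu₁ hur), ht₁.splice hu₁ hur hw⟩ (fun j hj f hf hf' => ?_) ?_ ?_ ?_ ?_
      ?_ ?_ ?_ ?_
    · rw [hv₂ i (by omega), hv i hi]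
    · rw [e₄ j f hf hf', hm₂ _ (by omega)]
    · rw [e₄ _ 4 (by omega) (by omega), hm₂ _ (by omega), hl4]
    · rw [e₄ _ 5 (by omega) (by omega), hm₂ _ (by omega), hl5]
    all_goals
      simp (disch := omega) only [e₄, a6, a7, a8, a9, a10, a11, a12, a13]
    · omega
    · intro a ha h1 h2 h3 h4
      rw [e₃ a h1 h3 h2 h4 (fun z => by omega), hm₂ a (by omega)]
  · simp only [val, v8] at hd
    exact hskip (ht₁.of_branching fun _ => hR₂.two_children hu₁ hul hd)

/-! ### Copying the input -/

theorem PointerChain.start {next : ℕ → ℕ} : ∀ {l : List ℕ} {p : ℕ}, PointerChain next p l →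
    p ≠ 0 → p ∈ l
  | [], _, h, hp => absurd h hp
  | v :: _, _, ⟨h, _⟩, _ => by simp [h]

theorem PointerChain.next_mem_tail {next : ℕ → ℕ} : ∀ {l : List ℕ} {p x : ℕ},
    PointerChain next p l → x ∈ l → next x ≠ 0 → next x ∈ l.tail
  | v :: l, p, x, ⟨_, _, h⟩, hx, hn => by
    rcases List.mem_cons.1 hx with rfl | hx
    · exact h.start hn
    · exact List.mem_of_mem_tail (h.next_mem_tail hx hn)

theorem PointerChain.start_not_mem_tail {next : ℕ → ℕ} : ∀ {l : List ℕ} {p : ℕ},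
    PointerChain next p l → l.Nodup → p ∉ l.tail
  | [], _, _, _ => by simp
  | v :: l, p, ⟨h, _⟩, hnd => h ▸ (List.nodup_cons.1 hnd).1

/-- Together with `start_not_mem_tail` this shows that each list element is pointed to from one
place only, so back pointers are well defined. -/
theorem PointerChain.next_inj {next : ℕ → ℕ} : ∀ {l : List ℕ} {p x y : ℕ},
    PointerChain next p l → l.Nodup → x ∈ l → y ∈ l → next x ≠ 0 → next x = next y → x = y
  | v :: l, p, x, y, ⟨_, _, h⟩, hnd, hx, hy, hn, he => by
    have hnd' := (List.nodup_cons.1 hnd).2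
    rcases List.mem_cons.1 hx with rfl | hx' <;> rcases List.mem_cons.1 hy with rfl | hy'
    · rfl
    · have := h.next_mem_tail hy' (he ▸ hn)
      rw [← he] at this
      exact absurd this (h.start_not_mem_tail hnd')
    · have := h.next_mem_tail hx' hn
      rw [he] at this
      exact absurd this (h.start_not_mem_tail hnd')
    · exact h.next_inj hnd' hx' hy' hn he

theorem DChain.of_pointerChain {A : ℕ} {m next : ℕ → ℕ} : ∀ {l : List ℕ} {p a : ℕ},
    PointerChain next p l → m a = p → (∀ z ∈ l, m (6 * z + 2) = next z) →
    (p ≠ 0 → m (A + 16 * p + 1) = a) →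
    (∀ z ∈ l, next z ≠ 0 → m (A + 16 * next z + 1) = 6 * z + 2) → DChain A m a l
  | [], _, _, h, ha, _, _, _ => ha.trans h
  | v :: l, p, a, ⟨h1, h2, h3⟩, ha, hn, hp, hpn => by
    subst h1
    exact ⟨ha, h2, hp h2, DChain.of_pointerChain h3 (hn _ (by simp))
      (fun z hz => hn z (by simp [hz])) (hpn _ (by simp)) (fun z hz => hpn z (by simp [hz]))⟩

/-- The input array contains the suffix tree `t` of `S`, with nodes `1, …, N`. -/
structure Source (inp : ℕ → ℕ) (S : List ℕ) (n N : ℕ) (t : EdgeTree) : Prop where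
  length : S.length = n + 1
  tree : t.IsSuffixTree S
  nodes : t.nodes = Finset.Icc 1 N
  inp_zero : inp 0 = n
  inp_one : inp 1 = N
  inp_two : inp 2 = t.root
  stores : StoresTree inp (n + 4) t S 1

namespace Source

open EdgeTree

variable {inp : ℕ → ℕ} {S : List ℕ} {n N : ℕ} {t : EdgeTree}

theorem mem_iff (h : Source inp S n N t) {x : ℕ} : x ∈ t.nodes ↔ 1 ≤ x ∧ x ≤ N := by
  rw [h.nodes, Finset.mem_Icc]

theorem card_le (h : Source inp S n N t) : N ≤ 2 * n + 2 := by
  have := h.tree.at_root.card_nodes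
  rw [h.nodes, Nat.card_Icc, h.length] at this
  omega

theorem parent_le (h : Source inp S n N t) {x : ℕ} (hx : x ∈ t.nodes) :
    field inp (n + 4) x 0 ≤ N := by
  by_cases hr : x = t.root
  · rw [hr, h.stores.root_fields.1]; omega
  · rw [h.stores.parent_eq x hx hr]
    exact (h.mem_iff.1 (t.parent_mem x hx hr)).2

theorem first_child (h : Source inp S n N t) {x : ℕ} (hx : x ∈ t.nodes)
    (h0 : field inp (n + 4) x 1 ≠ 0) : t.IsChild x (field inp (n + 4) x 1) := by
  obtain ⟨l, h1, h2, h3⟩ := h.stores.children x hx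
  exact (h2 _).1 (h3.start h0)

theorem next_sibling (h : Source inp S n N t) {x : ℕ} (hx : x ∈ t.nodes)
    (h0 : field inp (n + 4) x 2 ≠ 0) :
    x ≠ t.root ∧ t.IsChild (t.parent x) (field inp (n + 4) x 2) := by
  have hr : x ≠ t.root := by
    rintro rfl
    exact h0 h.stores.root_fields.2.1
  obtain ⟨l, h1, h2, h3⟩ := h.stores.children _ (t.parent_mem x hx hr)
  exact ⟨hr, (h2 _).1 (List.mem_of_mem_tail (h3.next_mem_tail ((h2 x).2 ⟨hx, hr, rfl⟩) h0))⟩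

theorem first_le (h : Source inp S n N t) {x : ℕ} (hx : x ∈ t.nodes) :
    field inp (n + 4) x 1 ≤ N := by
  by_cases h0 : field inp (n + 4) x 1 = 0
  · omega
  · exact (h.mem_iff.1 (h.first_child hx h0).1).2

theorem next_le (h : Source inp S n N t) {x : ℕ} (hx : x ∈ t.nodes) :
    field inp (n + 4) x 2 ≤ N := by
  by_cases h0 : field inp (n + 4) x 2 = 0
  · omega
  · exact (h.mem_iff.1 (h.next_sibling hx h0).2.1).2

theorem start_le (h : Source inp S n N t) {x : ℕ} (hx : x ∈ t.nodes) :
    field inp (n + 4) x 5 ≤ n + 1 := by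
  by_cases hl : t.IsLeaf x
  · rw [← h.length]; exact (h.stores.leaf_eq x hl).2.1
  · rw [h.stores.internal_eq x hx hl]; omega

/-- This lemma and the next two say that no two pointer cells of the input have the same nonzero
target. Hence the copying loop never overwrites a back pointer of a node. -/
theorem first_inj (h : Source inp S n N t) {x y : ℕ} (hx : x ∈ t.nodes) (hy : y ∈ t.nodes)
    (h0 : field inp (n + 4) x 1 ≠ 0) (he : field inp (n + 4) x 1 = field inp (n + 4) y 1) :
    x = y :=
  (h.first_child hx h0).2.2.symm.trans (he ▸ (h.first_child hy (he ▸ h0)).2.2)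

theorem next_inj (h : Source inp S n N t) {x y : ℕ} (hx : x ∈ t.nodes) (hy : y ∈ t.nodes)
    (h0 : field inp (n + 4) x 2 ≠ 0) (he : field inp (n + 4) x 2 = field inp (n + 4) y 2) :
    x = y := by
  obtain ⟨hxr, hx'⟩ := h.next_sibling hx h0
  obtain ⟨hyr, hy'⟩ := h.next_sibling hy (he ▸ h0)
  have hxy : t.parent x = t.parent y := hx'.2.2.symm.trans (he ▸ hy'.2.2)
  obtain ⟨l, h1, h2, h3⟩ := h.stores.children _ (t.parent_mem x hx hxr)
  exact h3.next_inj h1 ((h2 x).2 ⟨hx, hxr, rfl⟩) ((h2 y).2 ⟨hy, hyr, hxy.symm⟩) h0 he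

theorem first_ne_next (h : Source inp S n N t) {x y : ℕ} (hx : x ∈ t.nodes) (hy : y ∈ t.nodes)
    (h0 : field inp (n + 4) x 1 ≠ 0) : field inp (n + 4) x 1 ≠ field inp (n + 4) y 2 := by
  intro he
  obtain ⟨hyr, hy'⟩ := h.next_sibling hy (he ▸ h0)
  have hx' := h.first_child hx h0
  have hxy : t.parent y = x := hy'.2.2.symm.trans (he ▸ hx'.2.2)
  obtain ⟨l, h1, h2, h3⟩ := h.stores.children x hx
  have := h3.next_mem_tail ((h2 y).2 ⟨hy, hyr, hxy⟩) (he ▸ h0 : field inp (n + 4) y 2 ≠ 0)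
  refine h3.start_not_mem_tail h1 ?_
  rw [he]; exact this

theorem isLeaf_of_start (h : Source inp S n N t) {x : ℕ} (hx : x ∈ t.nodes)
    (h0 : field inp (n + 4) x 5 ≠ 0) : t.IsLeaf x := by
  by_contra hl
  exact h0 (h.stores.internal_eq x hx hl)

theorem str_leaf (h : Source inp S n N t) {x : ℕ} (hx : t.IsLeaf x) :
    t.str x = S.drop (field inp (n + 4) x 5 - 1) := (h.stores.leaf_eq x hx).2.2.str_eq

/-- Ensures that the table from start positions to leaves is not overwritten while copying. -/
theorem start_inj (h : Source inp S n N t) {x y : ℕ} (hx : x ∈ t.nodes) (hy : y ∈ t.nodes)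
    (h0 : field inp (n + 4) x 5 ≠ 0) (he : field inp (n + 4) x 5 = field inp (n + 4) y 5) :
    x = y := by
  have hx' := h.isLeaf_of_start hx h0
  have hy' := h.isLeaf_of_start hy (he ▸ h0)
  exact h.tree.at_root.eq_of_str_eq hx' hy' (by rw [h.str_leaf hx', h.str_leaf hy', he])

theorem exists_leaf (h : Source inp S n N t) {k : ℕ} (hk : 1 ≤ k) (hkn : k ≤ n + 1) :
    ∃ x, t.IsLeaf x ∧ field inp (n + 4) x 5 = k := by
  have hne : S.drop (k - 1) ≠ [] := by
    rw [Ne, List.drop_eq_nil_iff, h.length]; omega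
  obtain ⟨x, ⟨hx, hxs⟩, -⟩ := h.tree.suffix_leaf _ hne (List.drop_suffix _ _)
  refine ⟨x, hx, ?_⟩
  have h1 := congrArg List.length (hxs.str_eq.symm.trans (h.str_leaf hx))
  have h2 := h.stores.leaf_eq x hx
  have := h.length
  simp only [List.length_drop] at h1
  omega

theorem label_length (h : Source inp S n N t) {x : ℕ} (hx : x ∈ t.nodes) (hr : x ≠ t.root) :
    (t.label x).length = field inp (n + 4) x 4 - field inp (n + 4) x 3 + 1 ∧
      field inp (n + 4) x 4 ≤ n + 1 ∧ field inp (n + 4) x 3 ≤ n + 1 := by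
  obtain ⟨h1, h2, h3, h4⟩ := h.stores.label_eq x hx hr
  rw [h.length] at h3
  refine ⟨?_, h3, by omega⟩
  rw [h4, substr, List.length_take, List.length_drop, h.length]
  omega

end Source

/-- Read the sizes and the root. -/
def initCmd : Cmd :=
  set 0 (inp (lit 0)) ;;
  set 1 (inp (lit 1)) ;;
  set 2 (inp (lit 2)) ;;
  set 3 (add (six (var 1)) (lit 6)) ;;
  set 4 (off 0 4) ;;
  store (lit 1) (var 2)

/-- Copy the next record without its label, and set the auxiliary cells for its pointers. -/
def copyCmd : Cmd :=
  set 6 (off 6 1) ;;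
  set 13 (add (var 4) (six (var 6))) ;;
  store (six (var 6)) (inp (off 13 0)) ;;
  store (cell 6 1) (inp (off 13 1)) ;;
  store (cell 6 2) (inp (off 13 2)) ;;
  store (cell 6 5) (inp (off 13 5)) ;;
  store (add (add (var 3) (sixteen (inp (off 13 1)))) (lit 1)) (cell 6 1) ;;
  store (add (add (var 3) (sixteen (inp (off 13 2)))) (lit 1)) (cell 6 2) ;;
  store (add (var 3) (sixteen (inp (off 13 5)))) (var 6)

/-- The global variables have their values. -/
structure Globals (n N A rt : ℕ) (v : ℕ → ℕ) : Prop where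
  v0 : v 0 = n
  v1 : v 1 = N
  v2 : v 2 = rt
  v3 : v 3 = A
  v4 : v 4 = n + 4

theorem Globals.congr {n N A rt : ℕ} {v v' : ℕ → ℕ} (h : Globals n N A rt v)
    (hv : ∀ i < 5, v' i = v i) : Globals n N A rt v' :=
  ⟨(hv 0 (by omega)).trans h.v0, (hv 1 (by omega)).trans h.v1, (hv 2 (by omega)).trans h.v2,
    (hv 3 (by omega)).trans h.v3, (hv 4 (by omega)).trans h.v4⟩

/-- The records of the nodes `1, …, j` have been copied without their labels. -/
structure Copied (inp : ℕ → ℕ) (n N A rt j : ℕ) (m : ℕ → ℕ) : Prop where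
  m0 : m 0 = 0
  m1 : m 1 = rt
  copy : ∀ x, 1 ≤ x → x ≤ j → m (6 * x) = field inp (n + 4) x 0 ∧
    m (6 * x + 1) = field inp (n + 4) x 1 ∧ m (6 * x + 2) = field inp (n + 4) x 2 ∧
    m (6 * x + 5) = field inp (n + 4) x 5
  label_zero : ∀ x, 1 ≤ x → x ≤ N → m (6 * x + 3) = 0 ∧ m (6 * x + 4) = 0
  zero : ∀ z f, 2 ≤ f → f < 16 → m (A + 16 * z + f) = 0
  ptr1 : ∀ x, 1 ≤ x → x ≤ j → field inp (n + 4) x 1 ≠ 0 →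
    m (A + 16 * field inp (n + 4) x 1 + 1) = 6 * x + 1
  ptr2 : ∀ x, 1 ≤ x → x ≤ j → field inp (n + 4) x 2 ≠ 0 →
    m (A + 16 * field inp (n + 4) x 2 + 1) = 6 * x + 2
  leaf : ∀ x, 1 ≤ x → x ≤ j → field inp (n + 4) x 5 ≠ 0 →
    m (A + 16 * field inp (n + 4) x 5) = x

section

variable {inp : ℕ → ℕ} {S : List ℕ} {n N A W : ℕ} {t : EdgeTree}

theorem Source.init (h : Source inp S n N t) (hA : A = 6 * N + 6)
    (hW : A + 16 * (N + n + 3) ≤ W) :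
    initCmd.Ends inp W (fun _ => 0) (fun _ => 0) initCmd.size fun v' m' =>
      Globals n N A t.root v' ∧ v' 6 = 0 ∧ Copied inp n N A t.root 0 m' := by
  have hroot := h.mem_iff.1 t.root_mem
  apply ends_of_wp
  simp (disch := omega) only [initCmd, wp, Fits, val, h.inp_zero, h.inp_one, h.inp_two,
    Function.update_of_ne, Function.update_self, true_and]
  refine ⟨by omega, by omega, by omega, by omega, by omega, by omega, ⟨?_, ?_, ?_, ?_, ?_⟩, ?_⟩
  · simp
  · simp
  · simp
  · simp [hA]
  · simp
  · constructor
    · simp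
    · simp
    · intro x _ _; omega
    · intro x h1 h2
      simp (disch := omega) only [Function.update_of_ne, and_self]
    · intro z f h1 h2
      simp (disch := omega) only [Function.update_of_ne]
    all_goals intro x _ _; omega

/-- Null pointers, and the start `0` at internal nodes, direct the auxiliary writes to block `0`,
which is never consulted. -/
theorem Source.copy (h : Source inp S n N t) (hA : A = 6 * N + 6)
    (hW : A + 16 * (N + n + 3) ≤ W) {j : ℕ} (hj : j < N) {v m : ℕ → ℕ}
    (hv : Globals n N A t.root v) (h6 : v 6 = j) (hm : Copied inp n N A t.root j m) :
    copyCmd.Ends inp W v m copyCmd.size fun v' m' =>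
      Globals n N A t.root v' ∧ v' 6 = j + 1 ∧ Copied inp n N A t.root (j + 1) m' := by
  have hx : j + 1 ∈ t.nodes := h.mem_iff.2 (by omega)
  have f0 := h.parent_le hx
  have f1 := h.first_le hx
  have f2 := h.next_le hx
  have f5 := h.start_le hx
  apply ends_of_wp
  have e : ∀ f, inp (n + 4 + 6 * (j + 1) + f) = field inp (n + 4) (j + 1) f := fun _ => rfl
  simp (disch := omega) only [copyCmd, wp, Fits, val, hv.v3, hv.v4, h6, e,
    Function.update_of_ne, Function.update_self, true_and]
  repeat refine ⟨by omega, ?_⟩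
  refine ⟨?_, ?_⟩
  · exact hv.congr fun i hi => by simp (disch := omega) only [Function.update_of_ne]
  constructor
  · simp (disch := omega) only [Function.update_of_ne, hm.m0]
  · simp (disch := omega) only [Function.update_of_ne, hm.m1]
  · intro x h1 h2
    by_cases hxj : x = j + 1
    · subst hxj
      simp (disch := omega) only [Function.update_of_ne, Function.update_self, and_self]
    · simp (disch := omega) only [Function.update_of_ne]
      exact hm.copy x h1 (by omega)
  · intro x h1 h2
    simp (disch := omega) only [Function.update_of_ne]
    exact hm.label_zero x h1 h2
  · intro z f h1 h2
    simp (disch := omega) only [Function.update_of_ne]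
    exact hm.zero z f h1 h2
  · intro x h1 h2 hne
    have g2 := h.first_ne_next (h.mem_iff.2 ⟨h1, by omega⟩) hx hne
    by_cases hxj : x = j + 1
    · subst hxj
      simp (disch := omega) only [Function.update_of_ne, Function.update_self]
    · have g1 := mt (h.first_inj (h.mem_iff.2 ⟨h1, by omega⟩) hx hne) hxj
      have := h.first_le (h.mem_iff.2 ⟨h1, by omega⟩ : x ∈ t.nodes)
      simp (disch := omega) only [Function.update_of_ne]
      exact hm.ptr1 x h1 (by omega) hne
  · intro x h1 h2 hne
    by_cases hxj : x = j + 1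
    · subst hxj
      simp (disch := omega) only [Function.update_of_ne, Function.update_self]
    · have g1 := mt (h.next_inj (h.mem_iff.2 ⟨h1, by omega⟩) hx hne) hxj
      have g2 : field inp (n + 4) x 2 ≠ field inp (n + 4) (j + 1) 1 := fun he =>
        h.first_ne_next hx (h.mem_iff.2 ⟨h1, by omega⟩) (he ▸ hne) he.symm
      have := h.next_le (h.mem_iff.2 ⟨h1, by omega⟩ : x ∈ t.nodes)
      simp (disch := omega) only [Function.update_of_ne]
      exact hm.ptr2 x h1 (by omega) hne
  · intro x h1 h2 hne
    by_cases hxj : x = j + 1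
    · subst hxj
      simp only [Function.update_self]
    · have g1 := mt (h.start_inj (h.mem_iff.2 ⟨h1, by omega⟩) hx hne) hxj
      simp (disch := omega) only [Function.update_of_ne]
      exact hm.leaf x h1 (by omega) hne

/-- The loop that copies the records. -/
def copyLoop : Cmd := whileNe (var 6) (var 1) copyCmd

theorem Source.copyLoop (h : Source inp S n N t) (hA : A = 6 * N + 6)
    (hW : A + 16 * (N + n + 3) ≤ W) {v m : ℕ → ℕ}
    (hv : Globals n N A t.root v) (h6 : v 6 = 0) (hm : Copied inp n N A t.root 0 m) :
    copyLoop.Ends inp W v m (1000 * N + 1000) fun v' m' =>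
      Globals n N A t.root v' ∧ Copied inp n N A t.root N m' := by
  have key : ∀ v m, (Globals n N A t.root v ∧ v 6 ≤ N ∧ Copied inp n N A t.root (v 6) m) →
      (var 6).val inp v m ≠ (var 1).val inp v m → ∃ v' m' t', Exec inp W copyCmd v m v' m' t' ∧
      t' + (((var 6).compile 0).length + ((var 1).compile 1).length + 2) + 1000 * (N - v' 6) ≤
        1000 * (N - v 6) ∧
      Globals n N A t.root v' ∧ v' 6 ≤ N ∧ Copied inp n N A t.root (v' 6) m' := by
    rintro v m ⟨hv, hj, hm⟩ hne
    have hj' : v 6 < N := lt_of_le_of_ne hj fun he => hne (he.trans hv.v1.symm)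
    obtain ⟨v', m', t', h1, h2, h3, h4, h5⟩ := h.copy hA hW hj' hv rfl hm
    have hg : copyCmd.size + (((var 6).compile 0).length + ((var 1).compile 1).length + 2) ≤
      1000 := by decide
    exact ⟨v', m', t', h1, by omega, h3, by omega, by rw [h4]; exact h5⟩
  obtain ⟨v', m', t', h1, h2, h3, h4⟩ := exec_whileNe (inp := inp) (W := W) (a := var 6)
    (b := var 1) (c := copyCmd) (fun v _ => 1000 * (N - v 6)) _ rfl
    (fun v m hI => ⟨trivial, trivial, key v m hI⟩) ⟨hv, by omega, by rw [h6]; exact hm⟩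
  have hg : ((var 6).compile 0).length + ((var 1).compile 1).length + 2 ≤ 1000 := by decide
  simp only [h6] at h2
  have h5 : v' 6 = N := h4.trans h3.1.v1
  have h7 := h3.2.2
  rw [h5] at h7
  exact ⟨v', m', t', h1, by omega, h3.1, h7⟩

end

/-! ### Computing the labels -/

/-- Mark the node in variable `6`, store the label of its incoming edge, which ends at the position
in variable `11`, and go to its parent. -/
def climbStep : Cmd :=
  store (aux 6 2) (lit 1) ;;
  store (cell 6 4) (var 11) ;;
  set 13 (add (var 4) (six (var 6))) ;;
  set 11 (sub (var 11) (sub (inp (off 13 4)) (inp (off 13 3)))) ;;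
  store (cell 6 3) (var 11) ;;
  set 11 (sub (var 11) (lit 1)) ;;
  set 6 (inp (off 13 0))

/-- Climb from the leaf with start position in variable `5` to a marked node. -/
def climbCmd : Cmd :=
  (set 6 (mem (add (var 3) (sixteen (var 5)))) ;; set 11 (off 0 1)) ;;
  whileNe (mem (aux 6 2)) (lit 1) climbStep ;;
  set 5 (sub (var 5) (lit 1))

/-- Climb from all leaves, in decreasing order of start positions. -/
def climbLoop : Cmd :=
  (store (aux 2 2) (lit 1) ;; set 5 (off 0 1)) ;;
  whileNe (var 5) (lit 0) climbCmd

/-- The number of unmarked nodes. -/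
def unmarked (A N : ℕ) (m : ℕ → ℕ) : ℕ :=
  ((Finset.Icc 1 N).filter fun x => m (A + 16 * x + 2) ≠ 1).card

/-- The number of unmarked nodes is the potential that pays for the climbs. -/
theorem unmarked_lt {A N : ℕ} {m m' : ℕ → ℕ} {x : ℕ} (hx : 1 ≤ x) (hxN : x ≤ N)
    (h : m (A + 16 * x + 2) ≠ 1) (h' : m' (A + 16 * x + 2) = 1)
    (he : ∀ z, z ≠ x → m' (A + 16 * z + 2) = m (A + 16 * z + 2)) :
    unmarked A N m' < unmarked A N m := by
  refine Finset.card_lt_card ⟨fun z hz => ?_, fun hs => ?_⟩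
  · simp only [Finset.mem_filter] at hz ⊢
    have hzx : z ≠ x := by
      rintro rfl
      exact hz.2 h'
    rw [he z hzx] at hz
    exact hz
  · have := hs (Finset.mem_filter.2 ⟨Finset.mem_Icc.2 ⟨hx, hxN⟩, h⟩)
    exact (Finset.mem_filter.1 this).2 h'

theorem unmarked_le (A N : ℕ) (m : ℕ → ℕ) : unmarked A N m ≤ N :=
  (Finset.card_filter_le _ _).trans (by simp)

/-- The marked nodes have correct labels, and the unmarked nodes have no occurrences after the
first `k` suffixes. The memory was `m₀` before. -/
structure Labelled (inp : ℕ → ℕ) (S : List ℕ) (N A : ℕ) (t : EdgeTree) (m₀ : ℕ → ℕ) (k : ℕ)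
    (m : ℕ → ℕ) : Prop where
  frame : ∀ a, (∀ x, 1 ≤ x → x ≤ N → a ≠ 6 * x + 3 ∧ a ≠ 6 * x + 4) →
    (∀ z, a ≠ A + 16 * z + 2) → m a = m₀ a
  root_label : m (6 * t.root + 3) = 0 ∧ m (6 * t.root + 4) = 0
  root_marked : m (A + 16 * t.root + 2) = 1
  label : ∀ x ∈ t.nodes, x ≠ t.root → m (A + 16 * x + 2) = 1 → ∃ p, LastOcc S (t.str x) p ∧
    m (6 * x + 3) = p + (t.str (t.parent x)).length + 1 ∧ m (6 * x + 4) = p + (t.str x).length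
  occ : ∀ x ∈ t.nodes, m (A + 16 * x + 2) ≠ 1 → ∀ q, t.str x <+: S.drop q → q < k

section

variable {inp : ℕ → ℕ} {S : List ℕ} {n N A W : ℕ} {t : EdgeTree} {m₀ : ℕ → ℕ}

open EdgeTree

/-- The climb from the leaf `l` with start position `k` has arrived at the node in
variable `6`. -/
structure Climbing (inp : ℕ → ℕ) (S : List ℕ) (n N A : ℕ) (t : EdgeTree) (m₀ : ℕ → ℕ) (k l : ℕ)
    (v m : ℕ → ℕ) : Prop where
  globals : Globals n N A t.root v
  v5 : v 5 = k
  v6 : v 6 ∈ t.nodes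
  v11 : v 11 + 1 = k + (t.str (v 6)).length
  pre : t.str (v 6) <+: S.drop (k - 1)
  labelled : Labelled inp S N A t m₀ k m
  closed : ∀ x ∈ t.nodes, x ≠ t.root → m (A + 16 * x + 2) = 1 →
    m (A + 16 * t.parent x + 2) = 1 ∨ t.parent x = v 6
  leaf : m (A + 16 * l + 2) = 1 ∨ v 6 = l

/-- An unmarked node has no occurrence after the current one, which is therefore its last. From the
input labels only the lengths are used; the new positions are counted back from the end of the
string. -/
theorem Source.climbStep (h : Source inp S n N t) (hA : A = 6 * N + 6)
    (hW : A + 16 * (N + n + 3) ≤ W) {k l : ℕ} (hk : 1 ≤ k) {v m : ℕ → ℕ}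
    (hc : Climbing inp S n N A t m₀ k l v m) (hne : m (A + 16 * v 6 + 2) ≠ 1) :
    climbStep.Ends inp W v m climbStep.size fun v' m' =>
      Climbing inp S n N A t m₀ k l v' m' ∧ unmarked A N m' < unmarked A N m := by
  obtain ⟨hv, h5, hx, h11, hpre, hl, hcl, hleaf⟩ := hc
  have hxN := h.mem_iff.1 hx
  have hr : v 6 ≠ t.root := by
    intro he
    rw [he] at hne
    exact hne hl.root_marked
  set x := v 6 with hxdef
  obtain ⟨q1, q2, q3⟩ := h.label_length hx hr
  have hpar := h.stores.parent_eq x hx hr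
  have hparN := h.mem_iff.1 (t.parent_mem x hx hr)
  have hlen := hpre.length_le
  rw [List.length_drop, h.length] at hlen
  have hstr := str_eq hx hr
  have hlen' := congrArg List.length hstr
  rw [List.length_append] at hlen'
  apply ends_of_wp
  have e : ∀ f, inp (n + 4 + 6 * x + f) = field inp (n + 4) x f := fun _ => rfl
  simp (disch := omega) only [GrowingSuffixTree.climbStep, wp, Fits, val, hv.v3, hv.v4, ← hxdef,
    e, hpar, Function.update_of_ne, Function.update_self, true_and]
  repeat refine ⟨by omega, ?_⟩
  set m' := Function.update (Function.update (Function.update m (A + 16 * x + 2) 1) (6 * x + 4)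
    (v 11)) (6 * x + 3) (v 11 - (field inp (n + 4) x 4 - field inp (n + 4) x 3)) with hm'
  have e0 : ∀ a, a ≠ A + 16 * x + 2 → a ≠ 6 * x + 4 → a ≠ 6 * x + 3 → m' a = m a :=
    fun a h1 h2 h3 => by
      rw [hm', Function.update_of_ne h3, Function.update_of_ne h2, Function.update_of_ne h1]
  have e2 : m' (A + 16 * x + 2) = 1 := by
    rw [hm']; simp (disch := omega) only [Function.update_of_ne, Function.update_self]
  have e3 : m' (6 * x + 3) = v 11 - (field inp (n + 4) x 4 - field inp (n + 4) x 3) := by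
    rw [hm']; simp (disch := omega) only [Function.update_self]
  have e4 : m' (6 * x + 4) = v 11 := by
    rw [hm']; simp (disch := omega) only [Function.update_of_ne, Function.update_self]
  have em : ∀ z, z ≠ x → m' (A + 16 * z + 2) = m (A + 16 * z + 2) := fun z hz =>
    e0 _ (by omega) (by omega) (by omega)
  refine ⟨⟨?_, ?_, ?_, ?_, ?_, ⟨?_, ?_, ?_, ?_, ?_⟩, ?_, ?_⟩, unmarked_lt hxN.1 hxN.2 hne e2 em⟩
  · exact hv.congr fun i hi => by simp (disch := omega) only [Function.update_of_ne]
  · simp (disch := omega) only [Function.update_of_ne, h5]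
  · rw [Function.update_self]; exact t.parent_mem x hx hr
  · simp (disch := omega) only [Function.update_of_ne, Function.update_self]
    omega
  · rw [Function.update_self]
    exact (hstr ▸ List.prefix_append _ _).trans hpre
  · intro a ha ha'
    rw [e0 a (ha' x) (ha x hxN.1 hxN.2).2 (ha x hxN.1 hxN.2).1]
    exact hl.frame a ha ha'
  · have := h.mem_iff.1 t.root_mem
    rw [e0, e0] <;> try omega
    exact hl.root_label
  · rw [em _ hr.symm]; exact hl.root_marked
  · intro y hy hyr hym
    by_cases hyx : y = x
    · subst hyx
      -- Occurrences are counted from 0, start positions from 1.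
      refine ⟨k - 1, ⟨hpre, fun q hq => ?_⟩, ?_, ?_⟩
      · have := hl.occ _ hx hne q hq; omega
      · rw [e3]; omega
      · rw [e4]; omega
    · have := h.mem_iff.1 hy
      rw [em y hyx] at hym
      rw [e0, e0] <;> try omega
      exact hl.label y hy hyr hym
  · intro y hy hym
    have hyx : y ≠ x := by
      rintro rfl
      exact hym e2
    rw [em y hyx] at hym
    exact hl.occ y hy hym
  · intro y hy hyr hym
    rw [Function.update_self]
    by_cases hyx : y = x
    · right; rw [hyx]
    · rw [em y hyx] at hym
      left
      by_cases hpx : t.parent y = x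
      · rw [hpx, e2]
      · rw [em _ hpx]
        exact (hcl y hy hyr hym).resolve_right hpx
  · left
    by_cases hlx : l = x
    · rw [hlx, e2]
    · rw [em l hlx]
      exact hleaf.resolve_right fun he => hlx he.symm

/-- All climbs from leaves with start positions greater than `v 5` have been completed. -/
structure Climbed (inp : ℕ → ℕ) (S : List ℕ) (n N A : ℕ) (t : EdgeTree) (m₀ : ℕ → ℕ)
    (v m : ℕ → ℕ) : Prop where
  globals : Globals n N A t.root v
  v5 : v 5 ≤ n + 1
  labelled : Labelled inp S N A t m₀ (v 5) m
  closed : ∀ x ∈ t.nodes, x ≠ t.root → m (A + 16 * x + 2) = 1 →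
    m (A + 16 * t.parent x + 2) = 1

/-- The marked nodes are closed under parents before and after a climb, so stopping at the first
marked node misses no ancestor of the leaf. In between, closure may fail only at the current node.
-/
theorem Source.climb (h : Source inp S n N t) (hA : A = 6 * N + 6)
    (hW : A + 16 * (N + n + 3) ≤ W) (hm₀ : Copied inp n N A t.root N m₀) {v m : ℕ → ℕ}
    (hc : Climbed inp S n N A t m₀ v m) (h5 : v 5 ≠ 0) :
    ∃ v' m' τ, Exec inp W climbCmd v m v' m' τ ∧
      τ + 1000 * unmarked A N m' ≤ 1000 * unmarked A N m + 1000 ∧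
      v' 5 + 1 = v 5 ∧ Climbed inp S n N A t m₀ v' m' := by
  obtain ⟨hv, hk, hl, hcl⟩ := hc
  obtain ⟨k, hkdef⟩ : ∃ k, v 5 = k := ⟨_, rfl⟩
  rw [hkdef] at hk hl h5
  obtain ⟨l, hleaf, hl5⟩ := h.exists_leaf (k := k) (by omega) hk
  have hlN := h.mem_iff.1 hleaf.1
  have hlk : m (A + 16 * k) = l := by
    rw [hl.frame _ (fun x _ _ => by omega) (fun z => by omega), ← hl5]
    exact hm₀.leaf l hlN.1 hlN.2 (by omega)
  have hls := h.str_leaf hleaf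
  rw [hl5] at hls
  have h1 : (set 6 (mem (add (var 3) (sixteen (var 5)))) ;; set 11 (off 0 1)).Ends inp W v m
      (set 6 (mem (add (var 3) (sixteen (var 5)))) ;; set 11 (off 0 1)).size
      fun v' m' => Climbing inp S n N A t m₀ k l v' m' ∧ m' = m := by
    apply ends_of_wp
    simp (disch := omega) only [wp, Fits, val, hv.v3, hv.v0, hkdef, hlk,
      Function.update_of_ne, true_and, and_true]
    refine ⟨by omega, by omega, ⟨?_, ?_, ?_, ?_, ?_, hl, ?_, ?_⟩⟩
    · exact hv.congr fun i hi => by simp (disch := omega) only [Function.update_of_ne]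
    · simp (disch := omega) only [Function.update_of_ne, hkdef]
    · simp (disch := omega) only [Function.update_of_ne, Function.update_self, hleaf.1]
    · simp (disch := omega) only [Function.update_of_ne, Function.update_self]
      rw [hls, List.length_drop, h.length]
      omega
    · simp (disch := omega) only [Function.update_of_ne, Function.update_self]
      rw [hls]
    · exact fun x hx hr hm => .inl (hcl x hx hr hm)
    · simp (disch := omega) only [Function.update_of_ne, Function.update_self, or_true]
  obtain ⟨v₁, m₁, τ₁, hex₁, hτ₁, hc₁, rfl⟩ := h1
  obtain ⟨v₂, m₂, τ₂, hex₂, hτ₂, hc₂, hg⟩ := exec_whileNe (inp := inp) (W := W)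
    (a := mem (aux 6 2)) (b := lit 1) (c := GrowingSuffixTree.climbStep)
    (I := Climbing inp S n N A t m₀ k l) (fun _ m => 1000 * unmarked A N m) _ rfl
    (fun v m hI => by
      have := h.mem_iff.1 hI.v6
      refine ⟨?_, ?_, fun hne => ?_⟩
      · simp only [Fits, val, hI.globals.v3, true_and]; omega
      · simp only [Fits]; omega
      · simp only [val, hI.globals.v3] at hne
        obtain ⟨v', m', τ, g1, g2, g3, g4⟩ := h.climbStep hA hW (by omega) hI hne
        have hs : GrowingSuffixTree.climbStep.size + (((mem (aux 6 2)).compile 0).length +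
          ((lit 1).compile 1).length + 2) ≤ 1000 := by decide
        exact ⟨v', m', τ, g1, by omega, g3⟩) hc₁
  simp only [val, hc₂.globals.v3] at hg
  have hcl₂ : ∀ x ∈ t.nodes, x ≠ t.root → m₂ (A + 16 * x + 2) = 1 →
      m₂ (A + 16 * t.parent x + 2) = 1 := by
    intro x hx hr hm
    rcases hc₂.closed x hx hr hm with g | g
    · exact g
    · rw [g]; exact hg
  have hlm : m₂ (A + 16 * l + 2) = 1 := by
    rcases hc₂.leaf with g | g
    · exact g
    · rw [← g]; exact hg
  have h3 : (set 5 (sub (var 5) (lit 1))).Ends inp W v₂ m₂ (set 5 (sub (var 5) (lit 1))).size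
      fun v' m' => v' 5 + 1 = k ∧ m' = m₂ ∧ Climbed inp S n N A t m₀ v' m' := by
    apply ends_of_wp
    simp (disch := omega) only [wp, Fits, val, Function.update_self, hc₂.v5, true_and]
    refine ⟨by omega, by omega, ⟨?_, ?_, ?_, hcl₂⟩⟩
    · exact hc₂.globals.congr fun i hi => by simp (disch := omega) only [Function.update_of_ne]
    · rw [Function.update_self]; omega
    · rw [Function.update_self]
      refine ⟨hc₂.labelled.frame, hc₂.labelled.root_label, hc₂.labelled.root_marked,
        hc₂.labelled.label, fun x hx hxm q hq => ?_⟩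
      have := hc₂.labelled.occ x hx hxm q hq
      -- The only start to be excluded anew is `k - 1`. A node whose string occurs there is an
      -- ancestor of the leaf `l`, and is thus marked by closure.
      by_contra hcon
      obtain rfl : q = k - 1 := by omega
      rw [← hls] at hq
      exact hxm ((h.tree.at_root.anc_of_prefix x hx hleaf.1 hq).closed
        (X := fun x => m₂ (A + 16 * x + 2) = 1) hlm hcl₂)
  obtain ⟨v₃, m₃, τ₃, hex₃, hτ₃, g1, rfl, g3⟩ := h3
  have hs : (set 6 (mem (add (var 3) (sixteen (var 5)))) ;; set 11 (off 0 1)).size +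
    (((mem (aux 6 2)).compile 0).length + ((lit 1).compile 1).length + 2) +
    (set 5 (sub (var 5) (lit 1))).size ≤ 1000 := by decide
  exact ⟨v₃, m₃, _, hex₁.seq (hex₂.seq hex₃), by omega, by omega, g3⟩

theorem Source.climbLoop (h : Source inp S n N t) (hA : A = 6 * N + 6)
    (hW : A + 16 * (N + n + 3) ≤ W) (hm₀ : Copied inp n N A t.root N m₀) {v : ℕ → ℕ}
    (hv : Globals n N A t.root v) :
    climbLoop.Ends inp W v m₀ (1000 * N + 2000 * (n + 1) + 1000) fun v' m' =>
      Globals n N A t.root v' ∧ Labelled inp S N A t m₀ 0 m' := by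
  have hroot := h.mem_iff.1 t.root_mem
  have h1 : (store (aux 2 2) (lit 1) ;; set 5 (off 0 1)).Ends inp W v m₀
      (store (aux 2 2) (lit 1) ;; set 5 (off 0 1)).size
      fun v' m' => v' 5 = n + 1 ∧ Climbed inp S n N A t m₀ v' m' := by
    apply ends_of_wp
    simp (disch := omega) only [wp, Fits, val, Function.update_self, hv.v0, hv.v2, hv.v3, true_and]
    have hz : ∀ x ≠ t.root, Function.update m₀ (A + 16 * t.root + 2) 1 (A + 16 * x + 2) = 0 :=
      fun x hx => by
        rw [Function.update_of_ne (by omega)]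
        exact hm₀.zero x 2 (by omega) (by omega)
    refine ⟨by omega, by omega, by omega, ⟨?_, ?_, ⟨?_, ?_, ?_, ?_, ?_⟩, ?_⟩⟩
    · exact hv.congr fun i hi => by simp (disch := omega) only [Function.update_of_ne]
    · rw [Function.update_self]
    · intro a _ ha
      rw [Function.update_of_ne (ha _)]
    · simp (disch := omega) only [Function.update_of_ne]
      exact hm₀.label_zero _ hroot.1 hroot.2
    · rw [Function.update_self]
    · intro x _ hr hm
      rw [hz x hr] at hm
      omega
    · intro x hx hm q hq
      have hr : x ≠ t.root := by
        rintro rfl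
        rw [Function.update_self] at hm
        exact hm rfl
      rw [Function.update_self, ← h.length]
      -- Initially no occurrence can begin at offset `n + 1` or later, because strings of nodes
      -- other than the root are nonempty.
      by_contra hq'
      rw [List.drop_eq_nil_of_le (by omega), List.prefix_nil, str_eq hx hr] at hq
      exact h.tree.label_ne_nil x hx hr (List.append_eq_nil_iff.1 hq).2
    · intro x _ hr hm
      rw [hz x hr] at hm
      omega
  obtain ⟨v₁, m₁, τ₁, hex₁, hτ₁, h51, hc₁⟩ := h1
  obtain ⟨v₂, m₂, τ₂, hex₂, hτ₂, hc₂, hg⟩ := exec_whileNe (inp := inp) (W := W)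
    (a := var 5) (b := lit 0) (c := climbCmd) (I := Climbed inp S n N A t m₀)
    -- Climbed edges are paid for by newly marked nodes, the constant overhead of each leaf by the
    -- decrease of variable `5`.
    (fun v m => 1000 * unmarked A N m + 2000 * v 5) _ rfl
    (fun v m hI => by
      refine ⟨trivial, Nat.zero_le _, fun hne => ?_⟩
      obtain ⟨v', m', τ, g1, g2, g3, g4⟩ := h.climb hA hW hm₀ hI hne
      have hs : ((var 5).compile 0).length + ((lit 0).compile 1).length + 2 ≤ 1000 := by decide
      exact ⟨v', m', τ, g1, by omega, g4⟩) hc₁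
  have hs : (store (aux 2 2) (lit 1) ;; set 5 (off 0 1)).size +
    (((var 5).compile 0).length + ((lit 0).compile 1).length + 2) ≤ 1000 := by decide
  have hu := unmarked_le A N m₁
  refine ⟨v₂, m₂, _, hex₁.seq hex₂, ?_, hc₂.globals, ?_⟩
  · simp only [h51] at hτ₂
    omega
  · have h5 : v₂ 5 = 0 := hg
    exact h5 ▸ hc₂.labelled

/-- After the climbs, the memory represents the full tree. -/
theorem Source.rep (h : Source inp S n N t) (hA : A = 6 * N + 6)
    (hm₀ : Copied inp n N A t.root N m₀) {m : ℕ → ℕ} (hl : Labelled inp S N A t m₀ 0 m) :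
    Rep S N A m t := by
  -- With `k = 0` an unmarked node would occur nowhere, but every node lies above a leaf.
  have hmark : ∀ x ∈ t.nodes, m (A + 16 * x + 2) = 1 := by
    intro x hx
    by_contra hm
    obtain ⟨l, hll, hxl⟩ := h.tree.at_root.exists_leaf hx
    have := hxl.prefix
    rw [h.str_leaf hll] at this
    exact absurd (hl.occ x hx hm _ this) (by omega)
  have hroot := h.mem_iff.1 t.root_mem
  have e : ∀ a, a < A → a % 6 ≠ 3 → a % 6 ≠ 4 → m a = m₀ a := fun a h1 h2 h3 =>
    hl.frame a (fun x _ _ => by omega) (fun z => by omega)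
  have e' : ∀ z f, f ≠ 2 → f < 16 → m (A + 16 * z + f) = m₀ (A + 16 * z + f) :=
    fun z f h1 h2 => hl.frame _ (fun x _ _ => by omega) (fun z => by omega)
  have key : ∀ x ∈ t.nodes, m (6 * x) = field inp (n + 4) x 0 ∧
      m (6 * x + 1) = field inp (n + 4) x 1 ∧ m (6 * x + 2) = field inp (n + 4) x 2 ∧
      m (6 * x + 5) = field inp (n + 4) x 5 := fun x hx => by
    have := h.mem_iff.1 hx
    rw [e, e, e, e] <;> try omega
    exact hm₀.copy x this.1 this.2
  refine ⟨by omega, fun v hv => h.mem_iff.1 hv, ?_, ?_, ?_, ?_, ?_, ?_, ?_, ?_, ?_⟩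
  · rw [e _ (by omega) (by omega) (by omega), hm₀.m0]
  · rw [e _ (by omega) (by omega) (by omega), hm₀.m1]
  · refine ⟨?_, ?_, hl.root_label⟩
    · rw [(key _ t.root_mem).1]; exact h.stores.root_fields.1
    · rw [(key _ t.root_mem).2.2.1]; exact h.stores.root_fields.2.1
  · intro v hv hr
    rw [(key v hv).1]; exact h.stores.parent_eq v hv hr
  · intro u hu
    obtain ⟨l, h1, h2, h3⟩ := h.stores.children u hu
    have huN := h.mem_iff.1 hu
    refine ⟨l, h1, h2, DChain.of_pointerChain h3 (key u hu).2.1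
      (fun z hz => (key z ((h2 z).1 hz).1).2.2.1) (fun hne => ?_) (fun z hz hne => ?_)⟩
    · rw [e' _ 1 (by omega) (by omega)]
      exact hm₀.ptr1 u huN.1 huN.2 hne
    · have hzN := h.mem_iff.1 ((h2 z).1 hz).1
      rw [e' _ 1 (by omega) (by omega)]
      exact hm₀.ptr2 z hzN.1 hzN.2 hne
  · exact fun v hv hr => hl.label v hv hr (hmark v hv)
  · intro v hv
    rw [(key v hv.1).2.2.2]
    obtain ⟨g1, g2, _⟩ := h.stores.leaf_eq v hv
    exact ⟨g1, g2, h.str_leaf hv⟩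
  · intro v hv hnl
    rw [(key v hv).2.2.2]
    exact h.stores.internal_eq v hv hnl
  · intro v hv
    have hvN := h.mem_iff.1 hv.1
    rw [(key v hv.1).2.2.2]
    refine (e' _ 0 (by omega) (by omega)).trans (hm₀.leaf v hvN.1 hvN.2 ?_)
    have := (h.stores.leaf_eq v hv).1
    omega

end

/-! ### Assembling the preprocessing and the sequence of insertions -/

/-- Delete all leaves but the last one. -/
def deleteLoop : Cmd :=
  (set 5 (lit 1) ;; set 12 (off 3 16)) ;;
  whileNe (var 5) (off 0 1) deleteCmd

/-- The preprocessing. -/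
def prepCmd : Cmd := initCmd ;; copyLoop ;; climbLoop ;; deleteLoop

section

variable {inp : ℕ → ℕ} {S : List ℕ} {n N A W : ℕ} {t : EdgeTree}

theorem Source.deleteLoop (h : Source inp S n N t) (hA : A = 6 * N + 6)
    (hW : A + 16 * (N + n + 3) ≤ W) {m₀ : ℕ → ℕ} (hm₀ : Copied inp n N A t.root N m₀)
    {v m : ℕ → ℕ} (hv : Globals n N A t.root v) (hl : Labelled inp S N A t m₀ 0 m) :
    deleteLoop.Ends inp W v m (2000 * n + 1000) fun v' m' =>
      v' 12 = A + 16 * (n + 1) ∧ Restorable S A m' (n + 1) m' := by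
  have hrep := h.rep hA hm₀ hl
  have hz : ∀ j f, 4 ≤ f → f < 14 → m (A + 16 * j + f) = 0 := fun j f h1 h2 => by
    rw [hl.frame _ (fun x _ _ => by omega) (fun z => by omega)]
    exact hm₀.zero j f (by omega) (by omega)
  have ht : t.IsSuffixTreeAt (S.drop (1 - 1)) t.root := h.tree.at_root
  have h1 : (set 5 (lit 1) ;; set 12 (off 3 16)).Ends inp W v m
      (set 5 (lit 1) ;; set 12 (off 3 16)).size fun v' m' =>
        v' 5 = 1 ∧ DeletedTo S n N A 1 v' m' := by
    apply ends_of_wp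
    simp (disch := omega) only [wp, Fits, val, hv.v3, Function.update_of_ne, Function.update_self,
      true_and]
    refine ⟨by omega, by omega, ⟨?_, ?_, ?_, ?_, ⟨t, ?_, hrep, ht⟩, fun j _ f h1 h2 => hz j f h1 h2,
      ⟨fun m' hm' => hrep.holds ht hm', ?_, trivial⟩⟩⟩
    · simp (disch := omega) only [Function.update_of_ne, hv.v0]
    · simp (disch := omega) only [Function.update_of_ne, hv.v3]
    · simp (disch := omega) only [Function.update_of_ne, Function.update_self]
    · simp only [Function.update_self]
    · simp (disch := omega) only [Function.update_of_ne, hv.v2]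
    · simp (disch := omega) only [hz]
      omega
  obtain ⟨v₁, m₁, τ₁, hex₁, hτ₁, h51, hd₁⟩ := h1
  obtain ⟨v₂, m₂, τ₂, hex₂, hτ₂, ⟨_, _, hd₂⟩, hg⟩ := exec_whileNe (inp := inp) (W := W)
    (a := var 5) (b := off 0 1) (c := deleteCmd)
    (I := fun v m => 1 ≤ v 5 ∧ v 5 ≤ n + 1 ∧ DeletedTo S n N A (v 5) v m)
    (fun v _ => 2000 * (n + 1 - v 5)) _ rfl
    (fun v m ⟨hk, hkn, hI⟩ => by
      refine ⟨trivial, by simp only [Fits, val, hI.v0, true_and]; omega, fun hne => ?_⟩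
      simp only [val, hI.v0] at hne
      obtain ⟨v', m', τ, g1, g2, g3⟩ := hI.delete h.length hk (by omega) hW
      have hs : deleteCmd.size + (((var 5).compile 0).length + ((off 0 1).compile 1).length + 2) ≤
        2000 := by decide
      have h5 := g3.v5
      exact ⟨v', m', τ, g1, by omega, by omega, by omega, by rw [h5]; exact g3⟩)
    ⟨h51.ge, by omega, by rw [h51]; exact hd₁⟩
  have hs : (set 5 (lit 1) ;; set 12 (off 3 16)).size +
    (((var 5).compile 0).length + ((off 0 1).compile 1).length + 2) ≤ 1000 := by decide
  simp only [val, hd₂.v0] at hg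
  rw [hg] at hd₂
  refine ⟨v₂, m₂, _, hex₁.seq hex₂, ?_, hd₂.v12, hd₂.restorable⟩
  simp only [h51] at hτ₂
  omega

theorem Source.prep (h : Source inp S n N t) (hA : A = 6 * N + 6)
    (hW : A + 16 * (N + n + 3) ≤ W) :
    prepCmd.Ends inp W (fun _ => 0) (fun _ => 0) (10000 * (n + 1)) fun v' m' =>
      v' 12 = A + 16 * (n + 1) ∧ Restorable S A m' (n + 1) m' := by
  have hN := h.card_le
  have hs : initCmd.size ≤ 1000 := by decide
  refine Cmd.Ends.mono (T := initCmd.size + (1000 * N + 1000 +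
    (1000 * N + 2000 * (n + 1) + 1000 + (2000 * n + 1000)))) ?_ (by omega) fun _ _ h => h
  refine (h.init hA hW).seq fun v m ⟨g1, g2, g3⟩ => (h.copyLoop hA hW g1 g2 g3).seq
    fun v m ⟨g1, g2⟩ => (h.climbLoop hA hW g2 g1).seq fun v' m' ⟨k1, k2⟩ =>
      h.deleteLoop hA hW g2 k1 k2

theorem Source.exists_stores (h : Source inp S n N t) (hW : 100 * (n + 2) ≤ W) :
    ∃ s : ℕ → Store,
      Program.Runs (prepCmd.compile 0) inp W (10000 * (n + 1)) Store.empty (s (n + 1)) ∧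
      (∀ k, 1 ≤ k → k ≤ n →
        Program.Runs (insertCmd.compile 0) inp W insertCmd.size (s (k + 1)) (s k)) ∧
      ∀ k, 1 ≤ k → k ≤ n + 1 → HoldsSuffixTree (s k).mem S k := by
  have hN := h.card_le
  obtain ⟨A, hA⟩ : ∃ A, A = 6 * N + 6 := ⟨_, rfl⟩
  -- The left side is `22 * N + 16 * n + 54`, at most `60 * n + 98`.
  have hW' : A + 16 * (N + n + 3) ≤ W := by omega
  -- Register `24` holds variable `12`, the log position; it is the only register whose content
  -- matters between two insertions.
  let P : ℕ → Store → Prop := fun k s => s.reg (2 * 12) = A + 16 * k ∧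
    Restorable S A s.mem k s.mem ∧ s.FitsIn W
  have hprep : ∃ s, Program.Runs (prepCmd.compile 0) inp W (10000 * (n + 1)) Store.empty s ∧
      P (n + 1) s := by
    obtain ⟨v, m, τ, hex, hτ, h1, h2⟩ := h.prep hA hW'
    obtain ⟨r, hr, hr'⟩ := hex.runs hτ (r := fun _ => 0) (fun _ => rfl)
      ⟨fun _ => Nat.zero_le _, fun _ => Nat.zero_le _⟩
    exact ⟨_, hr, (hr' 12).trans h1, h2, hr.2.1 ▸ hr.2.2 _ le_rfl⟩
  have hins : ∀ k, k ≤ n → ∀ s, P (k + 1) s → ∃ s',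
      Program.Runs (insertCmd.compile 0) inp W insertCmd.size s s' ∧ P k s' := by
    rintro k hk ⟨r, m⟩ ⟨h1, h2, h3⟩
    obtain ⟨v', m', τ, hex, hτ, g1, g2⟩ := insertCmd_ends (inp := inp) (W := W)
      (v := fun i => r (2 * i)) h1 (by omega) h2
    obtain ⟨r', hr, hr'⟩ := hex.runs hτ (r := r) (fun _ => rfl) h3
    exact ⟨_, hr, (hr' 12).trans g1, g2, hr.2.1 ▸ hr.2.2 _ le_rfl⟩
  obtain ⟨s₀, hs₀, hP₀⟩ := hprep
  choose! f hf using hins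
  -- The store after `i` insertions, so that the required `s k` is `g (n + 1 - k)`.
  let g : ℕ → Store := fun i => Nat.rec s₀ (fun i s => f (n - i) s) i
  have hg : ∀ i ≤ n + 1, P (n + 1 - i) (g i) := by
    intro i
    induction i with
    | zero => exact fun _ => hP₀
    | succ i ih =>
      intro hi
      have := (hf (n - i) (by omega) (g i) (by
        rw [show n - i + 1 = n + 1 - i by omega]; exact ih (by omega))).2
      rw [show n + 1 - (i + 1) = n - i by omega]
      exact this
  refine ⟨fun k => g (n + 1 - k), by simpa [g] using hs₀, fun k hk hkn => ?_, fun k hk hkn => ?_⟩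
  · have h1 := hg (n - k) (by omega)
    rw [show n + 1 - (n - k) = k + 1 by omega] at h1
    have h2 := (hf k hkn _ h1).1
    have h3 : g (n + 1 - k) = f k (g (n - k)) := by
      rw [show n + 1 - k = n - k + 1 by omega]
      change f (n - (n - k)) (g (n - k)) = _
      rw [show n - (n - k) = k by omega]
    simp only [h3, show n + 1 - (k + 1) = n - k by omega]
    exact h2
  · have h1 := hg (n + 1 - k) (by omega)
    rw [show n + 1 - (n + 1 - k) = k by omega] at h1
    exact h1.2.1.holds hk

end

end GrowingSuffixTree

theorem mainTheorem7 (c : ℕ) :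
    ∃ (prep ins : GrowingSuffixTree.Program) (C d : ℕ),
      ∀ (T : List ℕ), (∀ a ∈ T, 1 ≤ a ∧ a ≤ (T.length + 2) ^ c) →
      ∀ (inp : ℕ → ℕ), GrowingSuffixTree.IsInput inp (T.reverse ++ [0]) T.length →
      ∃ (s : ℕ → GrowingSuffixTree.Store) (τ : ℕ → ℕ),
        prep.Runs inp ((T.length + 2) ^ d) (τ (T.length + 1))
          GrowingSuffixTree.Store.empty (s (T.length + 1)) ∧
        (∀ k, 1 ≤ k → k ≤ T.length →
          ins.Runs inp ((T.length + 2) ^ d) (τ k) (s (k + 1)) (s k)) ∧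
        (∀ k, 1 ≤ k → k ≤ T.length + 1 →
          GrowingSuffixTree.HoldsSuffixTree (s k).mem (T.reverse ++ [0]) k) ∧
        (∀ k, 1 ≤ k → k ≤ T.length → τ k ≤ C) ∧
        ∑ k ∈ Finset.Icc 1 (T.length + 1), τ k ≤ C * (T.length + 1) := by
  refine ⟨GrowingSuffixTree.prepCmd.compile 0, GrowingSuffixTree.insertCmd.compile 0,
    10000 + GrowingSuffixTree.insertCmd.size, 8, fun T _ inp hinp => ?_⟩
  obtain ⟨t, N, h1, h2, h3, h4, h5, _, h7⟩ := hinp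
  have hsrc : GrowingSuffixTree.Source inp (T.reverse ++ [0]) T.length N t :=
    ⟨by simp, h1, h2, h3, h4, h5, h7⟩
  -- Here `d = 8` suffices because `2 ^ 7 ≥ 100`.
  have hW : 100 * (T.length + 2) ≤ (T.length + 2) ^ 8 := by
    rw [pow_succ]
    refine Nat.mul_le_mul_right _ (le_trans (by norm_num) (Nat.pow_le_pow_left
      (show 2 ≤ T.length + 2 by omega) 7))
  obtain ⟨s, g1, g2, g3⟩ := hsrc.exists_stores hW
  refine ⟨s, fun k => if k ≤ T.length then GrowingSuffixTree.insertCmd.size else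
    10000 * (T.length + 1), by simpa using g1, fun k hk hkn => ?_, g3, fun k hk hkn => ?_, ?_⟩
  · simp only [if_pos hkn]; exact g2 k hk hkn
  · simp only [if_pos hkn]; omega
  · rw [Finset.sum_Icc_succ_top (by omega), if_neg (by omega),
      Finset.sum_congr rfl fun k hk => if_pos (Finset.mem_Icc.1 hk).2, Finset.sum_const,
      Nat.card_Icc, smul_eq_mul]
    simp only [Nat.add_sub_cancel]
    nlinarith [Nat.zero_le GrowingSuffixTree.insertCmd.size]
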